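/- Let $D\subset\mathbb C^n$ ($n\ge 1$) be a bounded symmetric domain, i.e. a bounded domain on which the group $\mathrm{Aut}(D)$ of biholomorphic self-maps acts transitively and in which every point is an isolated fixed point of an involution in $\mathrm{Aut}(D)$. Let $\Gamma\subset \mathrm{Aut}(D)$ be a discrete subgroup that acts freely on $D$ and whose quotient $M=\Gamma\backslash D$ is compact, let $m\ge 1$, and let $\rho:\Gamma\to U(m)$ be a unitary representation. Write $J(\gamma,z)$ for the complex Jacobian determinant of $\gamma$ at $z$, $\mathcal K$ for the Bergman kernel of $D$, $dV_e$ for Lebesgue measure, $dV(w)=\mathcal K(w,w)\,dV_e(w)$, and $c(D,k)$ for the constant determined by $$c(D,k)\int_D \frac{\mathcal K(z,w)^k\,\mathcal K(w,z)^k}{\mathcal K(w,w)^{k}}\,dV(w)=\mathcal K(z,z)^k\qquad(z\in D).$$ Let $\mathcal A(\Gamma,m,k,\rho)$ be the space of holomorphic maps $F:D\to\mathbb C^m$ with $J(\gamma,z)^kF(\gamma z)=\rho(\gamma)F(z)$ for all $\gamma\in\Gamma$, $z\in D$. For $p\in D$ and $1\le j\le m$ put $$\Theta_p^{(j;k)}(z)=c(D,k)\sum_{\gamma\in\Gamma}J(\gamma,z)^k\,\mathcal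 K(\gamma z,p)^k\,\rho(\gamma^{-1})e_j,$$ where $e_1,\dots,e_m$ is the standard basis of $\mathbb C^m$. Call points $p_1,\dots,p_d\in D$ in general position (for weight $k$) if there are nonzero linear functionals $\varphi_1,\dots,\varphi_d$ on $\mathbb C^m$ such that the functionals $F\mapsto\varphi_l(F(p_l))$, $1\le l\le d$, do not all lie in one hyperplane of the dual space $\mathcal A(\Gamma,m,k,\rho)^*$. Then there is $k_0$ such that for every integer $k\ge k_0$: 1. the series defining $\Theta_p^{(j;k)}(z)$ converges absolutely for all $p,z\in D$ and $1\le j\le m$; 2. $\mathcal A(\Gamma,m,k,\rho)$ is finite-dimensional, and for every $d\ge\dim\mathcal A(\Gamma,m,k,\rho)$ generic $d$-tuples of points of $D$ are in general position: there is a holomorphic function on $D^d$, not identically zero, such that all $(p_1,\dots,p_d)\in D^d$ outside its zero set are in general position; 3. for every $d$ and all points $p_1,\dots,p_d\in D$ in general position, the $\mathbb C$-linear span of $\{\Theta_{p_l}^{(j;k)} : 1\le l\le d,\ 1\le j\le m\}$ is $\mathcal A(\Gamma,m,k,\rho)$. -/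

import Mathlib

open MeasureTheory Topology Filter

noncomputable section

namespace BoundedSymmetric

/-- The group of self-homeomorphisms of a space acts on the space. -/
instance homeomorphMulAction (X : Type*) [TopologicalSpace X] : MulAction (X ≃ₜ X) X where
  smul g x := g x
  one_smul _ := rfl
  mul_smul _ _ _ := rfl

/-- A function on an open set `D` of a complex normed space is holomorphic. The extension by zero
only serves to have a function on the whole space; its values outside `D` play no role. -/
def IsHolomorphic {V E : Type*} [NormedAddCommGroup V] [NormedSpace ℂ V]
    [NormedAddCommGroup E] [NormedSpace ℂ E] {D : Set V} (f : D → E) : Prop :=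
  DifferentiableOn ℂ (Function.extend Subtype.val f 0) D

theorem extend_val {V E : Type*} [Zero E] {D : Set V} (f : D → E) {z : V} (hz : z ∈ D) :
    Function.extend Subtype.val f 0 z = f ⟨z, hz⟩ :=
  Subtype.val_injective.extend_apply f 0 ⟨z, hz⟩

variable {n : ℕ}

/-- The group `Aut(D)` of biholomorphic self-maps of `D ⊆ ℂⁿ`. -/
def Aut (D : Set (Fin n → ℂ)) : Subgroup (D ≃ₜ D) where
  carrier := {g | IsHolomorphic (fun z : D => (g z : Fin n → ℂ)) ∧
    IsHolomorphic (fun z : D => (g⁻¹ z : Fin n → ℂ))}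
  one_mem' := by
    have h : IsHolomorphic (fun z : D => (z : Fin n → ℂ)) :=
      differentiableOn_id.congr fun z hz => extend_val _ hz
    exact ⟨h, h⟩
  mul_mem' := by
    have key : ∀ a b : D ≃ₜ D, IsHolomorphic (fun z : D => (a z : Fin n → ℂ)) →
        IsHolomorphic (fun z : D => (b z : Fin n → ℂ)) →
        IsHolomorphic (fun z : D => ((a * b) z : Fin n → ℂ)) := by
      intro a b ha hb
      have hmaps : Set.MapsTo
          (Function.extend Subtype.val (fun z : D => (b z : Fin n → ℂ)) 0) D D := by
        intro z hz
        rw [extend_val _ hz]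
        exact (b ⟨z, hz⟩).2
      refine (DifferentiableOn.comp ha hb hmaps).congr fun z hz => ?_
      rw [extend_val _ hz, Function.comp_apply, extend_val _ (hmaps hz)]
      have e : (⟨_, hmaps hz⟩ : D) = b ⟨z, hz⟩ :=
        Subtype.ext (extend_val (fun z : D => (b z : Fin n → ℂ)) hz)
      rw [e]
      rfl
    intro a b ha hb
    refine ⟨key a b ha.1 hb.1, ?_⟩
    rw [mul_inv_rev]
    exact key _ _ hb.2 ha.2
  inv_mem' := by
    intro a ha
    refine ⟨ha.2, ?_⟩
    rw [inv_inv]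
    exact ha.1

/-- Bounded symmetric domains `D = G/K` with `G = Aut(D)`: bounded domains in `ℂⁿ` on which
`Aut(D)` acts transitively and each of whose points is an isolated fixed point of an involutive
automorphism. -/
structure IsBoundedSymmetricDomain (D : Set (Fin n → ℂ)) : Prop where
  isOpen : IsOpen D
  isConnected : IsConnected D
  isBounded : Bornology.IsBounded D
  transitive : ∀ p q : D, ∃ g ∈ Aut D, g p = q
  symmetric : ∀ p : D, ∃ s ∈ Aut D, s * s = 1 ∧ s p = p ∧ ∀ᶠ z in 𝓝[≠] p, s z ≠ z

/-- `Γ` is a discrete subgroup of `Aut(D)` (with the compact-open topology) such that `Γ \ D` is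
smooth (`Γ` acts without fixed points) and compact. -/
structure IsCocompactSmooth {D : Set (Fin n → ℂ)} (Γ : Subgroup (D ≃ₜ D)) : Prop where
  le_aut : Γ ≤ Aut D
  discrete : IsDiscrete ((fun g : D ≃ₜ D => (g : C(D, D))) '' (Γ : Set (D ≃ₜ D)))
  free : ∀ g ∈ Γ, ∀ z : D, g z = z → g = 1
  compact : CompactSpace (MulAction.orbitRel.Quotient Γ D)

/-- The complex Jacobian determinant `J(g, z)`. -/
def jac {D : Set (Fin n → ℂ)} (g : D ≃ₜ D) (z : D) : ℂ :=
  (fderiv ℂ (Function.extend Subtype.val (fun w : D => (g w : Fin n → ℂ)) 0) z).det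

/-- Lebesgue measure `dV_e` of `ℂⁿ = ℝ²ⁿ`, restricted to `D`. -/
def euclideanVolume (D : Set (Fin n → ℂ)) : Measure D := Measure.comap Subtype.val volume

/-- `K` is the reproducing kernel of the space of square integrable holomorphic functions on `D`. -/
structure IsBergmanKernel (D : Set (Fin n → ℂ)) (K : D → D → ℂ) : Prop where
  holomorphic : ∀ w, IsHolomorphic fun z => K z w
  memLp : ∀ w, MemLp (fun z => K z w) 2 (euclideanVolume D)
  hermitian : ∀ z w, K z w = starRingEnd ℂ (K w z)
  reproducing : ∀ f : D → ℂ, IsHolomorphic f → MemLp f 2 (euclideanVolume D) →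
    ∀ z, f z = ∫ w : D, f w * K z w ∂(euclideanVolume D)

open Classical in
/-- The Bergman kernel of `D`: the unique function with the property above. -/
def bergmanKernel (D : Set (Fin n → ℂ)) : D → D → ℂ :=
  if h : ∃ K, IsBergmanKernel D K then h.choose else 0

/-- The equation that determines the constant `c(D, k)`; the invariant volume `dV(w)` is
`K(w, w)` times Lebesgue measure. -/
def IsWeightConst (D : Set (Fin n → ℂ)) (k : ℕ) (c : ℂ) : Prop :=
  ∀ z : D, c * ∫ w : D, bergmanKernel D z w ^ k * bergmanKernel D w z ^ k /
    bergmanKernel D w w ^ k * bergmanKernel D w w ∂(euclideanVolume D) =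
      bergmanKernel D z z ^ k

open Classical in
/-- The constant `c(D, k)` for which `c(D, k) K(z, w) ^ k` is the reproducing kernel of the
weighted Bergman space with weight `K(z, z) ^ (-k) dV(z)`. -/
def weightConst (D : Set (Fin n → ℂ)) (k : ℕ) : ℂ :=
  if h : ∃ c, IsWeightConst D k c then h.choose else 0

variable {D : Set (Fin n → ℂ)} {m : ℕ}

/-- The space `A(Γ, m, k, ρ)` of `ℂᵐ`-valued holomorphic automorphic forms of weight `k`. -/
def automorphicForms (Γ : Subgroup (D ≃ₜ D)) (ρ : Γ →* Matrix.unitaryGroup (Fin m) ℂ) (k : ℕ) :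
    Submodule ℂ (D → Fin m → ℂ) where
  carrier := {F | IsHolomorphic F ∧ ∀ (γ : Γ) (z : D),
    jac γ.1 z ^ k • F (γ.1 z) = (ρ γ : Matrix (Fin m) (Fin m) ℂ).mulVec (F z)}
  zero_mem' := by
    refine ⟨(differentiableOn_const (0 : Fin m → ℂ)).congr fun z hz => extend_val _ hz, ?_⟩
    intro γ z
    simp
  add_mem' := by
    rintro F G ⟨hF, hF'⟩ ⟨hG, hG'⟩
    refine ⟨(DifferentiableOn.add hF hG).congr fun z hz => ?_, fun γ z => ?_⟩
    · simp [extend_val _ hz]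
    · simp only [Pi.add_apply, smul_add, Matrix.mulVec_add, hF', hG']
  smul_mem' := by
    rintro c F ⟨hF, hF'⟩
    refine ⟨(DifferentiableOn.const_smul hF c).congr fun z hz => ?_, fun γ z => ?_⟩
    · simp [extend_val _ hz]
    · rw [Pi.smul_apply, Pi.smul_apply, smul_comm, hF', Matrix.mulVec_smul]

/-- The term of index `γ` of the Poincaré series: `ρ(γ⁻¹) T_p(γ z) J(γ, z) ^ k`, where `T_p` has
`j`-th component `K(·, p) ^ k` and all other components zero. -/
def poincareTerm (Γ : Subgroup (D ≃ₜ D)) (ρ : Γ →* Matrix.unitaryGroup (Fin m) ℂ) (k : ℕ)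
    (j : Fin m) (p z : D) (γ : Γ) : Fin m → ℂ :=
  jac γ.1 z ^ k • (ρ γ⁻¹ : Matrix (Fin m) (Fin m) ℂ).mulVec
    (Pi.single j (bergmanKernel D (γ.1 z) p ^ k))

/-- The vector-valued Poincaré series `Θ_p^{(j;k)}`. -/
def poincareSeries (Γ : Subgroup (D ≃ₜ D)) (ρ : Γ →* Matrix.unitaryGroup (Fin m) ℂ) (k : ℕ)
    (j : Fin m) (p : D) : D → Fin m → ℂ :=
  fun z => weightConst D k • ∑' γ : Γ, poincareTerm Γ ρ k j p z γ

/-- The linear functional `F ↦ φ(F(p))` on automorphic forms. Up to a scalar it is the image of the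
point `(p, [φ])` of the projectivized dual bundle of `W = E_ρ ⊗ K_M^k` under the map into the
projective space of the dual of `H⁰(M, W)` given by the dual of the tautological line bundle. -/
def evalFunctional (Γ : Subgroup (D ≃ₜ D)) (ρ : Γ →* Matrix.unitaryGroup (Fin m) ℂ) (k : ℕ)
    (p : D) (φ : Module.Dual ℂ (Fin m → ℂ)) : Module.Dual ℂ (automorphicForms Γ ρ k) :=
  φ ∘ₗ LinearMap.proj p ∘ₗ (automorphicForms Γ ρ k).subtype

/-- The points `p₁, …, p_d` are in general position: there are points `(p_l, [φ_l])` of the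
projectivized dual bundle over them whose images in the projective space of the dual of the space
of automorphic forms do not lie on a common hyperplane. -/
def InGeneralPosition (Γ : Subgroup (D ≃ₜ D)) (ρ : Γ →* Matrix.unitaryGroup (Fin m) ℂ) (k : ℕ)
    {d : ℕ} (p : Fin d → D) : Prop :=
  ∃ φ : Fin d → Module.Dual ℂ (Fin m → ℂ), (∀ l, φ l ≠ 0) ∧
    ¬ ∃ S : Submodule ℂ (Module.Dual ℂ (automorphicForms Γ ρ k)),
      IsCoatom S ∧ ∀ l, evalFunctional Γ ρ k (p l) (φ l) ∈ S

/-- A property of `d`-tuples of points of a domain `D` holds generically: it holds outside the zero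
locus of a holomorphic function on `D × ⋯ × D` that is not identically zero. -/
def HoldsGenerically {d : ℕ} (P : (Fin d → D) → Prop) : Prop :=
  ∃ Φ : (Fin d → Fin n → ℂ) → ℂ, DifferentiableOn ℂ Φ {p | ∀ l, p l ∈ D} ∧
    (∃ p : Fin d → D, Φ (fun l => p l) ≠ 0) ∧
    ∀ p : Fin d → D, Φ (fun l => p l) ≠ 0 → P p

end BoundedSymmetric

end

/-! The threshold `k₀ = 2` works. The heart of the matter is that the Poincaré series represent
evaluations: up to a nonzero factor, the Petersson pairing of a form `F` with `Θ_p^{(j;k)}` is the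
coordinate `F(p)_j` (`apply_eq_zero_of_petersson`). If the series at `p₁, …, p_d` spanned a proper
subspace, some nonzero form `F` would be orthogonal to all of them and so vanish at every `p_l`. All
functionals `G ↦ φ_l(G(p_l))` would then lie in the hyperplane of functionals that kill `F`, against
general position (`span_poincareSeries`).

The pairing is unfolded to an integral over `D` of `F_j` against `K(p, ·)^k`, so a reproducing
formula is needed. The kernel of the weighted Bergman space of weight `k` and the power `K^k`
transform alike under `Aut(D)`. By transitivity their ratio on the diagonal is constant, and
polarization spreads this to `D × D` (`exists_isReproducingKernel_pow`).

The component `F_j` is only known to be `O(K(w,w)^{k/2})`, which need not put it in that space, and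
`reproducing_of_growth` bridges the gap. One may assume that the function `H` in question vanishes
at `z`. For `l ≥ 1` the product `H · K(·, z)^l` does lie in the space of weight `k + l`, and its
reproducing formula at `z` says that the `l`-th moment of `b(w) = |K(z,w)|² / (K(z,z) K(w,w))`,
taken against the integrand, is zero. As `0 ≤ b ≤ 1` and the integrand vanishes where `b` does, the
powers `(1 - b)^N` carry this over to the moment of order zero.

Convergence reduces to weight two, where the mean value inequality and a change of variables bound
the terms by integrals of `|K(·, p)|²` over translates of a ball (`exists_summable_bound_two`). The
translates have bounded overlap because `Γ` acts properly discontinuously, which follows from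
discreteness by means of an `Aut(D)`-invariant pseudodistance. Finite dimension holds because
evaluations are uniformly bounded by an `L²` norm on a compact set that meets every orbit.
Genericity is the nonvanishing of a determinant of values of a basis. -/

open MeasureTheory Topology Filter

noncomputable section

namespace BoundedSymmetric

/-! ### Holomorphic maps between complex normed spaces: limits, derivatives, identity theorem. -/

section SeveralVariables

variable {V E : Type*} [NormedAddCommGroup V] [NormedSpace ℂ V]
  [NormedAddCommGroup E] [NormedSpace ℂ E]

/-- A form of the Schwarz lemma: a bounded holomorphic map on a ball is Lipschitz at the centre. -/
theorem norm_sub_le_of_norm_le_ball {f : V → E} {c z : V} {R M : ℝ}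
    (hd : DifferentiableOn ℂ f (Metric.ball c R)) (hM : ∀ z ∈ Metric.ball c R, ‖f z‖ ≤ M)
    (hz : z ∈ Metric.ball c R) : ‖f z - f c‖ ≤ 2 * M / R * ‖z - c‖ := by
  rw [← dist_eq_norm, ← dist_eq_norm]
  refine Complex.dist_le_div_mul_dist_of_mapsTo_ball hd (fun w hw => ?_) hz
  have hc : c ∈ Metric.ball c R := Metric.mem_ball_self (Metric.pos_of_mem_ball hz)
  rw [Metric.mem_closedBall, dist_eq_norm]
  linarith [norm_sub_le (f w) (f c), hM w hw, hM c hc]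

theorem norm_fderiv_le_of_norm_le_ball {f : V → E} {c : V} {R M : ℝ} (hR : 0 < R)
    (hd : DifferentiableOn ℂ f (Metric.ball c R)) (hM : ∀ z ∈ Metric.ball c R, ‖f z‖ ≤ M) :
    ‖fderiv ℂ f c‖ ≤ 2 * M / R := by
  refine Complex.norm_fderiv_le_div_of_mapsTo_ball hd (fun w hw => ?_) hR
  rw [Metric.mem_closedBall, dist_eq_norm]
  linarith [norm_sub_le (f w) (f c), hM w hw, hM c (Metric.mem_ball_self hR)]

theorem norm_dslope_le_of_norm_le_ball {f : ℂ → E} {c z : ℂ} {R M : ℝ}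
    (hd : DifferentiableOn ℂ f (Metric.ball c R)) (hM : ∀ z ∈ Metric.ball c R, ‖f z‖ ≤ M)
    (hz : z ∈ Metric.ball c R) : ‖dslope f c z‖ ≤ 2 * M / R := by
  refine Complex.norm_dslope_le_div_of_mapsTo_ball hd (fun w hw => ?_) hz
  have hc : c ∈ Metric.ball c R := Metric.mem_ball_self (Metric.pos_of_mem_ball hz)
  rw [Metric.mem_closedBall, dist_eq_norm]
  linarith [norm_sub_le (f w) (f c), hM w hw, hM c hc]

/-- Uniform limits of holomorphic maps between complex normed spaces are holomorphic. -/
theorem differentiableOn_of_tendstoUniformlyOn [CompleteSpace E] {ι : Type*} {l : Filter ι}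
    [l.NeBot] {U : Set V} (hU : IsOpen U) {F : ι → V → E} {f : V → E}
    (hF : ∀ i, DifferentiableOn ℂ (F i) U) (h : TendstoUniformlyOn F f l U) :
    DifferentiableOn ℂ f U := by
  intro z₀ hz₀
  obtain ⟨r, hr, hrt⟩ := Metric.isOpen_iff.1 hU z₀ hz₀
  have hsub : ∀ z ∈ Metric.ball z₀ (r / 2), Metric.ball z (r / 2) ⊆ U := fun z hz =>
    (Metric.ball_subset_ball' (by rw [Metric.mem_ball] at hz; linarith)).trans hrt
  -- The Schwarz lemma on balls of radius `r / 2` turns closeness `ε r / 8` of the maps into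
  -- closeness `ε / 2` of their derivatives.
  have hcau : UniformCauchySeqOn (fun i => fderiv ℂ (F i)) l (Metric.ball z₀ (r / 2)) := by
    intro u hu
    obtain ⟨ε, hε, hεu⟩ := Metric.mem_uniformity_dist.1 hu
    have h1 := h.uniformCauchySeqOn _ (Metric.dist_mem_uniformity (by positivity : 0 < ε * r / 8))
    filter_upwards [h1] with p hp z hz
    apply hεu
    have hd : ∀ i, DifferentiableAt ℂ (F i) z := fun i =>
      (hF i).differentiableAt
        (hU.mem_nhds (hsub z hz (Metric.mem_ball_self (by positivity))))
    rw [dist_eq_norm, ← fderiv_sub (hd _) (hd _)]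
    refine (norm_fderiv_le_of_norm_le_ball (M := ε * r / 8) (half_pos hr)
      (((hF p.1).sub (hF p.2)).mono (hsub z hz)) fun w hw => ?_).trans_lt ?_
    · have h2 := hp w (hsub z hz hw)
      rw [dist_eq_norm] at h2
      exact h2.le
    · rw [div_lt_iff₀ (by positivity)]
      nlinarith [mul_pos hε hr]
  have hlim : ∀ z ∈ Metric.ball z₀ (r / 2), ∃ L, Tendsto (fun i => fderiv ℂ (F i) z) l (𝓝 L) :=
    fun z hz => cauchy_map_iff_exists_tendsto.1 (hcau.cauchy_map hz)
  choose! g' hg' using hlim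
  have := hasFDerivAt_of_tendstoUniformlyOn Metric.isOpen_ball
    (hcau.tendstoUniformlyOn_of_tendsto hg')
    (fun i z hz => ((hF i).differentiableAt (hU.mem_nhds (hsub z hz
      (Metric.mem_ball_self (by positivity))))).hasFDerivAt)
    (fun z hz => h.tendsto_at (hsub z hz (Metric.mem_ball_self (by positivity))))
    (Metric.mem_ball_self (half_pos hr))
  exact this.differentiableAt.differentiableWithinAt

/-- Directional derivatives of holomorphic maps are holomorphic. -/
theorem differentiableOn_fderiv_apply [CompleteSpace E] {U : Set V} (hU : IsOpen U) {f : V → E}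
    (hf : DifferentiableOn ℂ f U) (v : V) : DifferentiableOn ℂ (fun z => fderiv ℂ f z v) U := by
  intro z₀ hz₀
  obtain ⟨ρ, hρ, M, hM⟩ : ∃ ρ > 0, ∃ M, ∀ z ∈ Metric.ball z₀ (2 * ρ), z ∈ U ∧ ‖f z‖ ≤ M := by
    have hc : ContinuousAt f z₀ := (hf.differentiableAt (hU.mem_nhds hz₀)).continuousAt
    have h1 : ∀ᶠ z in 𝓝 z₀, z ∈ U ∧ ‖f z‖ ≤ ‖f z₀‖ + 1 := by
      filter_upwards [hU.mem_nhds hz₀,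
        hc.norm.eventually_lt continuousAt_const (lt_add_one ‖f z₀‖)] with z h1 h2
      exact ⟨h1, h2.le⟩
    obtain ⟨r, hr, h2⟩ := Metric.eventually_nhds_iff_ball.1 h1
    exact ⟨r / 2, half_pos hr, _, by simpa [mul_div_cancel₀] using h2⟩
  set R := ρ / (‖v‖ + 1) with hRdef
  have hv : 0 < ‖v‖ + 1 := by positivity
  have hR : 0 < R := by positivity
  have hRv : R * ‖v‖ < ρ := by
    rw [hRdef, div_mul_eq_mul_div, div_lt_iff₀ hv]
    nlinarith
  have hmem : ∀ z ∈ Metric.ball z₀ ρ, ∀ t ∈ Metric.ball (0 : ℂ) R,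
      z + t • v ∈ Metric.ball z₀ (2 * ρ) := by
    intro z hz t ht
    rw [Metric.mem_ball, dist_eq_norm] at *
    rw [sub_zero] at ht
    calc ‖z + t • v - z₀‖ = ‖(z - z₀) + t • v‖ := by congr 1; abel
      _ ≤ ‖z - z₀‖ + ‖t • v‖ := norm_add_le _ _
      _ < 2 * ρ := by
        rw [norm_smul]
        nlinarith [norm_nonneg v]
  have hφ : ∀ z ∈ Metric.ball z₀ ρ,
      DifferentiableOn ℂ (fun t : ℂ => f (z + t • v)) (Metric.ball 0 R) := by
    intro z hz
    exact hf.comp (by fun_prop) fun t ht => (hM _ (hmem z hz t ht)).1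
  -- Difference quotients in the direction `v` are holomorphic in `z`. Two applications of the
  -- Schwarz lemma, first to the slice and then to its slope, give a rate of convergence to the
  -- derivative that is uniform in `z`.
  have hds : ∀ z ∈ Metric.ball z₀ ρ, ∀ t ∈ Metric.ball (0 : ℂ) R,
      ‖dslope (fun t : ℂ => f (z + t • v)) 0 t - fderiv ℂ f z v‖ ≤
        2 * (2 * M / R) / R * ‖t‖ := by
    intro z hz t ht
    have h1 := norm_sub_le_of_norm_le_ball
      ((Complex.differentiableOn_dslope (Metric.ball_mem_nhds 0 hR)).2 (hφ z hz))
      (fun t ht => norm_dslope_le_of_norm_le_ball (hφ z hz)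
        (fun t ht => (hM _ (hmem z hz t ht)).2) ht) ht
    rw [sub_zero, dslope_same] at h1
    convert h1 using 3
    have hz' : z ∈ U := by simpa using (hM _ (hmem z hz 0 (Metric.mem_ball_self hR))).1
    have h2 : HasFDerivAt f (fderiv ℂ f z) (z + (0 : ℂ) • v) := by
      simpa using (hf.differentiableAt (hU.mem_nhds hz')).hasFDerivAt
    have h3 : HasDerivAt (fun t : ℂ => z + t • v) v 0 := by
      simpa using ((hasDerivAt_id (0 : ℂ)).smul_const v).const_add z
    exact (h2.comp_hasDerivAt (0 : ℂ) h3).deriv.symm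
  set t : ℕ → ℂ := fun N => ((R / (N + 2) : ℝ) : ℂ) with ht_def
  have htn : ∀ N, ‖t N‖ = R / (N + 2) := fun N => by
    rw [ht_def, Complex.norm_real, Real.norm_of_nonneg (by positivity)]
  have ht : ∀ N, t N ∈ Metric.ball (0 : ℂ) R := by
    intro N
    rw [mem_ball_zero_iff, htn, div_lt_iff₀ (by positivity)]
    nlinarith [(Nat.cast_nonneg N : (0 : ℝ) ≤ N)]
  have ht0 : ∀ N, t N ≠ 0 := fun N => by
    rw [← norm_ne_zero_iff, htn]; positivity
  have key : DifferentiableOn ℂ (fun z => fderiv ℂ f z v) (Metric.ball z₀ ρ) := by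
    refine differentiableOn_of_tendstoUniformlyOn (l := atTop) Metric.isOpen_ball
      (F := fun N z => dslope (fun t : ℂ => f (z + t • v)) 0 (t N)) (fun N => ?_) ?_
    · have : (fun z => dslope (fun t : ℂ => f (z + t • v)) 0 (t N)) =
          fun z => (t N)⁻¹ • (f (z + t N • v) - f z) := by
        ext z
        rw [dslope_of_ne _ (ht0 N), slope_def_module]
        simp
      rw [this]
      refine DifferentiableOn.const_smul (DifferentiableOn.sub ?_ ?_) _
      · exact hf.comp (by fun_prop) fun z hz => (hM _ (hmem z hz _ (ht N))).1
      · exact hf.mono fun z hz => by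
          simpa using (hM _ (hmem z hz 0 (Metric.mem_ball_self hR))).1
    · have hlim : Tendsto (fun N => 2 * (2 * M / R) / R * ‖t N‖) atTop (𝓝 0) := by
        have : Tendsto (fun N : ℕ => R / ((N : ℝ) + 2)) atTop (𝓝 0) :=
          tendsto_const_nhds.div_atTop
            (tendsto_atTop_add_const_right _ _ tendsto_natCast_atTop_atTop)
        simpa [htn] using this.const_mul (2 * (2 * M / R) / R)
      rw [Metric.tendstoUniformlyOn_iff]
      intro ε hε
      filter_upwards [hlim.eventually_lt_const hε] with N hN z hz
      rw [dist_comm, dist_eq_norm]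
      exact (hds z hz _ (ht N)).trans_lt hN
  exact (key.differentiableAt (Metric.ball_mem_nhds _ hρ)).differentiableWithinAt

/-- The identity theorem for holomorphic functions of several variables. -/
theorem eq_zero_of_eventually_eq_zero [CompleteSpace E] {U : Set V} (hU : IsOpen U)
    (hc : IsPreconnected U)
    {f : V → E} (hf : DifferentiableOn ℂ f U) {z₀ : V} (hz₀ : z₀ ∈ U) (h0 : ∀ᶠ z in 𝓝 z₀, f z = 0) :
    ∀ z ∈ U, f z = 0 := by
  have key : U ⊆ {z | ∀ᶠ w in 𝓝 z, f w = 0} := by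
    refine hc.subset_of_closure_inter_subset ?_ ⟨z₀, hz₀, h0⟩ ?_
    · exact isOpen_setOfPred_eventually_nhds
    · rintro z ⟨hzc, hzU⟩
      obtain ⟨r, hr, hrU⟩ := Metric.isOpen_iff.1 hU z hzU
      obtain ⟨a, ha, haz⟩ := Metric.mem_closure_iff.1 hzc r hr
      have haB : a ∈ Metric.ball z r := by rwa [Metric.mem_ball, dist_comm]
      refine Filter.mem_of_superset (Metric.ball_mem_nhds z hr) fun u hu => ?_
      -- The complex line through `u` and the nearby point `a` meets the ball in a convex set, where
      -- the identity theorem of one variable applies.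
      set ℓ : ℂ → V := fun t => a + t • (u - a) with hℓ
      have hℓc : Continuous ℓ := by fun_prop
      have hconv : Convex ℝ (ℓ ⁻¹' Metric.ball z r) := by
        intro x hx y hy α β hα hβ hαβ
        have : ℓ (α • x + β • y) = α • ℓ x + β • ℓ y := by
          simp only [hℓ, smul_add, add_smul, smul_assoc]
          have : a = α • a + β • a := by rw [← add_smul, hαβ, one_smul]
          nth_rewrite 1 [this]
          abel
        rw [Set.mem_preimage, this]
        exact convex_ball z r hx hy hα hβ hαβ
      have han : AnalyticOnNhd ℂ (f ∘ ℓ) (ℓ ⁻¹' Metric.ball z r) :=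
        (hf.comp (by fun_prop : DifferentiableOn ℂ ℓ (ℓ ⁻¹' Metric.ball z r))
          fun t ht => hrU ht).analyticOnNhd (Metric.isOpen_ball.preimage hℓc)
      have h0 : (f ∘ ℓ) =ᶠ[𝓝 0] 0 := by
        have : Tendsto ℓ (𝓝 0) (𝓝 a) := by
          have := hℓc.tendsto 0
          simpa [hℓ] using this
        exact this.eventually ha
      have := han.eqOn_zero_of_preconnected_of_eventuallyEq_zero hconv.isPreconnected
        (by simpa [hℓ] using haB) h0 (x := 1) (by simpa [hℓ] using hu)
      simpa [hℓ] using this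
  intro z hz
  exact (key hz).self_of_nhds

end SeveralVariables

/-! ### Polarization: sesquiholomorphic functions are determined by the diagonal. -/

section Polarization

/-- A bounded separately holomorphic function of two variables is differentiable along the
diagonal. -/
theorem differentiableAt_diagonal {ρ M : ℝ} (hρ : 0 < ρ) {f : ℂ → ℂ → ℂ}
    (h1 : ∀ t ∈ Metric.ball (0 : ℂ) ρ, DifferentiableOn ℂ (fun s => f s t) (Metric.ball 0 ρ))
    (h2 : ∀ s ∈ Metric.ball (0 : ℂ) ρ, DifferentiableOn ℂ (f s) (Metric.ball 0 ρ))
    (hM : ∀ s ∈ Metric.ball (0 : ℂ) ρ, ∀ t ∈ Metric.ball (0 : ℂ) ρ, ‖f s t‖ ≤ M) :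
    DifferentiableAt ℂ (fun x => f x x) 0 := by
  have h0 : (0 : ℂ) ∈ Metric.ball (0 : ℂ) ρ := Metric.mem_ball_self hρ
  -- Since `f x x = x * G x + f x 0`, continuity of `G` at `0` is all that is needed; no joint
  -- regularity of `f` is used.
  set G : ℂ → ℂ := fun x => dslope (f x) 0 x with hG
  have hGb : ∀ x ∈ Metric.ball (0 : ℂ) ρ,
      ‖G x - G 0‖ ≤ (2 * (2 * M / ρ) / ρ + 2 * (2 * M / ρ) / ρ) * ‖x‖ := by
    intro x hx
    have e1 : ‖dslope (f x) 0 x - dslope (f x) 0 0‖ ≤ 2 * (2 * M / ρ) / ρ * ‖x - 0‖ :=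
      norm_sub_le_of_norm_le_ball
        ((Complex.differentiableOn_dslope (Metric.ball_mem_nhds 0 hρ)).2 (h2 x hx))
        (fun t ht => norm_dslope_le_of_norm_le_ball (h2 x hx) (hM x hx) ht) hx
    have e2 : ‖dslope (f x) 0 0 - dslope (f 0) 0 0‖ ≤ 2 * (2 * M / ρ * ‖x‖) / ρ := by
      have hd : ∀ y ∈ Metric.ball (0 : ℂ) ρ, DifferentiableAt ℂ (f y) 0 := fun y hy =>
        (h2 y hy).differentiableAt (Metric.ball_mem_nhds 0 hρ)
      have : dslope (f x) 0 0 - dslope (f 0) 0 0 = dslope (f x - f 0) 0 0 := by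
        simp only [dslope_same]
        exact (deriv_sub (hd x hx) (hd 0 h0)).symm
      rw [this]
      refine norm_dslope_le_of_norm_le_ball ((h2 x hx).sub (h2 0 h0)) (fun t ht => ?_) h0
      simpa using norm_sub_le_of_norm_le_ball (h1 t ht) (fun s hs => hM s hs t ht) hx
    calc ‖G x - G 0‖ = ‖(dslope (f x) 0 x - dslope (f x) 0 0) +
          (dslope (f x) 0 0 - dslope (f 0) 0 0)‖ := by simp [hG]
      _ ≤ _ := norm_add_le _ _
      _ ≤ _ := by
        rw [sub_zero] at e1
        refine (add_le_add e1 e2).trans_eq ?_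
        ring
  have hGc : ContinuousAt G 0 := by
    rw [ContinuousAt, tendsto_iff_norm_sub_tendsto_zero]
    refine squeeze_zero' (Eventually.of_forall fun _ => norm_nonneg _)
      (Filter.mem_of_superset (Metric.ball_mem_nhds 0 hρ) hGb) ?_
    have : Continuous fun x : ℂ => (2 * (2 * M / ρ) / ρ + 2 * (2 * M / ρ) / ρ) * ‖x‖ := by
      fun_prop
    simpa using this.tendsto 0
  have hd1 : HasDerivAt (fun x => x * G x) (G 0) 0 := by
    rw [hasDerivAt_iff_tendsto_slope]
    refine (hGc.tendsto.mono_left nhdsWithin_le_nhds).congr' ?_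
    filter_upwards [self_mem_nhdsWithin] with x hx
    rw [slope_def_field]
    have hx' : x ≠ 0 := hx
    field_simp
    simp
  have heq : (fun x => f x x) = fun x => x * G x + f x 0 := by
    ext x
    have := sub_smul_dslope (f x) 0 x
    simp only [sub_zero, smul_eq_mul] at this
    rw [hG]
    simp only [this]
    ring
  rw [heq]
  exact hd1.differentiableAt.add ((h1 0 h0).differentiableAt (Metric.ball_mem_nhds 0 hρ))

/-- A bounded separately holomorphic function of two variables that vanishes on the set
`t = conj s` vanishes. -/
theorem eq_zero_of_conj_diagonal {R M : ℝ} {f : ℂ → ℂ → ℂ}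
    (h1 : ∀ t ∈ Metric.ball (0 : ℂ) R, DifferentiableOn ℂ (fun s => f s t) (Metric.ball 0 R))
    (h2 : ∀ s ∈ Metric.ball (0 : ℂ) R, DifferentiableOn ℂ (f s) (Metric.ball 0 R))
    (hM : ∀ s ∈ Metric.ball (0 : ℂ) R, ∀ t ∈ Metric.ball (0 : ℂ) R, ‖f s t‖ ≤ M)
    (hd : ∀ s ∈ Metric.ball (0 : ℂ) R, f s (starRingEnd ℂ s) = 0) :
    ∀ s ∈ Metric.ball (0 : ℂ) R, ∀ t ∈ Metric.ball (0 : ℂ) R, f s t = 0 := by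
  have hdiff : ∀ a ∈ Metric.ball (0 : ℂ) R, ∀ b ∈ Metric.ball (0 : ℂ) R,
      DifferentiableAt ℂ (fun x => f (a + x) (b + x)) 0 := by
    intro a ha b hb
    obtain ⟨ρ₁, hρ₁, h₁⟩ := Metric.isOpen_iff.1 Metric.isOpen_ball a ha
    obtain ⟨ρ₂, hρ₂, h₂⟩ := Metric.isOpen_iff.1 Metric.isOpen_ball b hb
    have ma : ∀ s ∈ Metric.ball (0 : ℂ) (min ρ₁ ρ₂), a + s ∈ Metric.ball (0 : ℂ) R := by
      intro s hs
      refine h₁ ?_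
      rw [Metric.mem_ball, dist_eq_norm] at *
      simpa using (lt_min_iff.1 hs).1
    have mb : ∀ s ∈ Metric.ball (0 : ℂ) (min ρ₁ ρ₂), b + s ∈ Metric.ball (0 : ℂ) R := by
      intro s hs
      refine h₂ ?_
      rw [Metric.mem_ball, dist_eq_norm] at *
      simpa using (lt_min_iff.1 hs).2
    refine differentiableAt_diagonal (f := fun s t => f (a + s) (b + t)) (M := M)
      (lt_min hρ₁ hρ₂) ?_ ?_ ?_
    · exact fun t ht => (h1 _ (mb t ht)).comp (by fun_prop) ma
    · exact fun s hs => (h2 _ (ma s hs)).comp (by fun_prop) mb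
    · exact fun s hs t ht => hM _ (ma s hs) _ (mb t ht)
  -- For fixed `y` the function `x ↦ f (x + iy) (x - iy)` is holomorphic. For real `x` its two
  -- arguments are conjugate, so it vanishes on a real interval.
  have hreal : ∀ (y : ℝ) (x : ℂ), x + y * Complex.I ∈ Metric.ball (0 : ℂ) R →
      x - y * Complex.I ∈ Metric.ball (0 : ℂ) R →
      f (x + y * Complex.I) (x - y * Complex.I) = 0 := by
    intro y x hx1 hx2
    set W : Set ℂ := {x | x + y * Complex.I ∈ Metric.ball (0 : ℂ) R} ∩
      {x | x - y * Complex.I ∈ Metric.ball (0 : ℂ) R} with hW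
    have hWo : IsOpen W := by
      refine IsOpen.inter (Metric.isOpen_ball.preimage ?_) (Metric.isOpen_ball.preimage ?_) <;>
        fun_prop
    have hWc : Convex ℝ W := by
      refine Convex.inter ?_ ?_
      · exact (convex_ball (0 : ℂ) R).translate_preimage_left (y * Complex.I)
      · simp only [sub_eq_add_neg]
        exact (convex_ball (0 : ℂ) R).translate_preimage_left (-(y * Complex.I))
    have han : AnalyticOnNhd ℂ (fun x => f (x + y * Complex.I) (x - y * Complex.I)) W := by
      refine DifferentiableOn.analyticOnNhd (fun x hx => ?_) hWo
      have h3 := hdiff _ hx.1 _ hx.2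
      have h4 : (fun x' => f (x' + y * Complex.I) (x' - y * Complex.I)) =
          (fun u => f (x + y * Complex.I + u) (x - y * Complex.I + u)) ∘ fun x' => x' - x := by
        ext x'
        simp only [Function.comp]
        congr 1 <;> ring_nf
      rw [h4]
      refine (DifferentiableAt.comp x ?_ (by fun_prop)).differentiableWithinAt
      simpa using h3
    have hzero : ∀ r : ℝ, (r : ℂ) ∈ W →
        f ((r : ℂ) + y * Complex.I) (r - y * Complex.I) = 0 := by
      intro r hr
      have := hd _ hr.1
      simpa [sub_eq_add_neg] using this
    -- The average of `|x + iy|²` and `|x - iy|²` is at least `(re x)² + y²`.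
    have hre : ((x.re : ℝ) : ℂ) ∈ W := by
      have n1 : ∀ r : ℝ, ‖(r : ℂ) + y * Complex.I‖ ^ 2 = r ^ 2 + y ^ 2 := by
        intro r; rw [← Complex.normSq_eq_norm_sq, Complex.normSq_add_mul_I]
      have hxx : (x.re : ℂ) + y * Complex.I ∈ Metric.ball (0 : ℂ) R := by
        rw [mem_ball_zero_iff] at *
        have hR : 0 < R := (norm_nonneg _).trans_lt hx1
        have q1 : ‖x + y * Complex.I‖ ^ 2 = x.re ^ 2 + (x.im + y) ^ 2 := by
          rw [← Complex.normSq_eq_norm_sq, Complex.normSq_apply]; simp; ring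
        have q2 : ‖x - y * Complex.I‖ ^ 2 = x.re ^ 2 + (x.im - y) ^ 2 := by
          rw [← Complex.normSq_eq_norm_sq, Complex.normSq_apply]; simp; ring
        have p1 := pow_lt_pow_left₀ hx1 (norm_nonneg _) two_ne_zero
        have p2 := pow_lt_pow_left₀ hx2 (norm_nonneg _) two_ne_zero
        refine lt_of_pow_lt_pow_left₀ 2 hR.le ?_
        rw [n1]
        nlinarith [sq_nonneg x.im]
      refine ⟨hxx, ?_⟩
      have : (x.re : ℂ) - y * Complex.I = starRingEnd ℂ ((x.re : ℂ) + y * Complex.I) := by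
        simp [sub_eq_add_neg]
      rw [Set.mem_ofPred_eq, this, mem_ball_zero_iff, Complex.norm_conj, ← mem_ball_zero_iff]
      exact hxx
    refine han.eqOn_zero_of_preconnected_of_frequently_eq_zero hWc.isPreconnected hre ?_ ⟨hx1, hx2⟩
    have htend : Tendsto (fun r : ℝ => (r : ℂ)) (𝓝[≠] x.re) (𝓝[≠] (x.re : ℂ)) := by
      refine tendsto_nhdsWithin_iff.2 ⟨?_, ?_⟩
      · exact (Complex.continuous_ofReal.tendsto _).mono_left nhdsWithin_le_nhds
      · filter_upwards [self_mem_nhdsWithin] with r hr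
        simpa using hr
    refine htend.frequently (Eventually.frequently ?_)
    have : ∀ᶠ r : ℝ in 𝓝 x.re, (r : ℂ) ∈ W :=
      (Complex.continuous_ofReal.tendsto _).eventually (hWo.mem_nhds hre)
    filter_upwards [this.filter_mono nhdsWithin_le_nhds] with r hr using hzero r hr
  intro s hs t ht
  have han : AnalyticOnNhd ℂ (f s) (Metric.ball 0 R) := (h2 s hs).analyticOnNhd Metric.isOpen_ball
  refine han.eqOn_zero_of_preconnected_of_frequently_eq_zero
    (convex_ball _ _).isPreconnected hs ?_ ht
  -- With `x = s - iy` the previous step gives `f s (s - 2iy) = 0` for small real `y`, so the zeros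
  -- of `f s` accumulate at `s`.
  have hc : Continuous fun y : ℝ => s - 2 * y * Complex.I := by fun_prop
  have htend : Tendsto (fun y : ℝ => s - 2 * y * Complex.I) (𝓝[≠] 0) (𝓝[≠] s) := by
    refine tendsto_nhdsWithin_iff.2 ⟨?_, ?_⟩
    · have := hc.tendsto 0
      simp only [Complex.ofReal_zero, mul_zero, zero_mul, sub_zero] at this
      exact this.mono_left nhdsWithin_le_nhds
    · filter_upwards [self_mem_nhdsWithin] with r hr
      simpa using hr
  refine htend.frequently (Eventually.frequently ?_)
  have h5 : ∀ᶠ y : ℝ in 𝓝[≠] 0, s - 2 * y * Complex.I ∈ Metric.ball (0 : ℂ) R :=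
    (htend.mono_right nhdsWithin_le_nhds).eventually (Metric.isOpen_ball.mem_nhds hs)
  filter_upwards [h5] with y hy
  have := hreal y (s - y * Complex.I) (by simpa using hs) (by convert hy using 1; ring)
  convert this using 2 <;> ring

/-- Polarization: a locally bounded function that is holomorphic in the first and antiholomorphic
in the second variable is determined by its values on the diagonal. -/
theorem eq_zero_of_diagonal_eq_zero {V : Type*} [NormedAddCommGroup V] [NormedSpace ℂ V]
    {U : Set V} (hU : IsOpen U) (hc : IsPreconnected U) {f : V → V → ℂ}
    (h1 : ∀ w ∈ U, DifferentiableOn ℂ (fun z => f z w) U)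
    (h2 : ∀ z ∈ U, DifferentiableOn ℂ (fun w => starRingEnd ℂ (f z w)) U)
    (hb : ∀ z₀ ∈ U, ∃ r > 0, ∃ M, ∀ z ∈ Metric.ball z₀ r, ∀ w ∈ Metric.ball z₀ r, ‖f z w‖ ≤ M)
    (hd : ∀ z ∈ U, f z z = 0) : ∀ z ∈ U, ∀ w ∈ U, f z w = 0 := by
  intro z hz w hw
  refine eq_zero_of_eventually_eq_zero hU hc (h1 w hw) hw ?_ z hz
  obtain ⟨r₁, hr₁, M, hM⟩ := hb w hw
  obtain ⟨r₂, hr₂, hU₂⟩ := Metric.isOpen_iff.1 hU w hw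
  set r := min r₁ r₂ with hr
  have hr0 : 0 < r := lt_min hr₁ hr₂
  refine Filter.mem_of_superset (Metric.ball_mem_nhds w (half_pos hr0)) fun u hu => ?_
  rw [Metric.mem_ball, dist_eq_norm] at hu
  have hm : ∀ s ∈ Metric.ball (0 : ℂ) 2, w + s • (u - w) ∈ Metric.ball w r := by
    intro s hs
    rw [mem_ball_zero_iff] at hs
    rw [Metric.mem_ball, dist_eq_norm, add_sub_cancel_left, norm_smul]
    nlinarith [norm_nonneg (u - w), norm_nonneg s]
  have hm1 : ∀ s ∈ Metric.ball (0 : ℂ) 2, w + s • (u - w) ∈ Metric.ball w r₁ := fun s hs =>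
    Metric.ball_subset_ball (min_le_left _ _) (hm s hs)
  have hm2 : ∀ s ∈ Metric.ball (0 : ℂ) 2, w + s • (u - w) ∈ U := fun s hs =>
    hU₂ (Metric.ball_subset_ball (min_le_right _ _) (hm s hs))
  have hcj : ∀ s ∈ Metric.ball (0 : ℂ) 2, starRingEnd ℂ s ∈ Metric.ball (0 : ℂ) 2 := by
    intro s hs
    rwa [mem_ball_zero_iff, Complex.norm_conj, ← mem_ball_zero_iff]
  -- On the complex line through `w` and `u`, conjugating the second parameter makes `f` holomorphic
  -- in both, and the diagonal becomes `t = conj s`. Radius `2` leaves room for the evaluation at `s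
  -- = 1`, `t = 0`, which is `f u w`.
  have := eq_zero_of_conj_diagonal (R := 2) (M := M)
    (f := fun s t => f (w + s • (u - w)) (w + starRingEnd ℂ t • (u - w))) ?_ ?_ ?_ ?_
    1 (by simp) 0 (by simp)
  · simpa using this
  · intro t ht
    exact (h1 _ (hm2 _ (hcj t ht))).comp (by fun_prop) hm2
  · intro s hs t ht
    have h3 : DifferentiableOn ℂ
        (fun t : ℂ => starRingEnd ℂ (f (w + s • (u - w)) (w + t • (u - w))))
        (Metric.ball 0 2) := (h2 _ (hm2 s hs)).comp (by fun_prop) hm2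
    have h4 := (h3.differentiableAt (Metric.isOpen_ball.mem_nhds (hcj t ht))).conj_conj
    have h5 : (fun t => f (w + s • (u - w)) (w + (starRingEnd ℂ) t • (u - w))) =
        starRingEnd ℂ ∘ (fun t => starRingEnd ℂ (f (w + s • (u - w)) (w + t • (u - w)))) ∘
          starRingEnd ℂ := by
      ext x
      simp
    rw [Complex.conj_conj] at h4
    rw [h5]
    exact h4.differentiableWithinAt
  · exact fun s hs t ht => hM _ (hm1 s hs) _ (hm1 _ (hcj t ht))
  · intro s hs
    simpa using hd _ (hm2 s hs)

end Polarization

/-! ### Calculus of holomorphic maps defined on the subtype `D`. -/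

section Holomorphic

variable {V E : Type*} [NormedAddCommGroup V] [NormedSpace ℂ V]
  [NormedAddCommGroup E] [NormedSpace ℂ E] {D : Set V}

theorem IsHolomorphic.of_differentiableOn {f : D → E} {F : V → E} (hF : DifferentiableOn ℂ F D)
    (h : ∀ z : D, f z = F z) : IsHolomorphic f :=
  hF.congr fun z hz => by rw [extend_val f hz, h ⟨z, hz⟩]

theorem IsHolomorphic.congr {f g : D → E} (hf : IsHolomorphic f) (h : ∀ z, g z = f z) :
    IsHolomorphic g := by
  rwa [show g = f from funext h]

theorem IsHolomorphic.continuous {f : D → E} (hf : IsHolomorphic f) : Continuous f := by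
  have h := (continuousOn_iff_continuous_domRestrict.1 (DifferentiableOn.continuousOn hf))
  convert h using 1
  ext z
  exact (extend_val f z.2).symm

theorem isHolomorphic_const (c : E) : IsHolomorphic (fun _ : D => c) :=
  .of_differentiableOn (differentiableOn_const c) fun _ => rfl

theorem IsHolomorphic.add {f g : D → E} (hf : IsHolomorphic f) (hg : IsHolomorphic g) :
    IsHolomorphic (fun z => f z + g z) :=
  .of_differentiableOn (DifferentiableOn.add hf hg) fun z => by simp

theorem IsHolomorphic.sub {f g : D → E} (hf : IsHolomorphic f) (hg : IsHolomorphic g) :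
    IsHolomorphic (fun z => f z - g z) :=
  .of_differentiableOn (DifferentiableOn.sub hf hg) fun z => by simp

theorem IsHolomorphic.smul {f : D → ℂ} {g : D → E} (hf : IsHolomorphic f) (hg : IsHolomorphic g) :
    IsHolomorphic (fun z => f z • g z) :=
  .of_differentiableOn (DifferentiableOn.smul hf hg) fun z => by simp

theorem IsHolomorphic.mul {f g : D → ℂ} (hf : IsHolomorphic f) (hg : IsHolomorphic g) :
    IsHolomorphic (fun z => f z * g z) := hf.smul hg

theorem IsHolomorphic.const_mul {f : D → ℂ} (c : ℂ) (hf : IsHolomorphic f) :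
    IsHolomorphic (fun z => c * f z) := (isHolomorphic_const c).mul hf

theorem IsHolomorphic.pow {f : D → ℂ} (hf : IsHolomorphic f) (k : ℕ) :
    IsHolomorphic (fun z => f z ^ k) :=
  .of_differentiableOn (DifferentiableOn.pow hf k) fun z => by simp

theorem IsHolomorphic.inv {f : D → ℂ} (hf : IsHolomorphic f) (h0 : ∀ z, f z ≠ 0) :
    IsHolomorphic (fun z => (f z)⁻¹) :=
  .of_differentiableOn (DifferentiableOn.inv hf fun z hz => by rw [extend_val f hz]; exact h0 _)
    fun z => by simp

theorem IsHolomorphic.sum {ι : Type*} (s : Finset ι) {f : ι → D → E}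
    (hf : ∀ i ∈ s, IsHolomorphic (f i)) : IsHolomorphic (fun z => ∑ i ∈ s, f i z) :=
  .of_differentiableOn (DifferentiableOn.fun_sum hf) fun z => by simp

theorem IsHolomorphic.clm_comp {E' : Type*} [NormedAddCommGroup E'] [NormedSpace ℂ E']
    (L : E →L[ℂ] E') {f : D → E} (hf : IsHolomorphic f) : IsHolomorphic (fun z => L (f z)) :=
  .of_differentiableOn (L.differentiable.comp_differentiableOn hf)
    fun z => by simp

theorem IsHolomorphic.apply {m : ℕ} {f : D → Fin m → ℂ} (hf : IsHolomorphic f) (i : Fin m) :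
    IsHolomorphic (fun z => f z i) :=
  hf.clm_comp (ContinuousLinearMap.proj (R := ℂ) (φ := fun _ : Fin m => ℂ) i)

theorem IsHolomorphic.comp {V' : Type*} [NormedAddCommGroup V'] [NormedSpace ℂ V'] {D' : Set V'}
    {f : D → E} (hf : IsHolomorphic f) {g : D' → D} (hg : IsHolomorphic (fun z => (g z : V))) :
    IsHolomorphic (fun z => f (g z)) := by
  refine .of_differentiableOn (F := Function.extend Subtype.val f 0 ∘
    Function.extend Subtype.val (fun z => (g z : V)) 0) (DifferentiableOn.comp hf hg fun z hz => ?_)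
    fun z => ?_
  · rw [extend_val _ hz]; exact (g _).2
  · rw [Function.comp, extend_val _ z.2, extend_val f (g z).2]

/-- Uniform limits on small balls of holomorphic maps are holomorphic. -/
theorem isHolomorphic_of_tendstoUniformlyOn [CompleteSpace E] (hD : IsOpen D) {ι : Type*}
    {l : Filter ι} [l.NeBot] {F : ι → D → E} {f : D → E} (hF : ∀ i, IsHolomorphic (F i))
    (h : ∀ z : D, ∃ r > 0, TendstoUniformlyOn F f l (Metric.ball z r)) : IsHolomorphic f := by
  intro z hz
  obtain ⟨r, hr, h⟩ := h ⟨z, hz⟩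
  have hU : IsOpen (D ∩ Metric.ball z r) := hD.inter Metric.isOpen_ball
  refine DifferentiableAt.differentiableWithinAt (DifferentiableOn.differentiableAt
    (differentiableOn_of_tendstoUniformlyOn (l := l) hU
      (F := fun i => Function.extend Subtype.val (F i) 0)
      (fun i => (hF i).mono Set.inter_subset_left) ?_)
    (hU.mem_nhds ⟨hz, Metric.mem_ball_self hr⟩))
  rw [Metric.tendstoUniformlyOn_iff] at h ⊢
  intro ε hε
  filter_upwards [h ε hε] with i hi w hw
  rw [extend_val _ hw.1, extend_val _ hw.1]
  exact hi ⟨w, hw.1⟩ hw.2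

/-- Bounded holomorphic maps are Lipschitz at centres of balls in the domain. -/
theorem IsHolomorphic.norm_sub_le {f : D → E} (hf : IsHolomorphic f) {z w : D} {r M : ℝ}
    (hr : Metric.ball (z : V) r ⊆ D) (hM : ∀ u ∈ Metric.ball z r, ‖f u‖ ≤ M)
    (hw : w ∈ Metric.ball z r) : ‖f w - f z‖ ≤ 2 * M / r * dist w z := by
  have := norm_sub_le_of_norm_le_ball (DifferentiableOn.mono hf hr) (M := M) (z := (w : V))
    (fun u hu => by rw [extend_val f (hr hu)]; exact hM ⟨u, hr hu⟩ hu) hw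
  rwa [extend_val f w.2, extend_val f z.2, ← dist_eq_norm (w : V)] at this

end Holomorphic

/-! ### Mean value inequalities over polydiscs. -/

section MeanValue

variable {n : ℕ}

/-- The real determinant of a complex-linear map is the squared modulus of its complex determinant,
which is `1` here. -/
theorem measurePreserving_circle_smul (θ : ℝ) :
    MeasurePreserving (fun u : Fin n → ℂ => Complex.exp (θ * Complex.I) • u) volume volume := by
  set c := Complex.exp (θ * Complex.I) with hc
  have hn : ‖c‖ = 1 := Complex.norm_exp_ofReal_mul_I θ
  set L : (Fin n → ℂ) →ₗ[ℝ] (Fin n → ℂ) :=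
    (LinearMap.lsmul ℂ (Fin n → ℂ) c).restrictScalars ℝ with hL
  have hdet : |LinearMap.det L| = 1 := by
    rw [hL, LinearMap.det_restrictScalars, Algebra.norm_complex_apply]
    have : LinearMap.lsmul ℂ (Fin n → ℂ) c = c • LinearMap.id := by ext; simp
    rw [this, LinearMap.det_smul, LinearMap.det_id, mul_one, Complex.normSq_eq_norm_sq, norm_pow,
      hn]
    simp
  have h0 : LinearMap.det L ≠ 0 := by
    intro h; rw [h] at hdet; simp at hdet
  refine ⟨by fun_prop, ?_⟩
  have := Measure.map_linearMap_addHaar_eq_smul_addHaar (volume : Measure (Fin n → ℂ)) h0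
  rw [abs_inv, hdet, inv_one, ENNReal.ofReal_one, one_smul] at this
  exact this

/-- The sub-mean value property of the modulus of a holomorphic function over polydiscs. -/
theorem enorm_mul_volume_ball_le {f : (Fin n → ℂ) → ℂ} {z : Fin n → ℂ} {r : ℝ}
    (hf : DifferentiableOn ℂ f (Metric.ball z r)) :
    ‖f z‖ₑ * volume (Metric.ball z r) ≤ ∫⁻ w in Metric.ball z r, ‖f w‖ₑ := by
  set g : (Fin n → ℂ) → ENNReal :=
    (Metric.ball 0 r).indicator fun u => ‖f (z + u)‖ₑ with hg
  have hmz : ∀ u ∈ Metric.ball (0 : Fin n → ℂ) r, z + u ∈ Metric.ball z r := by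
    intro u hu
    simpa [dist_eq_norm] using hu
  have hgm : Measurable g := by
    have hc : ContinuousOn (fun u => ‖f (z + u)‖ₑ) (Metric.ball 0 r) :=
      (hf.continuousOn.comp (by fun_prop) hmz).enorm
    classical
    rw [hg, ← Set.piecewise_eq_indicator]
    exact hc.measurable_piecewise continuousOn_const Metric.isOpen_ball.measurableSet
  have hball : ∀ (θ : ℝ) (u : Fin n → ℂ), Complex.exp (θ * Complex.I) • u ∈
      Metric.ball (0 : Fin n → ℂ) r ↔ u ∈ Metric.ball (0 : Fin n → ℂ) r := by
    intro θ u
    rw [mem_ball_zero_iff, mem_ball_zero_iff, norm_smul, Complex.norm_exp_ofReal_mul_I, one_mul]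
  have hgi : ∫⁻ u, g u = ∫⁻ w in Metric.ball z r, ‖f w‖ₑ := by
    rw [hg, lintegral_indicator Metric.isOpen_ball.measurableSet]
    have h1 : MeasurePreserving (fun u : Fin n → ℂ => z + u) volume volume :=
      measurePreserving_add_left volume z
    have h2 := h1.setLIntegral_comp_preimage_emb (MeasurableEquiv.addLeft z).measurableEmbedding
      (fun w => ‖f w‖ₑ) (Metric.ball z r)
    rw [← h2]
    congr 2
    ext u
    simp [dist_eq_norm]
  -- The mean value property in one variable, on the circle through `z + u` in the complex line from
  -- `z`.
  have hpt : ∀ u ∈ Metric.ball (0 : Fin n → ℂ) r, ‖f z‖ₑ * ENNReal.ofReal (2 * Real.pi) ≤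
      ∫⁻ θ in Set.Ioc 0 (2 * Real.pi), g (Complex.exp (θ * Complex.I) • u) := by
    intro u hu
    have hmem : ∀ t ∈ Metric.closedBall (0 : ℂ) 1, z + t • u ∈ Metric.ball z r := by
      intro t ht
      rw [mem_closedBall_zero_iff] at ht
      rw [mem_ball_zero_iff] at hu
      rw [Metric.mem_ball, dist_eq_norm, add_sub_cancel_left, norm_smul]
      nlinarith [norm_nonneg u]
    have hd : DifferentiableOn ℂ (fun t : ℂ => f (z + t • u)) (Metric.closedBall 0 1) :=
      hf.comp (by fun_prop) hmem
    have hdc : DiffContOnCl ℂ (fun t : ℂ => f (z + t • u)) (Metric.ball 0 |1|) := by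
      refine DifferentiableOn.diffContOnCl (hd.mono ?_)
      rw [abs_one]
      exact Metric.closure_ball_subset_closedBall
    have h1 := hdc.circleAverage
    rw [Real.circleAverage_def, intervalIntegral.integral_of_le (by positivity)] at h1
    simp only [zero_smul, add_zero] at h1
    have h2 : ∫ θ in Set.Ioc 0 (2 * Real.pi), f (z + circleMap 0 1 θ • u) =
        (2 * Real.pi) • f z := by
      rw [← h1, smul_smul, mul_inv_cancel₀ (by positivity), one_smul]
    have h3 := enorm_integral_le_lintegral_enorm (μ := volume.restrict (Set.Ioc 0 (2 * Real.pi)))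
      (fun θ => f (z + circleMap 0 1 θ • u))
    rw [h2, enorm_smul, Real.enorm_of_nonneg (by positivity), mul_comm] at h3
    refine h3.trans (le_of_eq (lintegral_congr fun θ => ?_))
    have : circleMap 0 1 θ = Complex.exp (θ * Complex.I) := by simp [circleMap]
    rw [hg, Set.indicator_of_mem ((hball θ u).2 hu), this]
  have hpi : ENNReal.ofReal (2 * Real.pi) ≠ 0 := by
    simp [Real.pi_pos]
  have hmeas2 : Measurable (Function.uncurry fun (u : Fin n → ℂ) (θ : ℝ) =>
      g (Complex.exp (θ * Complex.I) • u)) := by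
    refine hgm.comp ?_
    exact (by fun_prop : Continuous fun p : (Fin n → ℂ) × ℝ =>
      Complex.exp (p.2 * Complex.I) • p.1).measurable
  -- Integrate the circle inequality over `u`, exchange the integrals, and remove the rotation,
  -- which preserves Lebesgue measure.
  have hmain : ‖f z‖ₑ * volume (Metric.ball z r) * ENNReal.ofReal (2 * Real.pi) ≤
      (∫⁻ w in Metric.ball z r, ‖f w‖ₑ) * ENNReal.ofReal (2 * Real.pi) := by
    calc ‖f z‖ₑ * volume (Metric.ball z r) * ENNReal.ofReal (2 * Real.pi)
        = ∫⁻ u in Metric.ball (0 : Fin n → ℂ) r, ‖f z‖ₑ * ENNReal.ofReal (2 * Real.pi) := by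
          rw [setLIntegral_const, Measure.addHaar_ball_center volume z r]
          ring
      _ ≤ ∫⁻ u in Metric.ball (0 : Fin n → ℂ) r,
            ∫⁻ θ in Set.Ioc 0 (2 * Real.pi), g (Complex.exp (θ * Complex.I) • u) :=
          setLIntegral_mono' Metric.isOpen_ball.measurableSet hpt
      _ ≤ ∫⁻ u, ∫⁻ θ in Set.Ioc 0 (2 * Real.pi), g (Complex.exp (θ * Complex.I) • u) :=
          setLIntegral_le_lintegral _ _
      _ = ∫⁻ θ in Set.Ioc 0 (2 * Real.pi), ∫⁻ u, g (Complex.exp (θ * Complex.I) • u) :=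
          lintegral_lintegral_swap hmeas2.aemeasurable
      _ = ∫⁻ θ in Set.Ioc 0 (2 * Real.pi), ∫⁻ u, g u := by
          refine lintegral_congr fun θ => ?_
          exact (measurePreserving_circle_smul θ).lintegral_comp hgm
      _ = _ := by
          rw [setLIntegral_const, hgi, Real.volume_Ioc, sub_zero]
  exact (ENNReal.mul_le_mul_iff_left hpi ENNReal.ofReal_ne_top).1 hmain

variable {D : Set (Fin n → ℂ)}

theorem setLIntegral_euclideanVolume (hD : IsOpen D) {z : D} {r : ℝ}
    (hr : Metric.ball (z : Fin n → ℂ) r ⊆ D) (f : D → ENNReal) :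
    ∫⁻ w in Metric.ball z r, f w ∂(euclideanVolume D) =
      ∫⁻ w in Metric.ball (z : Fin n → ℂ) r, Function.extend Subtype.val f 0 w := by
  have h1 : ∀ w : D, f w = Function.extend Subtype.val f 0 w := fun w => (extend_val f w.2).symm
  rw [show f = fun w : D => Function.extend Subtype.val f 0 w from funext h1, euclideanVolume,
    setLIntegral_subtype hD.measurableSet, ← funext h1]
  congr 2
  ext w
  constructor
  · rintro ⟨u, hu, rfl⟩; exact hu
  · intro hw; exact ⟨⟨w, hr hw⟩, hw, rfl⟩

/-- The square of the modulus of a holomorphic function is bounded by its mean over a polydisc. -/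
theorem IsHolomorphic.sq_enorm_mul_le (hD : IsOpen D) {f : D → ℂ} (hf : IsHolomorphic f) {z : D}
    {r : ℝ} (hr : Metric.ball (z : Fin n → ℂ) r ⊆ D) :
    ‖f z‖ₑ ^ 2 * volume (Metric.ball (0 : Fin n → ℂ) r) ≤
      ∫⁻ w in Metric.ball z r, ‖f w‖ₑ ^ 2 ∂(euclideanVolume D) := by
  have h1 := enorm_mul_volume_ball_le (DifferentiableOn.mono (hf.pow 2) hr)
  rw [extend_val _ z.2, Measure.addHaar_ball_center] at h1
  rw [setLIntegral_euclideanVolume hD hr]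
  simp only [enorm_pow, Subtype.coe_eta] at h1
  refine h1.trans (le_of_eq (setLIntegral_congr_fun Metric.isOpen_ball.measurableSet ?_))
  intro w hw
  simp only [extend_val _ (hr hw), enorm_pow]

end MeanValue

/-! ### Complex Jacobians and change of variables. -/

section Jacobian

theorem differentiableOn_det {V ι : Type*} [NormedAddCommGroup V] [NormedSpace ℂ V] [Fintype ι]
    [DecidableEq ι] {U : Set V} {A : V → Matrix ι ι ℂ}
    (h : ∀ i j, DifferentiableOn ℂ (fun z => A z i j) U) :
    DifferentiableOn ℂ (fun z => (A z).det) U := by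
  have hp : ∀ (s : Finset ι) (σ : ι → ι),
      DifferentiableOn ℂ (fun z => ∏ i ∈ s, A z (σ i) i) U := by
    intro s σ
    induction s using Finset.induction_on with
    | empty => simp
    | insert a s ha ih =>
      simp only [Finset.prod_insert ha]
      exact (h _ _).mul ih
  simp only [Matrix.det_apply]
  exact DifferentiableOn.fun_sum fun σ _ => (hp _ σ).const_smul _

variable {n : ℕ} {D : Set (Fin n → ℂ)}

theorem isHolomorphic_jac (hD : IsOpen D) {g : D ≃ₜ D} (hg : g ∈ Aut D) :
    IsHolomorphic (jac g) := by
  refine .of_differentiableOn (F := fun z => (LinearMap.toMatrix'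
    (fderiv ℂ (Function.extend Subtype.val (fun w : D => (g w : Fin n → ℂ)) 0) z :
      (Fin n → ℂ) →ₗ[ℂ] (Fin n → ℂ))).det) ?_ fun z => ?_
  · refine differentiableOn_det fun i j => ?_
    simp only [LinearMap.toMatrix'_apply]
    exact differentiableOn_pi.1 (differentiableOn_fderiv_apply hD hg.1 _) _
  · rw [LinearMap.det_toMatrix']
    rfl

theorem differentiableAt_extend (hD : IsOpen D) {g : D ≃ₜ D} (hg : g ∈ Aut D) (z : D) :
    DifferentiableAt ℂ (Function.extend Subtype.val (fun w : D => (g w : Fin n → ℂ)) 0) z :=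
  DifferentiableOn.differentiableAt hg.1 (hD.mem_nhds z.2)

theorem jac_mul (hD : IsOpen D) {g h : D ≃ₜ D} (hg : g ∈ Aut D) (hh : h ∈ Aut D) (z : D) :
    jac (g * h) z = jac g (h z) * jac h z := by
  have h1 : (Function.extend Subtype.val (fun w : D => ((g * h) w : Fin n → ℂ)) 0) =ᶠ[𝓝 (z : Fin n → ℂ)]
      Function.extend Subtype.val (fun w : D => (g w : Fin n → ℂ)) 0 ∘
        Function.extend Subtype.val (fun w : D => (h w : Fin n → ℂ)) 0 := by
    filter_upwards [hD.mem_nhds z.2] with w hw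
    rw [Function.comp, extend_val _ hw, extend_val _ hw, extend_val _ (h ⟨w, hw⟩).2]
    rfl
  have h2 : Function.extend Subtype.val (fun w : D => (h w : Fin n → ℂ)) 0 z = h z :=
    extend_val _ z.2
  have h3 := differentiableAt_extend hD hg (h z)
  rw [jac, h1.fderiv_eq, fderiv_comp _ (by rwa [h2]) (differentiableAt_extend hD hh z), h2,
    ContinuousLinearMap.det, ContinuousLinearMap.toLinearMap_comp, LinearMap.det_comp]
  rfl

theorem jac_one (hD : IsOpen D) (z : D) : jac (1 : D ≃ₜ D) z = 1 := by
  have h1 : (Function.extend Subtype.val (fun w : D => ((1 : D ≃ₜ D) w : Fin n → ℂ)) 0)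
      =ᶠ[𝓝 (z : Fin n → ℂ)] id := by
    filter_upwards [hD.mem_nhds z.2] with w hw
    rw [extend_val _ hw]
    rfl
  rw [jac, h1.fderiv_eq, fderiv_id, ContinuousLinearMap.det]
  exact LinearMap.det_id

theorem jac_ne_zero (hD : IsOpen D) {g : D ≃ₜ D} (hg : g ∈ Aut D) (z : D) : jac g z ≠ 0 := by
  have h := jac_mul hD ((Aut D).inv_mem hg) hg z
  rw [inv_mul_cancel, jac_one hD] at h
  exact right_ne_zero_of_mul (h ▸ one_ne_zero)

/-- The change of variables formula for automorphisms. -/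
theorem lintegral_comp_aut (hD : IsOpen D) {g : D ≃ₜ D} (hg : g ∈ Aut D) (f : D → ENNReal) :
    ∫⁻ w, ‖jac g w‖ₑ ^ 2 * f (g w) ∂(euclideanVolume D) = ∫⁻ w, f w ∂(euclideanVolume D) := by
  set G := Function.extend Subtype.val (fun w : D => (g w : Fin n → ℂ)) 0 with hG
  have hGv : ∀ w : D, G w = g w := fun w => extend_val _ w.2
  set F := Function.extend Subtype.val f 0 with hF
  have himg : G '' D = D := by
    ext w
    constructor
    · rintro ⟨u, hu, rfl⟩
      rw [hGv ⟨u, hu⟩]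
      exact (g _).2
    · intro hw
      refine ⟨g.symm ⟨w, hw⟩, (g.symm _).2, ?_⟩
      rw [hGv, g.apply_symm_apply]
  have hinj : Set.InjOn G D := by
    intro u hu v hv huv
    rw [hGv ⟨u, hu⟩, hGv ⟨v, hv⟩] at huv
    simpa using g.injective (Subtype.ext huv)
  have hcov := lintegral_image_eq_lintegral_abs_det_fderiv_mul volume hD.measurableSet
    (f := G) (f' := fun x => (fderiv ℂ G x).restrictScalars ℝ)
    (fun x hx => ((differentiableAt_extend hD hg ⟨x, hx⟩).hasFDerivAt.restrictScalars
      ℝ).hasFDerivWithinAt) hinj F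
  rw [himg, ← lintegral_subtype_comap hD.measurableSet,
    ← lintegral_subtype_comap hD.measurableSet] at hcov
  rw [euclideanVolume]
  refine Eq.trans (lintegral_congr fun w => ?_) (hcov.symm.trans (lintegral_congr fun w => ?_))
  · rw [hGv, hF, extend_val f (g w).2]
    congr 1
    -- The real Jacobian of a holomorphic map is `|J|²`.
    rw [ContinuousLinearMap.det, ContinuousLinearMap.coe_restrictScalars,
      LinearMap.det_restrictScalars, Algebra.norm_complex_apply, Complex.normSq_eq_norm_sq,
      abs_of_nonneg (by positivity), ENNReal.ofReal_pow (norm_nonneg _), ofReal_norm]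
    rfl
  · rw [hF, extend_val f w.2]

/-- This form of the change of variables serves for Bochner integrals as well, and has the shape
that `IsReproducingKernel.covariant` requires. -/
theorem measurePreserving_aut (hD : IsOpen D) {g : D ≃ₜ D} (hg : g ∈ Aut D) :
    MeasurePreserving g ((euclideanVolume D).withDensity fun w => ‖jac g w‖ₑ ^ 2)
      (euclideanVolume D) := by
  refine ⟨g.continuous.measurable, Measure.ext fun s hs => ?_⟩
  have hm : Measurable fun w => ‖jac g w‖ₑ ^ 2 :=
    (isHolomorphic_jac hD hg).continuous.enorm.measurable.pow_const 2
  rw [Measure.map_apply g.continuous.measurable hs,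
    withDensity_apply _ (g.continuous.measurable hs), ← lintegral_indicator_one hs,
    ← lintegral_comp_aut hD hg, ← lintegral_indicator (g.continuous.measurable hs)]
  refine lintegral_congr fun w => ?_
  by_cases h : g w ∈ s <;> simp [Set.indicator, h]

end Jacobian

/-! ### Abstract reproducing kernels of spaces of holomorphic functions. -/

section Kernel

variable {n : ℕ} {D : Set (Fin n → ℂ)}

/-- `K` is the reproducing kernel of the space of holomorphic functions that are square integrable
with respect to `ν`. -/
structure IsReproducingKernel (ν : Measure D) (K : D → D → ℂ) : Prop where
  holomorphic : ∀ w, IsHolomorphic fun z => K z w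
  memLp : ∀ w, MemLp (fun z => K z w) 2 ν
  hermitian : ∀ z w, K z w = starRingEnd ℂ (K w z)
  reproducing : ∀ f : D → ℂ, IsHolomorphic f → MemLp f 2 ν → ∀ z, f z = ∫ w : D, f w * K z w ∂ν

/-- Point evaluations of square integrable holomorphic functions are locally uniformly bounded. -/
def EvalLocallyBounded (ν : Measure D) : Prop :=
  ∀ z : D, ∃ r > 0, ∃ C : ℝ, 0 ≤ C ∧ ∀ f : D → ℂ, IsHolomorphic f → MemLp f 2 ν →
    ∀ w ∈ Metric.ball z r, ‖f w‖ ≤ C * (eLpNorm f 2 ν).toReal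

theorem memLp_two_iff_lintegral {α : Type*} [MeasurableSpace α] {ν : Measure α} {f : α → ℂ}
    (hf : AEStronglyMeasurable f ν) : MemLp f 2 ν ↔ ∫⁻ w, ‖f w‖ₑ ^ 2 ∂ν < ⊤ := by
  rw [MemLp, and_iff_right hf, eLpNorm_lt_top_iff_lintegral_rpow_enorm_lt_top two_ne_zero
    ENNReal.ofNat_ne_top]
  simp

theorem toReal_eLpNorm_two_sq {α : Type*} [MeasurableSpace α] {ν : Measure α} (f : α → ℂ) :
    eLpNorm f 2 ν ^ 2 = ∫⁻ w, ‖f w‖ₑ ^ 2 ∂ν := by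
  rw [eLpNorm_eq_lintegral_rpow_enorm_toReal two_ne_zero ENNReal.ofNat_ne_top, ← ENNReal.rpow_natCast,
    ← ENNReal.rpow_mul]
  simp

/-- Each kernel reproduces the sections of the other, so the integral of `K'(w, u) K(z, w)` can be
evaluated in two ways. -/
theorem IsReproducingKernel.unique {ν : Measure D} {K K' : D → D → ℂ}
    (hK : IsReproducingKernel ν K) (hK' : IsReproducingKernel ν K') : K = K' := by
  ext z u
  rw [hK.hermitian z u, hK'.reproducing _ (hK.holomorphic z) (hK.memLp z) u, ← integral_conj,
    hK.reproducing _ (hK'.holomorphic u) (hK'.memLp u) z]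
  congr 1
  ext w
  rw [map_mul, ← hK.hermitian, ← hK'.hermitian, mul_comm]

/-- The holomorphic classes in `L²(ν)`. -/
def holomorphicL2 (ν : Measure D) : Submodule ℂ (Lp ℂ 2 ν) where
  carrier := {f | ∃ g : D → ℂ, IsHolomorphic g ∧ f =ᵐ[ν] g}
  zero_mem' := ⟨fun _ => 0, isHolomorphic_const 0, Lp.coeFn_zero _ _ _⟩
  add_mem' := by
    rintro f f' ⟨g, hg, hfg⟩ ⟨g', hg', hfg'⟩
    exact ⟨_, hg.add hg', (Lp.coeFn_add f f').trans (hfg.add hfg')⟩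
  smul_mem' := by
    rintro c f ⟨g, hg, hfg⟩
    exact ⟨_, hg.const_mul c, (Lp.coeFn_smul c f).trans (hfg.const_smul c)⟩

/-- Bounded evaluations turn an `L²` Cauchy sequence into a locally uniform one, whose limit is
holomorphic. A subsequence converging almost everywhere identifies that limit with the `L²` limit.
-/
theorem isClosed_holomorphicL2 (hD : IsOpen D) {ν : Measure D} (hb : EvalLocallyBounded ν) :
    IsClosed (holomorphicL2 ν : Set (Lp ℂ 2 ν)) := by
  refine IsSeqClosed.isClosed fun x f hx hlim => ?_
  choose g hg hxg using hx
  have hmem : ∀ i j, MemLp (fun w => g i w - g j w) 2 ν := fun i j =>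
    ((memLp_congr_ae (hxg i)).1 (Lp.memLp _)).sub ((memLp_congr_ae (hxg j)).1 (Lp.memLp _))
  have hnorm : ∀ i j, (eLpNorm (fun w => g i w - g j w) 2 ν).toReal = dist (x i) (x j) := by
    intro i j
    rw [Lp.dist_def]
    congr 1
    exact eLpNorm_congr_ae ((hxg i).sub (hxg j)).symm
  have hcau : ∀ z : D, ∃ r > 0, UniformCauchySeqOn g atTop (Metric.ball z r) := by
    intro z
    obtain ⟨r, hr, C, hC, h⟩ := hb z
    refine ⟨r, hr, Metric.uniformCauchySeqOn_iff.2 fun ε hε => ?_⟩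
    obtain ⟨N, hN⟩ := Metric.cauchySeq_iff.1 hlim.cauchySeq (ε / (C + 1)) (by positivity)
    refine ⟨N, fun i hi j hj w hw => ?_⟩
    rw [dist_eq_norm]
    have h1 := h _ ((hg i).sub (hg j)) (hmem i j) w hw
    rw [hnorm] at h1
    have h2 := hN i hi j hj
    rw [lt_div_iff₀ (by positivity)] at h2
    have h3 : 0 ≤ dist (x i) (x j) := dist_nonneg
    nlinarith
  have hpt : ∀ z, ∃ a, Tendsto (fun i => g i z) atTop (𝓝 a) := by
    intro z
    obtain ⟨r, hr, h⟩ := hcau z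
    exact cauchySeq_tendsto_of_complete (h.cauchySeq (Metric.mem_ball_self hr))
  choose G hG using hpt
  refine ⟨G, isHolomorphic_of_tendstoUniformlyOn (l := atTop) hD hg fun z => ?_, ?_⟩
  · obtain ⟨r, hr, h⟩ := hcau z
    exact ⟨r, hr, h.tendstoUniformlyOn_of_tendsto fun w _ => hG w⟩
  · have h1 : TendstoInMeasure ν (fun i => (x i : D → ℂ)) atTop f :=
      tendstoInMeasure_of_tendsto_Lp hlim
    obtain ⟨ns, hns, h2⟩ := h1.exists_seq_tendsto_ae
    have h3 : ∀ᵐ w ∂ν, ∀ i, x i w = g i w := ae_all_iff.2 hxg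
    filter_upwards [h2, h3] with w hw hw'
    simp only [hw'] at hw
    exact tendsto_nhds_unique hw ((hG w).comp hns.tendsto_atTop)

/-- The space of square integrable holomorphic functions has a reproducing kernel. -/
theorem exists_isReproducingKernel (hD : IsOpen D) {ν : Measure D} [ν.IsOpenPosMeasure]
    (hb : EvalLocallyBounded ν) : ∃ K, IsReproducingKernel ν K := by
  set H := holomorphicL2 ν with hH
  have : CompleteSpace H := (isClosed_holomorphicL2 hD hb).completeSpace_coe
  have hrep : ∀ f : H, ∃ g : D → ℂ, IsHolomorphic g ∧ (f : Lp ℂ 2 ν) =ᵐ[ν] g := fun f => f.2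
  choose rep hol hae using hrep
  -- Continuous functions that agree almost everywhere agree, because open sets have positive
  -- measure; so evaluation is well defined on classes.
  have huniq : ∀ (f : H) (g : D → ℂ), IsHolomorphic g → (f : Lp ℂ 2 ν) =ᵐ[ν] g → rep f = g := by
    intro f g hg hfg
    exact (hol f).continuous.ae_eq_iff_eq ν hg.continuous |>.1 ((hae f).symm.trans hfg)
  have hmem : ∀ f : H, MemLp (rep f) 2 ν := fun f => (memLp_congr_ae (hae f)).1 (Lp.memLp _)
  have hadd : ∀ f g : H, rep (f + g) = fun z => rep f z + rep g z := fun f g =>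
    huniq _ _ ((hol f).add (hol g)) ((Lp.coeFn_add _ _).trans ((hae f).add (hae g)))
  have hsmul : ∀ (c : ℂ) (f : H), rep (c • f) = fun z => c * rep f z := fun c f =>
    huniq _ _ ((hol f).const_mul c) ((Lp.coeFn_smul _ _).trans ((hae f).const_smul c))
  -- Riesz representation of the evaluation at `z`.
  have hev : ∀ z : D, ∃ e : H, ∀ f : H, inner ℂ e f = rep f z := by
    intro z
    obtain ⟨r, hr, C, hC, h⟩ := hb z
    let ev : H →ₗ[ℂ] ℂ :=
      { toFun := fun f => rep f z
        map_add' := fun f g => by rw [hadd]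
        map_smul' := fun c f => by rw [hsmul]; rfl }
    let evc : H →L[ℂ] ℂ := ev.mkContinuous C fun f => by
      refine (h _ (hol f) (hmem f) z (Metric.mem_ball_self hr)).trans_eq ?_
      rw [← eLpNorm_congr_ae (hae f)]
      rfl
    refine ⟨(InnerProductSpace.toDual ℂ H).symm evc, fun f => ?_⟩
    rw [InnerProductSpace.toDual_symm_apply]
    rfl
  choose e he using hev
  have hherm : ∀ z w, rep (e w) z = starRingEnd ℂ (rep (e z) w) := fun z w => by
    rw [← he, ← he]
    exact (inner_conj_symm (𝕜 := ℂ) (e z) (e w)).symm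
  refine ⟨fun z w => rep (e w) z, fun w => hol _, fun w => hmem _, hherm, ?_⟩
  · intro f hf hfm z
    set F : H := ⟨hfm.toLp f, f, hf, hfm.coeFn_toLp⟩ with hF
    have h1 : rep F = f := huniq _ _ hf hfm.coeFn_toLp
    have h2 : f z = inner ℂ (e z) F := by rw [he, h1]
    rw [h2, Submodule.coe_inner, L2.inner_def]
    refine integral_congr_ae ?_
    filter_upwards [hae (e z), hfm.coeFn_toLp] with w hw hw'
    rw [hw, hF, hw', hherm z w, RCLike.inner_apply]

/-- A reproducing kernel is a Gram matrix. -/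
theorem IsReproducingKernel.exists_gram {ν : Measure D} {K : D → D → ℂ}
    (hK : IsReproducingKernel ν K) : ∃ k : D → Lp ℂ 2 ν, (∀ z w, K z w = inner ℂ (k z) (k w)) ∧
      (∀ z, ‖k z‖ = (eLpNorm (fun w => K w z) 2 ν).toReal) ∧
      ∀ f : D → ℂ, IsHolomorphic f → ∀ hf : MemLp f 2 ν, ∀ z, f z = inner ℂ (k z) (hf.toLp f) := by
  have h3 : ∀ f : D → ℂ, IsHolomorphic f → ∀ hf : MemLp f 2 ν, ∀ z,
      f z = inner ℂ ((hK.memLp z).toLp _) (hf.toLp f) := by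
    intro f hf hfm z
    rw [hK.reproducing f hf hfm, L2.inner_def]
    refine integral_congr_ae ?_
    filter_upwards [(hK.memLp z).coeFn_toLp, hfm.coeFn_toLp] with w hw hw'
    rw [hw, hw', hK.hermitian z w, RCLike.inner_apply]
  refine ⟨fun z => (hK.memLp z).toLp _, fun z w => h3 _ (hK.holomorphic w) (hK.memLp w) z,
    fun z => Lp.norm_toLp _ _, h3⟩

theorem IsReproducingKernel.ofReal_norm_self {ν : Measure D} {K : D → D → ℂ}
    (hK : IsReproducingKernel ν K) (z : D) : ((‖K z z‖ : ℝ) : ℂ) = K z z := by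
  obtain ⟨k, hk, -⟩ := hK.exists_gram
  rw [hk, inner_self_eq_norm_sq_to_K]
  simp

theorem IsReproducingKernel.norm_le {ν : Measure D} {K : D → D → ℂ}
    (hK : IsReproducingKernel ν K) (z w : D) : ‖K z w‖ ≤ √‖K z z‖ * √‖K w w‖ := by
  obtain ⟨k, hk, -⟩ := hK.exists_gram
  have h : ∀ z, √‖K z z‖ = ‖k z‖ := by
    intro z
    rw [hk, inner_self_eq_norm_sq_to_K]
    simp
  rw [h, h, hk]
  exact norm_inner_le_norm _ _

theorem IsReproducingKernel.self_ne_zero {ν : Measure D} {K : D → D → ℂ}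
    (hK : IsReproducingKernel ν K) {f : D → ℂ} (hf : IsHolomorphic f) (hfm : MemLp f 2 ν) {z : D}
    (hz : f z ≠ 0) : K z z ≠ 0 := by
  obtain ⟨k, hk, -, h⟩ := hK.exists_gram
  rw [hk, Ne, inner_self_eq_zero]
  intro h0
  rw [h f hf hfm z, h0, inner_zero_left] at hz
  exact hz rfl

/-- Evaluating the section `K(·, z)` at `z` itself gives `‖k z‖² ≤ C ‖k z‖`, and Cauchy–Schwarz does
the rest. -/
theorem IsReproducingKernel.locally_bounded {ν : Measure D} {K : D → D → ℂ}
    (hK : IsReproducingKernel ν K) (hb : EvalLocallyBounded ν) (z₀ : D) :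
    ∃ r > 0, ∃ M, ∀ z ∈ Metric.ball z₀ r, ∀ w ∈ Metric.ball z₀ r, ‖K z w‖ ≤ M := by
  obtain ⟨k, hk, hkn, -⟩ := hK.exists_gram
  obtain ⟨r, hr, C, hC, h⟩ := hb z₀
  have h1 : ∀ z ∈ Metric.ball z₀ r, ‖k z‖ ≤ C := by
    intro z hz
    have h2 := h _ (hK.holomorphic z) (hK.memLp z) z hz
    rw [← hkn] at h2
    have h3 : ‖K z z‖ = ‖k z‖ ^ 2 := by
      rw [hk, inner_self_eq_norm_sq_to_K]
      simp
    rcases (norm_nonneg (k z)).eq_or_lt with h0 | h0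
    · rwa [← h0]
    · rw [h3, pow_two] at h2
      exact le_of_mul_le_mul_right h2 h0
  refine ⟨r, hr, C * C, fun z hz w hw => ?_⟩
  rw [hk]
  exact (norm_inner_le_norm _ _).trans
    (mul_le_mul (h1 z hz) (h1 w hw) (norm_nonneg _) hC)

/-- The local bound makes `K` Lipschitz in its first variable, uniformly in the second, and
hermitian symmetry exchanges the variables. -/
theorem IsReproducingKernel.continuous_diagonal (hD : IsOpen D) {ν : Measure D} {K : D → D → ℂ}
    (hK : IsReproducingKernel ν K) (hb : EvalLocallyBounded ν) : Continuous fun z => K z z := by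
  rw [continuous_iff_continuousAt]
  intro z₀
  obtain ⟨r₁, hr₁, M, hM⟩ := hK.locally_bounded hb z₀
  obtain ⟨r₂, hr₂, hsub⟩ := Metric.isOpen_iff.1 hD z₀ z₀.2
  set r := min r₁ r₂
  have hr : 0 < r := lt_min hr₁ hr₂
  have hsub' : Metric.ball (z₀ : Fin n → ℂ) r ⊆ D :=
    (Metric.ball_subset_ball (min_le_right _ _)).trans hsub
  have hlip : ∀ z ∈ Metric.ball z₀ r, ∀ w ∈ Metric.ball z₀ r,
      ‖K z w - K z₀ w‖ ≤ 2 * M / r * dist z z₀ := fun z hz w hw =>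
    (hK.holomorphic w).norm_sub_le hsub' (fun u hu =>
      hM u (Metric.ball_subset_ball (min_le_left _ _) hu) w
        (Metric.ball_subset_ball (min_le_left _ _) hw)) hz
  rw [ContinuousAt, tendsto_iff_norm_sub_tendsto_zero]
  refine squeeze_zero' (Eventually.of_forall fun _ => norm_nonneg _)
    (g := fun z => 2 * M / r * dist z z₀ + 2 * M / r * dist z z₀)
    (Filter.mem_of_superset (Metric.ball_mem_nhds z₀ hr) fun z hz => ?_) ?_
  · have h1 := hlip z hz z hz
    have h2 := hlip z hz z₀ (Metric.mem_ball_self hr)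
    have h3 : ‖K z₀ z - K z₀ z₀‖ = ‖K z z₀ - K z₀ z₀‖ := by
      rw [← Complex.norm_conj, map_sub, ← hK.hermitian, ← hK.hermitian]
    calc ‖K z z - K z₀ z₀‖ = ‖(K z z - K z₀ z) + (K z₀ z - K z₀ z₀)‖ := by congr 1; ring
      _ ≤ _ := norm_add_le _ _
      _ ≤ _ := add_le_add h1 (h3.trans_le h2)
  · have : Continuous fun z : D => 2 * M / r * dist z z₀ + 2 * M / r * dist z z₀ := by fun_prop
    simpa using this.tendsto z₀

theorem lintegral_comp_of_measurePreserving {ν : Measure D} {g : D ≃ₜ D} {a : D → ℂ} (ha : Measurable a)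
    (hmp : MeasurePreserving g (ν.withDensity fun w => ‖a w‖ₑ ^ 2) ν)
    (f : D → ENNReal) : ∫⁻ w, ‖a w‖ₑ ^ 2 * f (g w) ∂ν = ∫⁻ w, f w ∂ν := by
  rw [← hmp.lintegral_comp_emb g.measurableEmbedding f,
    lintegral_withDensity_eq_lintegral_mul_non_measurable _ (ha.enorm.pow_const 2)
      (Eventually.of_forall fun w => by finiteness)]
  rfl

theorem integral_comp_of_measurePreserving {E : Type*} [NormedAddCommGroup E] [NormedSpace ℝ E]
    {ν : Measure D} {g : D ≃ₜ D} {a : D → ℂ} (ha : Measurable a)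
    (hmp : MeasurePreserving g (ν.withDensity fun w => ‖a w‖ₑ ^ 2) ν) (f : D → E) :
    ∫ w, (‖a w‖ ^ 2 : ℝ) • f (g w) ∂ν = ∫ w, f w ∂ν := by
  rw [← hmp.integral_comp g.measurableEmbedding f, integral_withDensity_eq_integral_toReal_smul
    (ha.enorm.pow_const 2) (Eventually.of_forall fun w => by finiteness)]
  simp

/-- Transformation rule of reproducing kernels under automorphisms that act unitarily through a
multiplier. -/
theorem IsReproducingKernel.covariant {ν : Measure D} {K : D → D → ℂ}
    (hK : IsReproducingKernel ν K) {g : D ≃ₜ D} (hg : g ∈ Aut D) {a : D → ℂ}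
    (ha : IsHolomorphic a) (ha0 : ∀ z, a z ≠ 0)
    (hmp : MeasurePreserving g (ν.withDensity fun w => ‖a w‖ₑ ^ 2) ν) (z w : D) :
    K (g z) (g w) * a z * starRingEnd ℂ (a w) = K z w := by
  have hL := lintegral_comp_of_measurePreserving ha.continuous.measurable hmp
  have hI := integral_comp_of_measurePreserving (E := ℂ) ha.continuous.measurable hmp
  have hgi : IsHolomorphic (fun z => (g⁻¹ z : Fin n → ℂ)) := hg.2
  have hgg : ∀ z, g⁻¹ (g z) = z := fun z => g.symm_apply_apply z
  have key : IsReproducingKernel ν fun z w => K (g z) (g w) * a z * starRingEnd ℂ (a w) := by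
    have hhol : ∀ w, IsHolomorphic fun z => K (g z) (g w) * a z * starRingEnd ℂ (a w) := fun w =>
      (((hK.holomorphic (g w)).comp hg.1).mul ha).mul (isHolomorphic_const _)
    refine ⟨hhol, fun w => ?_, fun z w => ?_, fun f hf hfm z => ?_⟩
    · refine MemLp.mul_const ?_ _
      rw [memLp_two_iff_lintegral (((hK.holomorphic (g w)).comp hg.1).mul
        ha).continuous.aestronglyMeasurable]
      have h1 := (memLp_two_iff_lintegral (hK.memLp (g w)).1).1 (hK.memLp (g w))
      rw [← hL] at h1
      refine lt_of_eq_of_lt (lintegral_congr fun z => ?_) h1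
      rw [enorm_mul, mul_pow, mul_comm]
    · rw [map_mul, map_mul, ← hK.hermitian, Complex.conj_conj]
      ring
    -- Pull `f` back by the inverse of the unitary action `h ↦ a · (h ∘ g)`, reproduce there, and
    -- change variables. Uniqueness then identifies the transported kernel with `K`.
    · set h : D → ℂ := fun u => f (g⁻¹ u) * (a (g⁻¹ u))⁻¹ with hh
      have hhol : IsHolomorphic h := (hf.comp hgi).mul ((ha.comp hgi).inv fun z => ha0 _)
      have hhm : MemLp h 2 ν := by
        rw [memLp_two_iff_lintegral hhol.continuous.aestronglyMeasurable, ← hL]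
        refine lt_of_eq_of_lt (lintegral_congr fun u => ?_)
          ((memLp_two_iff_lintegral hfm.1).1 hfm)
        rw [hh]
        simp only [hgg]
        rw [← mul_pow, ← enorm_mul]
        congr 2
        field_simp [ha0 u]
      have h1 := hK.reproducing h hhol hhm (g z)
      rw [← hI] at h1
      simp only [hh, hgg] at h1
      have h2 : f z = a z * (f z * (a z)⁻¹) := by field_simp [ha0 z]
      rw [h2, h1, ← integral_const_mul]
      congr 1
      ext u
      have h3 : ((‖a u‖ ^ 2 : ℝ) : ℂ) = a u * starRingEnd ℂ (a u) := by
        rw [Complex.mul_conj, Complex.normSq_eq_norm_sq]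
      rw [Complex.real_smul, h3]
      field_simp [ha0 u]
  exact congr_fun₂ (key.unique hK) z w

end Kernel

/-! ### The Bergman kernel and its weighted spaces. -/

section Bergman

variable {n : ℕ} {D : Set (Fin n → ℂ)}

theorem isOpenPosMeasure_euclideanVolume (hD : IsOpen D) :
    (euclideanVolume D).IsOpenPosMeasure := by
  refine ⟨fun U hU hne => ?_⟩
  rw [euclideanVolume, comap_subtype_coe_apply hD.measurableSet]
  exact (hD.isOpenMap_subtype_val U hU).measure_ne_zero _ (hne.image _)

theorem isFiniteMeasure_euclideanVolume (hD : IsOpen D) (hb : Bornology.IsBounded D) :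
    IsFiniteMeasure (euclideanVolume D) := by
  refine ⟨?_⟩
  rw [euclideanVolume, comap_subtype_coe_apply hD.measurableSet, Set.image_univ,
    Subtype.range_coe]
  exact hb.measure_lt_top

/-- Lebesgue measure on `D` with a weight. -/
def weightedVolume (D : Set (Fin n → ℂ)) (ω : D → ℝ) : Measure D :=
  (euclideanVolume D).withDensity fun w => ENNReal.ofReal (ω w)

theorem weightedVolume_one : weightedVolume D (fun _ => 1) = euclideanVolume D := by
  simp [weightedVolume]

theorem isOpenPosMeasure_weightedVolume (hD : IsOpen D) {ω : D → ℝ} (hω : Continuous ω)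
    (h0 : ∀ w, 0 < ω w) : (weightedVolume D ω).IsOpenPosMeasure := by
  have := isOpenPosMeasure_euclideanVolume hD
  refine (withDensity_absolutelyContinuous' ?_ ?_).isOpenPosMeasure
  · exact hω.measurable.ennreal_ofReal.aemeasurable
  · exact Eventually.of_forall fun w => by simpa using h0 w

/-- Mean value inequality on a polydisc where the weight is at least half its value at the centre.
The radius is half the available one, so that it serves at every point of the smaller ball. -/
theorem evalLocallyBounded_weightedVolume (hD : IsOpen D) {ω : D → ℝ} (hω : Continuous ω)
    (h0 : ∀ w, 0 < ω w) : EvalLocallyBounded (weightedVolume D ω) := by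
  intro z
  obtain ⟨r₁, hr₁, hsub⟩ := Metric.isOpen_iff.1 hD z z.2
  obtain ⟨r₂, hr₂, hlow⟩ := Metric.eventually_nhds_iff_ball.1
    (hω.continuousAt.eventually_const_lt (half_lt_self (h0 z)))
  set r := min r₁ r₂ / 2 with hr
  have hr0 : 0 < r := by positivity
  set v := volume (Metric.ball (0 : Fin n → ℂ) r) with hv
  have hv0 : v ≠ 0 := (Metric.measure_ball_pos _ _ hr0).ne'
  have hvt : v ≠ ⊤ := measure_ball_lt_top.ne
  set c := ENNReal.ofReal (ω z / 2) with hc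
  have hc0 : c ≠ 0 := by simpa [hc] using h0 z
  have hct : c ≠ ⊤ := ENNReal.ofReal_ne_top
  refine ⟨r, hr0, √((c * v)⁻¹).toReal, Real.sqrt_nonneg _, fun f hf hfm w hw => ?_⟩
  have hw' : dist w z < r := hw
  have hsub' : Metric.ball (w : Fin n → ℂ) r ⊆ D := by
    refine (Metric.ball_subset_ball' ?_).trans hsub
    have : min r₁ r₂ ≤ r₁ := min_le_left _ _
    have h2 : dist (w : Fin n → ℂ) z < r := hw
    linarith
  have hlow' : ∀ u ∈ Metric.ball w r, ω z / 2 ≤ ω u := by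
    intro u hu
    refine (hlow u ?_).le
    have : min r₁ r₂ ≤ r₂ := min_le_right _ _
    rw [Metric.mem_ball] at hu ⊢
    linarith [dist_triangle u w z]
  have h1 := hf.sq_enorm_mul_le hD hsub'
  have h2 : c * ∫⁻ u in Metric.ball w r, ‖f u‖ₑ ^ 2 ∂(euclideanVolume D) ≤
      eLpNorm f 2 (weightedVolume D ω) ^ 2 := by
    rw [toReal_eLpNorm_two_sq, weightedVolume,
      lintegral_withDensity_eq_lintegral_mul_non_measurable _ hω.measurable.ennreal_ofReal
        (Eventually.of_forall fun w => ENNReal.ofReal_lt_top), ← lintegral_const_mul' _ _ hct]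
    refine le_trans ?_ (setLIntegral_le_lintegral (Metric.ball w r) _)
    refine setLIntegral_mono' Metric.isOpen_ball.measurableSet fun u hu => ?_
    exact mul_le_mul_left (ENNReal.ofReal_le_ofReal (hlow' u hu)) _
  have h3 : ‖f w‖ₑ ^ 2 * (c * v) ≤ eLpNorm f 2 (weightedVolume D ω) ^ 2 := by
    refine le_trans ?_ h2
    calc ‖f w‖ₑ ^ 2 * (c * v) = c * (‖f w‖ₑ ^ 2 * v) := by ring
      _ ≤ _ := mul_le_mul_right h1 _
  have h4 : ‖f w‖ₑ ^ 2 ≤ (c * v)⁻¹ * eLpNorm f 2 (weightedVolume D ω) ^ 2 := by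
    rw [mul_comm, ← div_eq_mul_inv, ENNReal.le_div_iff_mul_le (Or.inl (mul_ne_zero hc0 hv0))
      (Or.inl (ENNReal.mul_ne_top hct hvt))]
    exact h3
  have h5 := ENNReal.toReal_mono (by
    refine ENNReal.mul_ne_top (ENNReal.inv_ne_top.2 (mul_ne_zero hc0 hv0)) ?_
    exact ENNReal.pow_ne_top hfm.2.ne) h4
  rw [ENNReal.toReal_pow, ENNReal.toReal_mul, ENNReal.toReal_pow, toReal_enorm] at h5
  rw [← Real.sqrt_sq (norm_nonneg (f w))]
  refine (Real.sqrt_le_sqrt h5).trans_eq ?_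
  rw [Real.sqrt_mul ENNReal.toReal_nonneg, Real.sqrt_sq ENNReal.toReal_nonneg]

theorem isReproducingKernel_bergmanKernel (hD : IsOpen D) :
    IsReproducingKernel (euclideanVolume D) (bergmanKernel D) := by
  have h : ∃ K, IsBergmanKernel D K := by
    have := isOpenPosMeasure_euclideanVolume hD
    have hb := evalLocallyBounded_weightedVolume hD (ω := fun _ => 1) continuous_const
      fun _ => one_pos
    rw [weightedVolume_one] at hb
    obtain ⟨K, hK⟩ := exists_isReproducingKernel hD hb
    exact ⟨K, hK.1, hK.2, hK.3, hK.4⟩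
  rw [bergmanKernel, dif_pos h]
  have := h.choose_spec
  exact ⟨this.1, this.2, this.3, this.4⟩

/-- The square root of the Bergman kernel on the diagonal. -/
def bergmanRoot (D : Set (Fin n → ℂ)) (z : D) : ℝ := √‖bergmanKernel D z z‖

theorem continuous_bergmanRoot (hD : IsOpen D) : Continuous (bergmanRoot D) := by
  have hb := evalLocallyBounded_weightedVolume hD (ω := fun _ => 1) continuous_const
    fun _ => one_pos
  rw [weightedVolume_one] at hb
  exact ((isReproducingKernel_bergmanKernel hD).continuous_diagonal hD hb).norm.sqrt

theorem bergmanKernel_self (hD : IsOpen D) (z : D) :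
    bergmanKernel D z z = ((bergmanRoot D z ^ 2 : ℝ) : ℂ) := by
  rw [bergmanRoot, Real.sq_sqrt (norm_nonneg _)]
  exact ((isReproducingKernel_bergmanKernel hD).ofReal_norm_self z).symm

theorem bergmanRoot_pos (hD : IsOpen D) (hb : Bornology.IsBounded D) (z : D) :
    0 < bergmanRoot D z := by
  have := isFiniteMeasure_euclideanVolume hD hb
  refine Real.sqrt_pos.2 (norm_pos_iff.2 ?_)
  exact (isReproducingKernel_bergmanKernel hD).self_ne_zero (isHolomorphic_const 1)
    (memLp_const 1) one_ne_zero

theorem norm_bergmanKernel_le (hD : IsOpen D) (z w : D) :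
    ‖bergmanKernel D z w‖ ≤ bergmanRoot D z * bergmanRoot D w :=
  (isReproducingKernel_bergmanKernel hD).norm_le z w

theorem bergmanKernel_aut (hD : IsOpen D) {g : D ≃ₜ D} (hg : g ∈ Aut D) (z w : D) :
    bergmanKernel D (g z) (g w) * jac g z * starRingEnd ℂ (jac g w) = bergmanKernel D z w :=
  (isReproducingKernel_bergmanKernel hD).covariant hg (isHolomorphic_jac hD hg)
    (jac_ne_zero hD hg) (measurePreserving_aut hD hg) z w

theorem bergmanRoot_aut (hD : IsOpen D) {g : D ≃ₜ D} (hg : g ∈ Aut D) (z : D) :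
    bergmanRoot D (g z) * ‖jac g z‖ = bergmanRoot D z := by
  have h := congr_arg norm (bergmanKernel_aut hD hg z z)
  rw [norm_mul, norm_mul, Complex.norm_conj] at h
  rw [bergmanRoot, bergmanRoot, ← h, mul_assoc, Real.sqrt_mul (norm_nonneg _),
    Real.sqrt_mul_self (norm_nonneg _)]

/-- The weight `K(w, w) ^ (-k) K(w, w)`. -/
def bergmanWeight (D : Set (Fin n → ℂ)) (k : ℕ) (w : D) : ℝ :=
  bergmanRoot D w ^ 2 / bergmanRoot D w ^ (2 * k)

theorem continuous_bergmanWeight (hD : IsOpen D) (hb : Bornology.IsBounded D) (k : ℕ) :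
    Continuous (bergmanWeight D k) :=
  ((continuous_bergmanRoot hD).pow _).div ((continuous_bergmanRoot hD).pow _) fun w =>
    (pow_pos (bergmanRoot_pos hD hb w) _).ne'

theorem bergmanWeight_pos (hD : IsOpen D) (hb : Bornology.IsBounded D) (k : ℕ) (w : D) :
    0 < bergmanWeight D k w :=
  div_pos (pow_pos (bergmanRoot_pos hD hb w) _) (pow_pos (bergmanRoot_pos hD hb w) _)

/-- `K(w,w) dV_e` is invariant and `K(w,w)` scales by `|J|⁻²`. Hence `f ↦ J^k · (f ∘ g)` is unitary
on the weighted Bergman space, whose kernel is therefore covariant with multiplier `J^k`. -/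
theorem bergmanWeight_aut (hD : IsOpen D) (hb : Bornology.IsBounded D) (k : ℕ) {g : D ≃ₜ D}
    (hg : g ∈ Aut D) (w : D) :
    ‖jac g w‖ ^ (2 * k) * bergmanWeight D k w = ‖jac g w‖ ^ 2 * bergmanWeight D k (g w) := by
  have h1 := bergmanRoot_aut hD hg w
  have h2 := bergmanRoot_pos hD hb (g w)
  have h3 : 0 < ‖jac g w‖ := norm_pos_iff.2 (jac_ne_zero hD hg w)
  rw [bergmanWeight, bergmanWeight, ← h1, mul_pow, mul_pow]
  field_simp

theorem measurePreserving_weighted (hD : IsOpen D) (hb : Bornology.IsBounded D) (k : ℕ)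
    {g : D ≃ₜ D} (hg : g ∈ Aut D) :
    MeasurePreserving g
      ((weightedVolume D (bergmanWeight D k)).withDensity fun w => ‖jac g w ^ k‖ₑ ^ 2)
      (weightedVolume D (bergmanWeight D k)) := by
  refine ⟨g.continuous.measurable, Measure.ext fun s hs => ?_⟩
  have hm : Measurable fun w => ‖jac g w ^ k‖ₑ ^ 2 :=
    ((isHolomorphic_jac hD hg).pow k).continuous.enorm.measurable.pow_const 2
  have hm' : Measurable fun w => ENNReal.ofReal (bergmanWeight D k w) :=
    (continuous_bergmanWeight hD hb k).measurable.ennreal_ofReal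
  have hgs := g.continuous.measurable hs
  rw [Measure.map_apply g.continuous.measurable hs, weightedVolume, ← withDensity_mul _ hm' hm,
    withDensity_apply _ hgs, withDensity_apply _ hs, ← lintegral_indicator hs,
    ← lintegral_comp_aut hD hg, ← lintegral_indicator hgs]
  refine lintegral_congr fun w => ?_
  by_cases h : g w ∈ s
  · have h' : w ∈ g ⁻¹' s := h
    rw [Set.indicator_of_mem h', Set.indicator_of_mem h, Pi.mul_apply, enorm_pow, ← pow_mul,
      ← ofReal_norm, ← ENNReal.ofReal_pow (norm_nonneg _), ← ENNReal.ofReal_pow (norm_nonneg _),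
      ← ENNReal.ofReal_mul (bergmanWeight_pos hD hb k w).le, ← ENNReal.ofReal_mul (by positivity),
      ← bergmanWeight_aut hD hb k hg w]
    congr 1
    ring
  · have h' : w ∉ g ⁻¹' s := h
    rw [Set.indicator_of_notMem h', Set.indicator_of_notMem h, mul_zero]

theorem integral_weightedVolume (hD : IsOpen D) (hb : Bornology.IsBounded D) (k : ℕ) (f : D → ℂ) :
    ∫ w, f w ∂(weightedVolume D (bergmanWeight D k)) =
      ∫ w, (bergmanWeight D k w : ℂ) * f w ∂(euclideanVolume D) := by
  rw [weightedVolume, integral_withDensity_eq_integral_toReal_smul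
    (continuous_bergmanWeight hD hb k).measurable.ennreal_ofReal
    (Eventually.of_forall fun w => ENNReal.ofReal_lt_top)]
  congr 1
  ext w
  rw [ENNReal.toReal_ofReal (bergmanWeight_pos hD hb k w).le, Complex.real_smul]

theorem integrable_sq_norm_bergmanKernel (hD : IsOpen D) (z : D) :
    Integrable (fun w => ‖bergmanKernel D w z‖ ^ 2) (euclideanVolume D) :=
  (memLp_two_iff_integrable_sq_norm
    ((isReproducingKernel_bergmanKernel hD).memLp z).1).1
    ((isReproducingKernel_bergmanKernel hD).memLp z)

/-- The comparison function `K(·, z)` is in `L²` by definition; both the powers `K(·, z)^k` and the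
products `H · K(·, z)^l` are dominated by it through Cauchy–Schwarz. -/
theorem memLp_weightedVolume (hD : IsOpen D) (hb : Bornology.IsBounded D) {k : ℕ} {f : D → ℂ}
    (hf : Continuous f) {z : D} {B : ℝ}
    (h : ∀ w, bergmanWeight D k w * ‖f w‖ ^ 2 ≤ B * ‖bergmanKernel D w z‖ ^ 2) :
    MemLp f 2 (weightedVolume D (bergmanWeight D k)) := by
  rw [memLp_two_iff_lintegral hf.aestronglyMeasurable, weightedVolume,
    lintegral_withDensity_eq_lintegral_mul_non_measurable _
      (continuous_bergmanWeight hD hb k).measurable.ennreal_ofReal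
      (Eventually.of_forall fun w => ENNReal.ofReal_lt_top)]
  have h1 := ((integrable_sq_norm_bergmanKernel hD z).const_mul B).lintegral_lt_top
  refine lt_of_le_of_lt (lintegral_mono fun w => ?_) h1
  rw [Pi.mul_apply, ← ofReal_norm, ← ENNReal.ofReal_pow (norm_nonneg _),
    ← ENNReal.ofReal_mul (bergmanWeight_pos hD hb k w).le]
  exact ENNReal.ofReal_le_ofReal (h w)

theorem memLp_bergmanKernel_pow (hD : IsOpen D) (hb : Bornology.IsBounded D) {k : ℕ} (hk : 1 ≤ k)
    (z : D) : MemLp (fun w => bergmanKernel D w z ^ k) 2 (weightedVolume D (bergmanWeight D k)) := by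
  obtain ⟨l, rfl⟩ := Nat.exists_eq_add_of_le hk
  refine memLp_weightedVolume hD hb (z := z) (B := bergmanRoot D z ^ (2 * l))
    (((isReproducingKernel_bergmanKernel hD).holomorphic z).pow _).continuous fun w => ?_
  have hs := bergmanRoot_pos hD hb w
  have h1 := pow_le_pow_left₀ (norm_nonneg _) (norm_bergmanKernel_le hD w z) (2 * l)
  rw [mul_pow] at h1
  rw [bergmanWeight, norm_pow, div_mul_eq_mul_div, div_le_iff₀ (by positivity)]
  calc bergmanRoot D w ^ 2 * (‖bergmanKernel D w z‖ ^ (1 + l)) ^ 2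
      = bergmanRoot D w ^ 2 * ‖bergmanKernel D w z‖ ^ 2 * ‖bergmanKernel D w z‖ ^ (2 * l) := by ring
    _ ≤ bergmanRoot D w ^ 2 * ‖bergmanKernel D w z‖ ^ 2 *
          (bergmanRoot D w ^ (2 * l) * bergmanRoot D z ^ (2 * l)) := by gcongr
    _ = _ := by ring

/-- The reproducing kernel of the weighted Bergman space is a multiple of the power of the Bergman
kernel. -/
theorem exists_isReproducingKernel_pow (hD : IsBoundedSymmetricDomain D) (k : ℕ) :
    ∃ a : ℂ, IsReproducingKernel (weightedVolume D (bergmanWeight D k))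
      fun z w => a * bergmanKernel D z w ^ k := by
  have hb := hD.isBounded
  have hK := isReproducingKernel_bergmanKernel hD.isOpen
  have hωc := continuous_bergmanWeight hD.isOpen hb k
  have hω0 := bergmanWeight_pos hD.isOpen hb k
  have := isOpenPosMeasure_weightedVolume hD.isOpen hωc hω0
  have hev := evalLocallyBounded_weightedVolume hD.isOpen hωc hω0
  have hev1 := evalLocallyBounded_weightedVolume hD.isOpen (ω := fun _ => 1) continuous_const
    fun _ => one_pos
  rw [weightedVolume_one] at hev1
  obtain ⟨L, hL⟩ := exists_isReproducingKernel hD.isOpen hev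
  -- On the diagonal `L` has the same multiplier `|J|^{2k}` as `K^k`, so by transitivity their
  -- quotient is the constant `a` read off at one point.
  have hcov : ∀ g ∈ Aut D, ∀ z, L (g z) (g z) * jac g z ^ k * starRingEnd ℂ (jac g z ^ k) = L z z :=
    fun g hg z => hL.covariant hg ((isHolomorphic_jac hD.isOpen hg).pow k)
      (fun z => pow_ne_zero _ (jac_ne_zero hD.isOpen hg z))
      (measurePreserving_weighted hD.isOpen hb k hg) z z
  have hK0 : ∀ z, bergmanKernel D z z ≠ 0 := fun z => by
    rw [bergmanKernel_self hD.isOpen]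
    exact_mod_cast (pow_pos (bergmanRoot_pos hD.isOpen hb z) 2).ne'
  obtain ⟨z₀, hz₀⟩ := hD.isConnected.nonempty
  set p : D := ⟨z₀, hz₀⟩
  set a := L p p / bergmanKernel D p p ^ k with ha
  have hdiag : ∀ z, L z z = a * bergmanKernel D z z ^ k := by
    intro z
    obtain ⟨g, hg, hgz⟩ := hD.transitive p z
    have h1 := hcov g hg p
    have h2 := bergmanKernel_aut hD.isOpen hg p p
    have hj := jac_ne_zero hD.isOpen hg p
    have hj' : starRingEnd ℂ (jac g p) ≠ 0 := by simpa using hj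
    rw [hgz] at h1 h2
    rw [ha, ← h1, ← h2, map_pow, mul_pow, mul_pow]
    have := hK0 z
    field_simp
  refine ⟨a, ?_⟩
  have heq : L = fun z w => a * bergmanKernel D z w ^ k := by
    -- Polarization applied to the difference, extended by zero because that lemma speaks of
    -- functions on the ambient space.
    set f : (Fin n → ℂ) → (Fin n → ℂ) → ℂ := fun z w =>
      Function.extend (Subtype.val : D → Fin n → ℂ) (fun z' : D =>
        Function.extend (Subtype.val : D → Fin n → ℂ)
          (fun w' : D => L z' w' - a * bergmanKernel D z' w' ^ k) 0 w) 0 z with hf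
    have hfv : ∀ z w : D, f z w = L z w - a * bergmanKernel D z w ^ k := by
      intro z w
      simp only [hf, extend_val _ z.2, extend_val _ w.2]
    have key := eq_zero_of_diagonal_eq_zero (f := f) hD.isOpen hD.isConnected.isPreconnected
      ?_ ?_ ?_ ?_
    · ext z w
      have := key z z.2 w w.2
      rw [hfv] at this
      exact sub_eq_zero.1 this
    · intro w hw
      have : IsHolomorphic fun z => L z ⟨w, hw⟩ - a * bergmanKernel D z ⟨w, hw⟩ ^ k :=
        (hL.holomorphic _).sub (((hK.holomorphic _).pow k).const_mul a)
      refine DifferentiableOn.congr this fun z hz => ?_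
      rw [extend_val _ hz]
      exact hfv ⟨z, hz⟩ ⟨w, hw⟩
    · intro z hz
      have : IsHolomorphic fun w => L w ⟨z, hz⟩ -
          starRingEnd ℂ a * bergmanKernel D w ⟨z, hz⟩ ^ k :=
        (hL.holomorphic _).sub (((hK.holomorphic _).pow k).const_mul _)
      refine DifferentiableOn.congr this fun w hw => ?_
      rw [extend_val _ hw, hfv ⟨z, hz⟩ ⟨w, hw⟩, map_sub, map_mul, map_pow, ← hL.hermitian,
        ← hK.hermitian]
    · intro z hz
      obtain ⟨r₁, hr₁, M₁, hM₁⟩ := hL.locally_bounded hev ⟨z, hz⟩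
      obtain ⟨r₂, hr₂, M₂, hM₂⟩ := hK.locally_bounded hev1 ⟨z, hz⟩
      obtain ⟨r₃, hr₃, hsub⟩ := Metric.isOpen_iff.1 hD.isOpen z hz
      refine ⟨min r₁ (min r₂ r₃), by positivity, M₁ + ‖a‖ * M₂ ^ k, fun u hu v hv => ?_⟩
      simp only [Metric.mem_ball, lt_min_iff] at hu hv
      have huD : u ∈ D := hsub hu.2.2
      have hvD : v ∈ D := hsub hv.2.2
      rw [hfv ⟨u, huD⟩ ⟨v, hvD⟩]
      refine (norm_sub_le _ _).trans (add_le_add (hM₁ _ hu.1 _ hv.1) ?_)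
      rw [norm_mul, norm_pow]
      exact mul_le_mul_of_nonneg_left (pow_le_pow_left₀ (norm_nonneg _)
        (hM₂ ⟨u, huD⟩ hu.2.1 ⟨v, hvD⟩ hv.2.1) k) (norm_nonneg _)
    · intro z hz
      rw [hfv ⟨z, hz⟩ ⟨z, hz⟩, hdiag, sub_self]
  rwa [← heq]

/-- `c(D, k) K(z, w) ^ k` is the reproducing kernel of the weighted Bergman space. -/
theorem isReproducingKernel_weightConst (hD : IsBoundedSymmetricDomain D) {k : ℕ} (hk : 1 ≤ k) :
    IsReproducingKernel (weightedVolume D (bergmanWeight D k))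
      (fun z w => weightConst D k * bergmanKernel D z w ^ k) ∧ IsWeightConst D k (weightConst D k) := by
  have hb := hD.isBounded
  have hK := isReproducingKernel_bergmanKernel hD.isOpen
  have hK0 : ∀ z, bergmanKernel D z z ≠ 0 := fun z => by
    rw [bergmanKernel_self hD.isOpen]
    exact_mod_cast (pow_pos (bergmanRoot_pos hD.isOpen hb z) 2).ne'
  obtain ⟨a, ha⟩ := exists_isReproducingKernel_pow hD k
  have hwc : IsWeightConst D k a := by
    intro z
    have h1 := ha.reproducing _ ((hK.holomorphic z).pow k) (memLp_bergmanKernel_pow hD.isOpen hb hk z) z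
    rw [h1, integral_weightedVolume hD.isOpen hb, ← integral_const_mul]
    congr 1
    ext w
    have h2 : (bergmanWeight D k w : ℂ) = bergmanKernel D w w / bergmanKernel D w w ^ k := by
      rw [bergmanKernel_self hD.isOpen, bergmanWeight]
      push_cast
      rw [pow_mul]
    rw [h2]
    ring
  have hex : ∃ c, IsWeightConst D k c := ⟨a, hwc⟩
  have hc : IsWeightConst D k (weightConst D k) := by
    rw [weightConst, dif_pos hex]
    exact hex.choose_spec
  obtain ⟨z₀, hz₀⟩ := hD.isConnected.nonempty
  -- The chosen constant must be `a`: the defining equation determines it, since `K(z,z)^k` is not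
  -- zero.
  have heq : weightConst D k = a := by
    have h1 := hwc ⟨z₀, hz₀⟩
    have h2 := hc ⟨z₀, hz₀⟩
    have h3 := h2.trans h1.symm
    refine mul_right_cancel₀ (fun h0 => ?_) h3
    rw [h0, mul_zero] at h1
    exact pow_ne_zero k (hK0 ⟨z₀, hz₀⟩) h1.symm
  exact ⟨heq ▸ ha, hc⟩

theorem weightConst_ne_zero (hD : IsBoundedSymmetricDomain D) {k : ℕ} (hk : 1 ≤ k) :
    weightConst D k ≠ 0 := by
  intro h
  obtain ⟨z₀, hz₀⟩ := hD.isConnected.nonempty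
  have h1 := (isReproducingKernel_weightConst hD hk).2 ⟨z₀, hz₀⟩
  rw [h, zero_mul, bergmanKernel_self hD.isOpen] at h1
  exact pow_ne_zero k (by exact_mod_cast
    (pow_pos (bergmanRoot_pos hD.isOpen hD.isBounded ⟨z₀, hz₀⟩) 2).ne') h1.symm

end Bergman

/-! ### The reproducing formula for functions of moderate growth. -/

section Reproducing

/-- If all moments of positive order of `b` with respect to `g` vanish, and `g` vanishes where `b`
does, then the moment of order zero vanishes. -/
theorem integral_eq_zero_of_moments {α : Type*} [MeasurableSpace α] {μ : Measure α} {g : α → ℂ}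
    {b : α → ℝ} (hg : Integrable g μ) (hb : Measurable b) (hb0 : ∀ x, 0 ≤ b x) (hb1 : ∀ x, b x ≤ 1)
    (hz : ∀ x, b x = 0 → g x = 0) (hmom : ∀ l : ℕ, 1 ≤ l → ∫ x, ((b x ^ l : ℝ) : ℂ) * g x ∂μ = 0) :
    ∫ x, g x ∂μ = 0 := by
  have hinteg : ∀ l N : ℕ, Integrable (fun x => ((b x ^ l * (1 - b x) ^ N : ℝ) : ℂ) * g x) μ := by
    intro l N
    refine hg.bdd_mul (c := 1) ?_ (Eventually.of_forall fun x => ?_)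
    · exact (Complex.measurable_ofReal.comp
        ((hb.pow_const l).mul ((measurable_const.sub hb).pow_const N))).aestronglyMeasurable
    · have h1 : 0 ≤ 1 - b x := by linarith [hb1 x]
      rw [Complex.norm_real, Real.norm_of_nonneg (mul_nonneg (pow_nonneg (hb0 x) _)
        (pow_nonneg h1 _))]
      exact mul_le_one₀ (pow_le_one₀ (hb0 x) (hb1 x)) (pow_nonneg h1 _)
        (pow_le_one₀ h1 (by linarith [hb0 x]))
  have hstep : ∀ l N : ℕ, ∫ x, ((b x ^ l * (1 - b x) ^ (N + 1) : ℝ) : ℂ) * g x ∂μ =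
      ∫ x, ((b x ^ l * (1 - b x) ^ N : ℝ) : ℂ) * g x ∂μ -
        ∫ x, ((b x ^ (l + 1) * (1 - b x) ^ N : ℝ) : ℂ) * g x ∂μ := by
    intro l N
    rw [← integral_sub (hinteg l N) (hinteg (l + 1) N)]
    congr 1
    ext x
    push_cast
    ring
  -- All integrals of `b^l (1 - b)^N g` with `l ≥ 1` vanish, so the integral of `(1 - b)^N g` does
  -- not depend on `N`; dominated convergence shows that it tends to zero.
  have hpos : ∀ N l : ℕ, 1 ≤ l → ∫ x, ((b x ^ l * (1 - b x) ^ N : ℝ) : ℂ) * g x ∂μ = 0 := by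
    intro N
    induction N with
    | zero => intro l hl; simpa using hmom l hl
    | succ N ih => intro l hl; rw [hstep, ih l hl, ih (l + 1) (by omega), sub_zero]
  have hall : ∀ N : ℕ, ∫ x, ((b x ^ 0 * (1 - b x) ^ N : ℝ) : ℂ) * g x ∂μ = ∫ x, g x ∂μ := by
    intro N
    induction N with
    | zero => simp
    | succ N ih => rw [hstep, ih, hpos N 1 le_rfl, sub_zero]
  have hlim : Tendsto (fun N : ℕ => ∫ x, ((b x ^ 0 * (1 - b x) ^ N : ℝ) : ℂ) * g x ∂μ) atTop
      (𝓝 (∫ _, (0 : ℂ) ∂μ)) := by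
    refine tendsto_integral_of_dominated_convergence (fun x => ‖g x‖)
      (fun N => (hinteg 0 N).1) hg.norm (fun N => Eventually.of_forall fun x => ?_)
      (Eventually.of_forall fun x => ?_)
    · have h1 : 0 ≤ 1 - b x := by linarith [hb1 x]
      rw [norm_mul, Complex.norm_real, pow_zero, one_mul, Real.norm_of_nonneg (pow_nonneg h1 _)]
      exact mul_le_of_le_one_left (norm_nonneg _) (pow_le_one₀ h1 (by linarith [hb0 x]))
    · rcases (hb0 x).eq_or_lt with h | h
      · simp [hz x h.symm]
      · have h1 := tendsto_pow_atTop_nhds_zero_of_lt_one (r := 1 - b x) (by linarith [hb1 x])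
          (by linarith)
        have h2 : Tendsto (fun N : ℕ => (((1 - b x) ^ N : ℝ) : ℂ)) atTop (𝓝 ((0 : ℝ) : ℂ)) :=
          (Complex.continuous_ofReal.tendsto 0).comp h1
        simpa using h2.mul_const (g x)
  simp only [hall, integral_zero] at hlim
  exact tendsto_nhds_unique tendsto_const_nhds hlim

variable {n : ℕ} {D : Set (Fin n → ℂ)}

theorem bergmanKernel_symm (hD : IsOpen D) (z w : D) :
    bergmanKernel D z w = starRingEnd ℂ (bergmanKernel D w z) :=
  (isReproducingKernel_bergmanKernel hD).hermitian z w

theorem norm_bergmanKernel_symm (hD : IsOpen D) (z w : D) :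
    ‖bergmanKernel D z w‖ = ‖bergmanKernel D w z‖ := by
  rw [bergmanKernel_symm hD, Complex.norm_conj]

theorem continuous_bergmanKernel_right (hD : IsOpen D) (z : D) :
    Continuous fun w => bergmanKernel D z w := by
  have h := ((isReproducingKernel_bergmanKernel hD).holomorphic z).continuous
  simp only [bergmanKernel_symm hD z]
  exact Complex.continuous_conj.comp h

/-- Cauchy–Schwarz for the last `k - 2` factors cancels the weight and leaves two factors for
integrability. It gives absolute convergence of the reproducing integral from weight two on. -/
theorem norm_mul_weight_le (hD : IsOpen D) (hb : Bornology.IsBounded D) {k : ℕ}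
    (hk : 2 ≤ k) (z w : D) :
    bergmanRoot D w ^ k * ‖bergmanKernel D w z‖ ^ k * bergmanWeight D k w ≤
      bergmanRoot D z ^ (k - 2) * ‖bergmanKernel D w z‖ ^ 2 := by
  obtain ⟨l, rfl⟩ := Nat.exists_eq_add_of_le hk
  have hs := bergmanRoot_pos hD hb w
  have h1 := pow_le_pow_left₀ (norm_nonneg _) (norm_bergmanKernel_le hD w z) l
  rw [mul_pow] at h1
  rw [bergmanWeight, mul_div_assoc', div_le_iff₀ (by positivity), Nat.add_sub_cancel_left]
  calc bergmanRoot D w ^ (2 + l) * ‖bergmanKernel D w z‖ ^ (2 + l) * bergmanRoot D w ^ 2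
      = bergmanRoot D w ^ (4 + l) * ‖bergmanKernel D w z‖ ^ 2 * ‖bergmanKernel D w z‖ ^ l := by
        ring
    _ ≤ bergmanRoot D w ^ (4 + l) * ‖bergmanKernel D w z‖ ^ 2 *
          (bergmanRoot D w ^ l * bergmanRoot D z ^ l) := by gcongr
    _ = _ := by ring

theorem integrable_mul_bergmanKernel_pow (hD : IsOpen D) (hb : Bornology.IsBounded D) {k : ℕ}
    (hk : 2 ≤ k) {H : D → ℂ} (hH : Continuous H) {C : ℝ}
    (hC : ∀ w, ‖H w‖ ≤ C * bergmanRoot D w ^ k) (z : D) :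
    Integrable (fun w => (bergmanWeight D k w : ℂ) * (H w * bergmanKernel D z w ^ k))
      (euclideanVolume D) := by
  have hC0 : 0 ≤ C := by
    have h1 := (norm_nonneg _).trans (hC z)
    exact nonneg_of_mul_nonneg_left h1 (pow_pos (bergmanRoot_pos hD hb z) k)
  refine ((integrable_sq_norm_bergmanKernel hD z).const_mul (C * bergmanRoot D z ^ (k - 2))).mono'
    ?_ (Eventually.of_forall fun w => ?_)
  · exact ((Complex.continuous_ofReal.comp (continuous_bergmanWeight hD hb k)).mul
      (hH.mul ((continuous_bergmanKernel_right hD z).pow k))).aestronglyMeasurable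
  · rw [norm_mul, norm_mul, norm_pow, Complex.norm_real,
      Real.norm_of_nonneg (bergmanWeight_pos hD hb k w).le, norm_bergmanKernel_symm hD z w]
    calc bergmanWeight D k w * (‖H w‖ * ‖bergmanKernel D w z‖ ^ k)
        ≤ bergmanWeight D k w * (C * bergmanRoot D w ^ k * ‖bergmanKernel D w z‖ ^ k) := by
          have := (bergmanWeight_pos hD hb k w).le
          gcongr
          exact hC w
      _ = C * (bergmanRoot D w ^ k * ‖bergmanKernel D w z‖ ^ k * bergmanWeight D k w) := by ring
      _ ≤ C * (bergmanRoot D z ^ (k - 2) * ‖bergmanKernel D w z‖ ^ 2) := by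
          exact mul_le_mul_of_nonneg_left (norm_mul_weight_le hD hb hk z w) hC0
      _ = _ := by ring

/-- `H` itself need not be square integrable for the weight `k`. Multiplication by `K(·, z)^l` with
`l ≥ 1` makes it so for the weight `k + l`, and the formula there yields the vanishing of the
positive moments of `b`. -/
theorem integral_eq_zero_of_apply_eq_zero (hD : IsBoundedSymmetricDomain D) {k : ℕ}
    (hk : 2 ≤ k) {H : D → ℂ} (hH : IsHolomorphic H) {C : ℝ}
    (hC : ∀ w, ‖H w‖ ≤ C * bergmanRoot D w ^ k) {z : D} (hz : H z = 0) :
    ∫ w, (bergmanWeight D k w : ℂ) * (H w * bergmanKernel D z w ^ k) ∂(euclideanVolume D) = 0 := by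
  have hO := hD.isOpen
  have hb := hD.isBounded
  have hs := bergmanRoot_pos hO hb
  -- Cauchy–Schwarz for the kernel gives `b ≤ 1`.
  set b : D → ℝ := fun w => ‖bergmanKernel D z w‖ ^ 2 / (bergmanRoot D z ^ 2 * bergmanRoot D w ^ 2)
    with hbdef
  have hbc : Continuous b := ((continuous_bergmanKernel_right hO z).norm.pow 2).div
    (continuous_const.mul ((continuous_bergmanRoot hO).pow 2)) fun w => by
      have := hs w; have := hs z; positivity
  refine integral_eq_zero_of_moments (integrable_mul_bergmanKernel_pow hO hb hk hH.continuous hC z)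
    hbc.measurable (fun w => by positivity) (fun w => ?_) (fun w hw => ?_) fun l hl => ?_
  · have h1 := hs w
    have h2 := hs z
    rw [hbdef, div_le_one (by positivity), ← mul_pow]
    exact pow_le_pow_left₀ (norm_nonneg _) (norm_bergmanKernel_le hO z w) 2
  · have h1 := hs w
    have h2 := hs z
    have h3 : bergmanRoot D z ^ 2 * bergmanRoot D w ^ 2 ≠ 0 := by positivity
    rw [hbdef, div_eq_zero_iff, or_iff_left h3] at hw
    have h4 : bergmanKernel D z w = 0 := norm_eq_zero.1 (pow_eq_zero_iff two_ne_zero |>.1 hw)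
    rw [h4, zero_pow (by omega), mul_zero, mul_zero]
  · have hKl := isReproducingKernel_bergmanKernel hO
    have hhol : IsHolomorphic fun w => H w * bergmanKernel D w z ^ l :=
      hH.mul ((hKl.holomorphic z).pow l)
    have hmem : MemLp (fun w => H w * bergmanKernel D w z ^ l) 2
        (weightedVolume D (bergmanWeight D (k + l))) := by
      refine memLp_weightedVolume hO hb (z := z) (B := C ^ 2 * bergmanRoot D z ^ (2 * (l - 1)))
        hhol.continuous fun w => ?_
      obtain ⟨q, rfl⟩ := Nat.exists_eq_add_of_le hl
      have hsw := hs w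
      have h1 := pow_le_pow_left₀ (norm_nonneg _) (norm_bergmanKernel_le hO w z) (2 * q)
      rw [mul_pow] at h1
      have h2 := pow_le_pow_left₀ (norm_nonneg _) (hC w) 2
      rw [Nat.add_sub_cancel_left, bergmanWeight, norm_mul, norm_pow, div_mul_eq_mul_div,
        div_le_iff₀ (by positivity)]
      calc bergmanRoot D w ^ 2 * (‖H w‖ * ‖bergmanKernel D w z‖ ^ (1 + q)) ^ 2
          = bergmanRoot D w ^ 2 * ‖H w‖ ^ 2 * ‖bergmanKernel D w z‖ ^ 2 *
              ‖bergmanKernel D w z‖ ^ (2 * q) := by ring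
        _ ≤ bergmanRoot D w ^ 2 * (C * bergmanRoot D w ^ k) ^ 2 * ‖bergmanKernel D w z‖ ^ 2 *
              (bergmanRoot D w ^ (2 * q) * bergmanRoot D z ^ (2 * q)) := by gcongr
        _ = _ := by ring
    have hrep := (isReproducingKernel_weightConst hD (by omega : 1 ≤ k + l)).1.reproducing _ hhol
      hmem z
    rw [hz, zero_mul, integral_weightedVolume hO hb] at hrep
    -- Passing from weight `k` to weight `k + l` multiplies the integrand by `b^l`, up to a nonzero
    -- constant.
    have heq : ∀ w, (bergmanWeight D (k + l) w : ℂ) * (H w * bergmanKernel D w z ^ l *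
        (weightConst D (k + l) * bergmanKernel D z w ^ (k + l))) =
        (weightConst D (k + l) * (bergmanRoot D z : ℂ) ^ (2 * l)) * (((b w ^ l : ℝ) : ℂ) *
          ((bergmanWeight D k w : ℂ) * (H w * bergmanKernel D z w ^ k))) := by
      intro w
      have h1 : (bergmanRoot D w : ℂ) ≠ 0 := by exact_mod_cast (hs w).ne'
      have h2 : (bergmanRoot D z : ℂ) ≠ 0 := by exact_mod_cast (hs z).ne'
      have h3 : ((‖bergmanKernel D z w‖ : ℝ) : ℂ) ^ 2 =
          bergmanKernel D w z * bergmanKernel D z w := by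
        rw [bergmanKernel_symm hO w z, mul_comm, Complex.mul_conj, Complex.normSq_eq_norm_sq]
        push_cast
        rfl
      rw [hbdef, bergmanWeight, bergmanWeight]
      push_cast
      rw [h3, div_pow, mul_pow, mul_pow, ← pow_mul, ← pow_mul]
      field_simp
      ring
    simp only [heq] at hrep
    rw [integral_const_mul] at hrep
    have h1 : (bergmanRoot D z : ℂ) ≠ 0 := by exact_mod_cast (hs z).ne'
    exact (mul_eq_zero.1 hrep.symm).resolve_left (mul_ne_zero
      (weightConst_ne_zero hD (by omega)) (pow_ne_zero _ h1))

/-- The reproducing formula for holomorphic functions that grow at most like `K(w, w) ^ (k / 2)`. -/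
theorem reproducing_of_growth (hD : IsBoundedSymmetricDomain D) {k : ℕ}
    (hk : 2 ≤ k) {H : D → ℂ} (hH : IsHolomorphic H) {C : ℝ}
    (hC : ∀ w, ‖H w‖ ≤ C * bergmanRoot D w ^ k) (z : D) :
    H z = weightConst D k *
      ∫ w, (bergmanWeight D k w : ℂ) * (H w * bergmanKernel D z w ^ k) ∂(euclideanVolume D) := by
  have hO := hD.isOpen
  have hb := hD.isBounded
  have hK := isReproducingKernel_bergmanKernel hO
  have hKC : ∀ w, ‖bergmanKernel D w z ^ k‖ ≤ bergmanRoot D z ^ k * bergmanRoot D w ^ k := by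
    intro w
    rw [norm_pow, ← mul_pow, mul_comm]
    exact pow_le_pow_left₀ (norm_nonneg _) (norm_bergmanKernel_le hO w z) k
  have hKh := (hK.holomorphic z).pow k
  have hKz : bergmanKernel D z z ^ k ≠ 0 := by
    rw [bergmanKernel_self hO]
    exact pow_ne_zero _ (by exact_mod_cast (pow_pos (bergmanRoot_pos hO hb z) 2).ne')
  -- The combination vanishes at `z`, and the formula is already known for `K(·, z)^k`, which is
  -- square integrable.
  have h0 := integral_eq_zero_of_apply_eq_zero hD hk (z := z)
    (H := fun w => bergmanKernel D z z ^ k * H w - H z * bergmanKernel D w z ^ k)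
    ((hH.const_mul _).sub (hKh.const_mul _))
    (C := ‖bergmanKernel D z z ^ k‖ * C + ‖H z‖ * bergmanRoot D z ^ k) (fun w => by
      refine (norm_sub_le _ _).trans ?_
      rw [norm_mul, norm_mul, add_mul, mul_assoc, mul_assoc]
      exact add_le_add (mul_le_mul_of_nonneg_left (hC w) (norm_nonneg _))
        (mul_le_mul_of_nonneg_left (hKC w) (norm_nonneg _))) (by ring)
  have hsplit : ∀ w, (bergmanWeight D k w : ℂ) * ((bergmanKernel D z z ^ k * H w -
      H z * bergmanKernel D w z ^ k) * bergmanKernel D z w ^ k) =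
      bergmanKernel D z z ^ k * ((bergmanWeight D k w : ℂ) * (H w * bergmanKernel D z w ^ k)) -
      H z * ((bergmanWeight D k w : ℂ) * (bergmanKernel D w z ^ k * bergmanKernel D z w ^ k)) := by
    intro w; ring
  simp only [hsplit] at h0
  rw [integral_sub ((integrable_mul_bergmanKernel_pow hO hb hk hH.continuous hC z).const_mul _)
    ((integrable_mul_bergmanKernel_pow hO hb hk hKh.continuous hKC z).const_mul _),
    integral_const_mul, integral_const_mul, sub_eq_zero] at h0
  have hrep := (isReproducingKernel_weightConst hD (by omega : 1 ≤ k)).1.reproducing _ hKh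
    (memLp_bergmanKernel_pow hO hb (by omega) z) z
  rw [integral_weightedVolume hO hb] at hrep
  have hrep' : bergmanKernel D z z ^ k = weightConst D k *
      ∫ w, (bergmanWeight D k w : ℂ) * (bergmanKernel D w z ^ k * bergmanKernel D z w ^ k)
        ∂(euclideanVolume D) := by
    rw [← integral_const_mul]
    refine hrep.trans ?_
    congr 1
    ext w
    ring
  refine mul_left_cancel₀ hKz ?_
  rw [mul_left_comm, h0, mul_left_comm, ← hrep', mul_comm]

end Reproducing

/-! ### Proper discontinuity of the action, by an invariant pseudodistance. -/

section ProperDiscontinuity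

variable {n : ℕ} {D : Set (Fin n → ℂ)}

/-- The Carathéodory-type pseudodistance of `z` and `w`, given by the holomorphic maps into the unit
disc, is at most `ε`. -/
def Near (ε : ℝ) (z w : D) : Prop :=
  ∀ f : D → ℂ, IsHolomorphic f → (∀ u, ‖f u‖ ≤ 1) → ‖f z - f w‖ ≤ ε

theorem Near.symm {ε : ℝ} {z w : D} (h : Near ε z w) : Near ε w z := fun f hf hf1 => by
  rw [norm_sub_rev]; exact h f hf hf1

theorem Near.trans {ε δ : ℝ} {z w u : D} (h : Near ε z w) (h' : Near δ w u) :
    Near (ε + δ) z u := fun f hf hf1 => by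
  linarith [norm_sub_le_norm_sub_add_norm_sub (f z) (f w) (f u), h f hf hf1, h' f hf hf1]

theorem Near.mono {ε δ : ℝ} {z w : D} (h : Near ε z w) (hεδ : ε ≤ δ) : Near δ z w :=
  fun f hf hf1 => (h f hf hf1).trans hεδ

theorem Near.aut {ε : ℝ} {z w : D} (h : Near ε z w) {g : D ≃ₜ D} (hg : g ∈ Aut D) :
    Near ε (g z) (g w) := fun _ hf hf1 => h _ (hf.comp hg.1) fun u => hf1 (g u)

theorem near_of_mem_ball {z w : D} {r : ℝ} (hr : Metric.ball (z : Fin n → ℂ) r ⊆ D)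
    (hw : w ∈ Metric.ball z r) : Near (2 / r * dist w z) w z := fun f hf hf1 => by
  simpa using hf.norm_sub_le hr (fun u _ => hf1 u) hw

theorem near_mem_nhds (hD : IsOpen D) (z : D) {ε : ℝ} (hε : 0 < ε) :
    {w | Near ε z w} ∈ 𝓝 z := by
  obtain ⟨r, hr, hsub⟩ := Metric.isOpen_iff.1 hD z z.2
  refine Filter.mem_of_superset (Metric.ball_mem_nhds z (ε := min r (ε * r / 2))
    (by positivity)) fun w hw => ?_
  have hw1 : dist w z < r := (Metric.mem_ball.1 hw).trans_le (min_le_left _ _)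
  have hw2 : dist w z < ε * r / 2 := (Metric.mem_ball.1 hw).trans_le (min_le_right _ _)
  refine ((near_of_mem_ball hsub hw1).mono ?_).symm
  rw [div_mul_eq_mul_div, div_le_iff₀ hr]
  linarith

/-- The coordinate functions divided by a bound for `D` are admissible test functions. Thus the
invariant pseudodistance dominates the Euclidean distance. -/
theorem exists_dist_le_of_near (hb : Bornology.IsBounded D) :
    ∃ R > 0, ∀ (ε : ℝ) (z w : D), Near ε z w → dist z w ≤ R * ε := by
  obtain ⟨R, hR, hRD⟩ := hb.exists_pos_norm_le
  refine ⟨R, hR, fun ε z w h => ?_⟩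
  have hε : 0 ≤ ε := by simpa using h (fun _ => 0) (isHolomorphic_const 0) (by simp)
  have hR' : ‖((R : ℝ) : ℂ)⁻¹‖ = R⁻¹ := by
    rw [norm_inv, Complex.norm_real, Real.norm_of_nonneg hR.le]
  rw [Subtype.dist_eq, dist_eq_norm, pi_norm_le_iff_of_nonneg (by positivity)]
  intro i
  have hid : IsHolomorphic fun u : D => (u : Fin n → ℂ) :=
    .of_differentiableOn differentiableOn_id fun _ => rfl
  have h1 := h (fun u => ((R : ℝ) : ℂ)⁻¹ * (u : Fin n → ℂ) i) ((hid.apply i).const_mul _)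
    fun u => by
      rw [norm_mul, hR', inv_mul_le_iff₀ hR, mul_one]
      exact (norm_le_pi_norm _ _).trans (hRD u u.2)
  rw [← mul_sub, norm_mul, hR', inv_mul_le_iff₀ hR] at h1
  exact h1

theorem isCompact_closedBall_of_subset {z : D} {r : ℝ}
    (h : Metric.closedBall (z : Fin n → ℂ) r ⊆ D) : IsCompact (Metric.closedBall z r) := by
  have h1 : Subtype.val '' Metric.closedBall z r = Metric.closedBall (z : Fin n → ℂ) r := ?_
  · rw [Subtype.isCompact_iff, h1]
    exact isCompact_closedBall _ r
  ext w
  constructor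
  · rintro ⟨u, hu, rfl⟩; exact hu
  · intro hw; exact ⟨⟨w, h hw⟩, hw, rfl⟩

theorem exists_closedBall_subset (hD : IsOpen D) (z : D) :
    ∃ r > 0, Metric.closedBall (z : Fin n → ℂ) r ⊆ D :=
  Metric.nhds_basis_closedBall.mem_iff.1 (hD.mem_nhds z.2)

/-- By homogeneity, neighbourhoods of a fixed size for the invariant pseudodistance are relatively
compact. -/
theorem exists_near_subset_isCompact (hD : IsBoundedSymmetricDomain D) :
    ∃ ε > 0, ∀ z : D, ∃ Q : Set D, IsCompact Q ∧ ∀ w, Near ε z w → w ∈ Q := by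
  obtain ⟨z₀, hz₀⟩ := hD.isConnected.nonempty
  obtain ⟨R, hR, hRn⟩ := exists_dist_le_of_near hD.isBounded
  obtain ⟨r, hr, hsub⟩ := exists_closedBall_subset hD.isOpen ⟨z₀, hz₀⟩
  refine ⟨r / R, by positivity, fun z => ?_⟩
  -- `Near` is invariant, so the size found at `z₀` is good at every point.
  obtain ⟨g, hg, hgz⟩ := hD.transitive z ⟨z₀, hz₀⟩
  refine ⟨g ⁻¹' Metric.closedBall ⟨z₀, hz₀⟩ r,
    g.isCompact_preimage.2 (isCompact_closedBall_of_subset hsub), fun w hw => ?_⟩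
  have h1 := hRn _ _ _ (hw.aut hg)
  rw [hgz, mul_div_cancel₀ _ hR.ne', dist_comm] at h1
  exact h1

/-- If a set of automorphisms moves one point into a compact set, it moves every point into a
compact set. -/
theorem exists_isCompact_forall_mem (hD : IsBoundedSymmetricDomain D) {S : Set (D ≃ₜ D)}
    (hS : S ⊆ Aut D) {z : D} {Q : Set D} (hQ : IsCompact Q) (hz : ∀ g ∈ S, g z ∈ Q) (x : D) :
    ∃ Q' : Set D, IsCompact Q' ∧ ∀ g ∈ S, g x ∈ Q' := by
  obtain ⟨ε, hε, hcomp⟩ := exists_near_subset_isCompact hD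
  choose P hP hPn using hcomp
  set B : Set D := {x | ∃ Q' : Set D, IsCompact Q' ∧ ∀ g ∈ S, g x ∈ Q'} with hB
  -- The step `ε / 2` does not depend on the point, so the set `B` of good points is both open and
  -- closed.
  have hstep : ∀ x ∈ B, ∀ y, Near (ε / 2) x y → y ∈ B := by
    rintro x ⟨Q', hQ', hx⟩ y hxy
    obtain ⟨t, -, ht⟩ := hQ'.elim_nhds_subcover (fun q => {w | Near (ε / 2) q w})
      fun q _ => near_mem_nhds hD.isOpen q (half_pos hε)
    refine ⟨⋃ q ∈ t, P q, t.isCompact_biUnion fun q _ => hP q, fun g hg => ?_⟩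
    obtain ⟨q, hq, hqn⟩ := Set.mem_iUnion₂.1 (ht (hx g hg))
    have h1 : Near (ε / 2) q (g x) := hqn
    have h2 := h1.trans (hxy.aut (hS hg))
    rw [add_halves] at h2
    exact Set.mem_iUnion₂.2 ⟨q, hq, hPn q _ h2⟩
  have : PreconnectedSpace D := Subtype.preconnectedSpace hD.isConnected.isPreconnected
  have hclopen : IsClopen B := by
    refine ⟨⟨isOpen_iff_mem_nhds.2 fun x hx => ?_⟩, isOpen_iff_mem_nhds.2 fun x hx => ?_⟩
    · refine Filter.mem_of_superset (near_mem_nhds hD.isOpen x (half_pos hε)) fun y hy hyB => hx ?_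
      exact hstep y hyB x (Near.symm hy)
    · exact Filter.mem_of_superset (near_mem_nhds hD.isOpen x (half_pos hε)) fun y hy =>
        hstep x hx y hy
  have huniv : B = Set.univ := hclopen.eq_univ ⟨z, Q, hQ, hz⟩
  have : x ∈ B := huniv ▸ Set.mem_univ x
  exact this

/-- Discreteness isolates the identity within `Γ` for uniform convergence on some compact set, and
`Near` controls the distances there. -/
theorem exists_near_imp_eq_one (hD : IsBoundedSymmetricDomain D) {Γ : Subgroup (D ≃ₜ D)}
    (hΓ : IsCocompactSmooth Γ) : ∃ L : Set D, IsCompact L ∧ ∃ ε > 0, ∀ γ ∈ Γ,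
      (∀ x ∈ L, Near ε (γ x) x) → γ = 1 := by
  obtain ⟨R, hR, hRn⟩ := exists_dist_le_of_near hD.isBounded
  obtain ⟨O, hO, hOid⟩ := isDiscrete_iff_forall_mem_exists_isOpen.1 hΓ.discrete
    ((1 : D ≃ₜ D) : C(D, D)) ⟨1, Γ.one_mem, rfl⟩
  have h1 : O ∈ 𝓝 ((1 : D ≃ₜ D) : C(D, D)) := by
    refine hO.mem_nhds ?_
    have : ((1 : D ≃ₜ D) : C(D, D)) ∈ ({((1 : D ≃ₜ D) : C(D, D))} : Set C(D, D)) := rfl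
    rw [← hOid] at this
    exact this.1
  rw [UniformSpace.mem_nhds_iff] at h1
  obtain ⟨W, hW, hWO⟩ := h1
  obtain ⟨L, U, hL, hU, hLU⟩ := ContinuousMap.mem_compactConvergence_entourage_iff W |>.1 hW
  obtain ⟨η, hη, hηU⟩ := Metric.mem_uniformity_dist.1 hU
  refine ⟨L, hL, η / (2 * R), by positivity, fun γ hγ hn => ?_⟩
  have h2 : (γ : C(D, D)) ∈ O := by
    refine hWO (hLU fun x hx => ?_)
    refine hηU ?_
    have h3 := hRn _ _ _ (hn x hx).symm
    have h4 : R * (η / (2 * R)) = η / 2 := by field_simp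
    rw [h4] at h3
    exact h3.trans_lt (half_lt_self hη)
  have h3 : (γ : C(D, D)) ∈ ({((1 : D ≃ₜ D) : C(D, D))} : Set C(D, D)) := by
    rw [← hOid]
    exact ⟨h2, γ, hγ, rfl⟩
  ext x : 1
  exact congr_arg (fun f : C(D, D) => f x) h3

/-- Discrete subgroups act properly discontinuously. -/
theorem finite_setOf_apply_mem (hD : IsBoundedSymmetricDomain D) {Γ : Subgroup (D ≃ₜ D)}
    (hΓ : IsCocompactSmooth Γ) (z : D) {Q : Set D} (hQ : IsCompact Q) :
    {γ : Γ | γ.1 z ∈ Q}.Finite := by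
  obtain ⟨L, hL, ε, hε, hone⟩ := exists_near_imp_eq_one hD hΓ
  have hO := hD.isOpen
  set S : Set (D ≃ₜ D) := {γ | γ ∈ Γ ∧ γ z ∈ Q} with hSdef
  have hSA : S ⊆ Aut D := fun γ hγ => hΓ.le_aut hγ.1
  obtain ⟨t, -, ht⟩ := hL.elim_nhds_subcover (fun q => {w | Near (ε / 3) q w})
    fun q _ => near_mem_nhds hO q (by positivity)
  choose P hP hPS using exists_isCompact_forall_mem hD hSA hQ fun γ hγ => hγ.2
  have hcov : ∀ x : D, ∃ T : Finset D, P x ⊆ ⋃ q ∈ T, {w | Near (ε / 6) q w} := by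
    intro x
    obtain ⟨T, -, hT⟩ := (hP x).elim_nhds_subcover (fun q => {w | Near (ε / 6) q w})
      fun q _ => near_mem_nhds hO q (by positivity)
    exact ⟨T, hT⟩
  choose T hT using hcov
  have hc : ∀ (γ : D ≃ₜ D) (x : D), ∃ q : D, γ ∈ S → q ∈ T x ∧ Near (ε / 6) q (γ x) := by
    intro γ x
    by_cases h : γ ∈ S
    · obtain ⟨q, hq, hqn⟩ := Set.mem_iUnion₂.1 (hT x (hPS x γ h))
      exact ⟨q, fun _ => ⟨hq, hqn⟩⟩
    · exact ⟨x, fun h' => absurd h' h⟩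
  choose c hc using hc
  -- Pigeonhole: record to precision `ε / 6` where `γ` sends the finite net `t` of `L`. Two elements
  -- with the same record differ on `L` by at most `ε/3 + (ε/6 + ε/6) + ε/3 = ε`, hence coincide.
  have hfin : S.Finite := by
    refine Set.Finite.of_injOn (f := fun γ (x : t) => c γ x)
      (t := Set.pi Set.univ fun x : t => (T x : Set D)) (fun γ hγ x _ => (hc γ x hγ).1) ?_
      (Set.Finite.pi fun x => (T x).finite_toSet)
    intro γ hγ γ' hγ' heq
    have hnear : ∀ x ∈ t, Near (ε / 6 + ε / 6) (γ x) (γ' x) := by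
      intro x hx
      have h1 := (hc γ x hγ).2
      have h2 := (hc γ' x hγ').2
      rw [← show c γ x = c γ' x from congr_fun heq ⟨x, hx⟩] at h2
      exact h1.symm.trans h2
    have h1 : γ'⁻¹ * γ = 1 := by
      refine hone _ (Γ.mul_mem (Γ.inv_mem hγ'.1) hγ.1) fun y hy => ?_
      obtain ⟨x, hx, hxy⟩ := Set.mem_iUnion₂.1 (ht hy)
      have h2 : Near (ε / 3) x y := hxy
      have h3 := ((h2.symm.aut (hSA hγ)).trans (hnear x hx)).trans (h2.aut (hSA hγ'))
      have h4 := (h3.mono (by linarith : _ ≤ ε)).aut ((Aut D).inv_mem (hSA hγ'))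
      have h5 : γ'⁻¹ (γ' y) = y := γ'.symm_apply_apply y
      rw [h5] at h4
      exact h4
    exact (inv_mul_eq_one.1 h1).symm
  exact (hfin.preimage Subtype.val_injective.injOn).subset fun γ hγ => ⟨γ.2, hγ⟩

/-- `D` is a countable union of compact sets, and each contains the images of a base point under
only finitely many elements. -/
theorem countable_of_isCocompactSmooth (hD : IsBoundedSymmetricDomain D) {Γ : Subgroup (D ≃ₜ D)}
    (hΓ : IsCocompactSmooth Γ) : Countable Γ := by
  obtain ⟨z₀, hz₀⟩ := hD.isConnected.nonempty
  have : LocallyCompactSpace D := hD.isOpen.locallyCompactSpace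
  have h : (⋃ i, {γ : Γ | γ.1 ⟨z₀, hz₀⟩ ∈ compactCovering D i}).Countable :=
    Set.countable_iUnion fun i =>
      (finite_setOf_apply_mem hD hΓ _ (isCompact_compactCovering D i)).countable
  refine Set.countable_univ_iff.1 (h.mono fun γ _ => ?_)
  exact Set.mem_iUnion.2 (exists_mem_compactCovering _)

/-- A point has a neighbourhood that meets only finitely many of its translates. -/
theorem exists_ball_finite (hD : IsBoundedSymmetricDomain D) {Γ : Subgroup (D ≃ₜ D)}
    (hΓ : IsCocompactSmooth Γ) (z : D) : ∃ r > 0, Metric.ball (z : Fin n → ℂ) r ⊆ D ∧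
      {γ : Γ | ∃ w ∈ Metric.ball z r, γ.1 w ∈ Metric.ball z r}.Finite := by
  obtain ⟨R, hR, hRn⟩ := exists_dist_le_of_near hD.isBounded
  obtain ⟨r₀, hr₀, hsub⟩ := exists_closedBall_subset hD.isOpen z
  have hsub' : Metric.ball (z : Fin n → ℂ) r₀ ⊆ D := Metric.ball_subset_closedBall.trans hsub
  -- The solution of `r + R · (2 / r₀) · r = r₀`: if `w` and `γ w` are within `r` of `z`, then `γ z`
  -- is within `r₀`.
  set r := r₀ / (1 + 2 * R / r₀) with hr
  have hr0 : 0 < r := by positivity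
  have hrr : r * (1 + 2 * R / r₀) = r₀ := by rw [hr]; field_simp
  have hle : r ≤ r₀ := by
    have : 0 ≤ r * (2 * R / r₀) := by positivity
    linarith
  refine ⟨r, hr0, (Metric.ball_subset_ball hle).trans hsub',
    (finite_setOf_apply_mem hD hΓ z (isCompact_closedBall_of_subset hsub)).subset ?_⟩
  rintro γ ⟨w, hw, hγw⟩
  have h1 := (near_of_mem_ball hsub' (Metric.ball_subset_ball hle hw)).aut (hΓ.le_aut γ.2)
  have h2 := hRn _ _ _ h1
  rw [Metric.mem_ball] at hw hγw
  have h3 : R * (2 / r₀ * dist w z) ≤ r * (2 * R / r₀) := by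
    have : R * (2 / r₀ * dist w z) = dist w z * (2 * R / r₀) := by ring
    rw [this]
    gcongr
  show dist (γ.1 z) z ≤ r₀
  linarith [dist_triangle_left (γ.1 z) z (γ.1 w)]

/-- The quotient is the image of a compact set. -/
theorem exists_isCompact_forall_exists_mem (hD : IsOpen D) {Γ : Subgroup (D ≃ₜ D)}
    (hΓ : IsCocompactSmooth Γ) : ∃ C : Set D, IsCompact C ∧ ∀ z : D, ∃ γ : Γ, γ.1 z ∈ C := by
  have : LocallyCompactSpace D := hD.locallyCompactSpace
  have : ContinuousConstSMul Γ D := ⟨fun γ => γ.1.continuous⟩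
  have := hΓ.compact
  let π : D → MulAction.orbitRel.Quotient Γ D := Quotient.mk''
  have hπ : IsOpenMap π := isOpenMap_quotient_mk'_mul
  choose N hN hNz using fun z : D => exists_compact_mem_nhds z
  obtain ⟨t, ht⟩ := isCompact_univ.elim_finite_subcover (fun z : D => π '' interior (N z))
    (fun z => hπ _ isOpen_interior) fun q _ => by
      obtain ⟨z, rfl⟩ := Quotient.mk''_surjective q
      exact Set.mem_iUnion.2 ⟨z, z, mem_interior_iff_mem_nhds.2 (hNz z), rfl⟩
  refine ⟨⋃ z ∈ t, N z, t.isCompact_biUnion fun z _ => hN z, fun z => ?_⟩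
  obtain ⟨x, hx, y, hy, hyz⟩ := Set.mem_iUnion₂.1 (ht (Set.mem_univ (π z)))
  have h1 : (MulAction.orbitRel Γ D) y z := Quotient.exact' hyz
  obtain ⟨γ, hγ⟩ := MulAction.orbitRel_apply.1 h1
  exact ⟨γ, Set.mem_iUnion₂.2 ⟨x, hx, by
    have : γ.1 z = y := hγ
    rw [this]; exact interior_subset hy⟩⟩

end ProperDiscontinuity

/-! ### Convergence and automorphy of the Poincaré series; growth of automorphic forms. -/

section Poincare

variable {n : ℕ} {D : Set (Fin n → ℂ)} {m : ℕ}

theorem poincareTerm_apply (Γ : Subgroup (D ≃ₜ D)) (ρ : Γ →* Matrix.unitaryGroup (Fin m) ℂ) (k : ℕ)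
    (i j : Fin m) (p z : D) (γ : Γ) : poincareTerm Γ ρ k j p z γ i =
      (jac γ.1 z * bergmanKernel D (γ.1 z) p) ^ k * (ρ γ⁻¹ : Matrix (Fin m) (Fin m) ℂ) i j := by
  rw [poincareTerm, Matrix.mulVec_single]
  simp only [Pi.smul_apply, smul_eq_mul, Matrix.col_apply, mul_pow]
  simp
  ring

theorem norm_poincareTerm_le (Γ : Subgroup (D ≃ₜ D)) (ρ : Γ →* Matrix.unitaryGroup (Fin m) ℂ)
    (k : ℕ) (j : Fin m) (p z : D) (γ : Γ) :
    ‖poincareTerm Γ ρ k j p z γ‖ ≤ ‖jac γ.1 z * bergmanKernel D (γ.1 z) p‖ ^ k := by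
  rw [pi_norm_le_iff_of_nonneg (by positivity)]
  intro i
  rw [poincareTerm_apply, norm_mul, norm_pow]
  exact mul_le_of_le_one_right (by positivity) (entry_norm_bound_of_unitary (ρ γ⁻¹).2 i j)

/-- The factor `|J(g, z)|` is absorbed by the covariance of `K(z,z)^{1/2}`, so the bound does not
depend on `g`. -/
theorem norm_jac_mul_bergmanKernel_le (hD : IsOpen D) {g : D ≃ₜ D} (hg : g ∈ Aut D) (z p : D) :
    ‖jac g z * bergmanKernel D (g z) p‖ ≤ bergmanRoot D z * bergmanRoot D p := by
  rw [norm_mul, ← bergmanRoot_aut hD hg z, mul_comm (bergmanRoot D (g z)), mul_assoc]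
  exact mul_le_mul_of_nonneg_left (norm_bergmanKernel_le hD _ _) (norm_nonneg _)

/-- Bounded overlap of the translates of `B`: if both `γ⁻¹ u` and `γ₀⁻¹ u` lie in `B`, then `γ⁻¹ γ₀`
moves a point of `B` into `B`, which leaves finitely many `γ`. -/
theorem tsum_indicator_ball_le {Γ : Subgroup (D ≃ₜ D)} {B : Set D}
    (hfin : {γ : Γ | ∃ w ∈ B, γ.1 w ∈ B}.Finite) (u : D) (c : ENNReal) :
    ∑' γ : Γ, B.indicator (fun _ => c) (γ.1⁻¹ u) ≤ hfin.toFinset.card * c := by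
  classical
  by_cases h : ∃ γ₀ : Γ, γ₀.1⁻¹ u ∈ B
  · obtain ⟨γ₀, hγ₀⟩ := h
    set S := {γ : Γ | ∃ w ∈ B, γ.1 w ∈ B}
    calc ∑' γ : Γ, B.indicator (fun _ => c) (γ.1⁻¹ u)
        ≤ ∑' γ : Γ, S.indicator (fun _ => c) (γ⁻¹ * γ₀) := by
          refine ENNReal.tsum_le_tsum fun γ => ?_
          by_cases hγ : γ.1⁻¹ u ∈ B
          · have : γ⁻¹ * γ₀ ∈ S := by
              refine ⟨γ₀.1⁻¹ u, hγ₀, ?_⟩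
              have : (γ⁻¹ * γ₀).1 (γ₀.1⁻¹ u) = γ.1⁻¹ u := by
                show γ.1⁻¹ (γ₀.1 (γ₀.1⁻¹ u)) = _
                congr 1
                exact γ₀.1.apply_symm_apply u
              rwa [this]
            rw [Set.indicator_of_mem hγ, Set.indicator_of_mem this]
          · rw [Set.indicator_of_notMem hγ]
            exact zero_le
      _ = ∑' γ : Γ, S.indicator (fun _ => c) γ :=
          ((Equiv.inv Γ).trans (Equiv.mulRight γ₀)).tsum_eq (S.indicator fun _ => c)
      _ = ∑ γ ∈ hfin.toFinset, S.indicator (fun _ => c) γ := by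
          refine tsum_eq_sum fun γ hγ => ?_
          rw [Set.Finite.mem_toFinset] at hγ
          exact Set.indicator_of_notMem hγ _
      _ = _ := by
          rw [Finset.sum_congr rfl fun γ hγ => Set.indicator_of_mem
            ((Set.Finite.mem_toFinset hfin).1 hγ) _, Finset.sum_const, nsmul_eq_mul]
  · have h0 : ∀ γ : Γ, B.indicator (fun _ => c) (γ.1⁻¹ u) = 0 := fun γ =>
      Set.indicator_of_notMem (fun hγ => h ⟨γ, hγ⟩) _
    simp only [h0, tsum_zero, zero_le]

/-- The series of weight two converges locally uniformly. -/
theorem exists_summable_bound_two (hD : IsBoundedSymmetricDomain D) {Γ : Subgroup (D ≃ₜ D)}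
    (hΓ : IsCocompactSmooth Γ) (p z₀ : D) : ∃ r > 0, ∃ u : Γ → ℝ, Summable u ∧
      ∀ γ : Γ, ∀ z ∈ Metric.ball z₀ r, ‖jac γ.1 z * bergmanKernel D (γ.1 z) p‖ ^ 2 ≤ u γ := by
  have hO := hD.isOpen
  have := countable_of_isCocompactSmooth hD hΓ
  have hK := isReproducingKernel_bergmanKernel hO
  obtain ⟨r₀, hr₀, hsub, hfin⟩ := exists_ball_finite hD hΓ z₀
  set B := Metric.ball z₀ r₀ with hB
  set v := volume (Metric.ball (0 : Fin n → ℂ) (r₀ / 2)) with hv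
  have hv0 : v ≠ 0 := (Metric.measure_ball_pos _ _ (half_pos hr₀)).ne'
  have hvt : v ≠ ⊤ := measure_ball_lt_top.ne
  -- The integral of `|K(u, p)|²` over the translate `γ B`. By bounded overlap the sum over `γ` is
  -- at most a multiple of `‖K(·, p)‖²`.
  set I : Γ → ENNReal := fun γ =>
    ∫⁻ u, B.indicator (fun _ => ‖bergmanKernel D u p‖ₑ ^ 2) (γ.1⁻¹ u) ∂(euclideanVolume D) with hI
  have hmeas : ∀ γ : Γ, Measurable fun u =>
      B.indicator (fun _ => ‖bergmanKernel D u p‖ₑ ^ 2) (γ.1⁻¹ u) := by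
    intro γ
    have h1 : MeasurableSet {u | γ.1⁻¹ u ∈ B} :=
      (Metric.isOpen_ball.preimage γ.1⁻¹.continuous).measurableSet
    have h2 : Measurable fun u => ‖bergmanKernel D u p‖ₑ ^ 2 :=
      (hK.holomorphic p).continuous.enorm.measurable.pow_const 2
    exact h2.indicator h1
  have hsum : ∑' γ, I γ ≠ ⊤ := by
    rw [hI, ← lintegral_tsum fun γ => (hmeas γ).aemeasurable]
    refine ne_top_of_le_ne_top ?_ (lintegral_mono fun u => tsum_indicator_ball_le hfin u _)
    rw [lintegral_const_mul' _ _ (ENNReal.natCast_ne_top _)]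
    refine ENNReal.mul_ne_top (ENNReal.natCast_ne_top _) ?_
    exact ((memLp_two_iff_lintegral (hK.memLp p).1).1 (hK.memLp p)).ne
  have hIt : ∀ γ, I γ ≠ ⊤ := ENNReal.ne_top_of_tsum_ne_top hsum
  refine ⟨r₀ / 2, half_pos hr₀, fun γ => (I γ).toReal / v.toReal,
    (ENNReal.summable_toReal hsum).div_const _, fun γ z hz => ?_⟩
  have hγ := hΓ.le_aut γ.2
  have hz' : dist z z₀ < r₀ / 2 := hz
  have hsub' : Metric.ball (z : Fin n → ℂ) (r₀ / 2) ⊆ D := by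
    refine (Metric.ball_subset_ball' ?_).trans hsub
    have : dist (z : Fin n → ℂ) z₀ < r₀ / 2 := hz
    linarith
  -- The mean value inequality on a polydisc inside `B`, after the substitution `u = γ w`, bounds
  -- the term by `I γ`.
  have hhol : IsHolomorphic fun w => jac γ.1 w * bergmanKernel D (γ.1 w) p :=
    (isHolomorphic_jac hO hγ).mul ((hK.holomorphic p).comp hγ.1)
  have h1 := hhol.sq_enorm_mul_le hO hsub'
  have h2 : ∫⁻ w in Metric.ball z (r₀ / 2), ‖jac γ.1 w * bergmanKernel D (γ.1 w) p‖ₑ ^ 2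
      ∂(euclideanVolume D) ≤ I γ := by
    rw [hI]
    simp only
    rw [← lintegral_comp_aut hO hγ, ← lintegral_indicator Metric.isOpen_ball.measurableSet]
    refine lintegral_mono fun w => ?_
    have hBB : Metric.ball z (r₀ / 2) ⊆ B := Metric.ball_subset_ball' (by linarith)
    refine Set.indicator_le_indicator_of_subset hBB
      (fun _ => zero_le) w |>.trans_eq ?_
    have h3 : γ.1⁻¹ (γ.1 w) = w := γ.1.symm_apply_apply w
    by_cases hw : w ∈ B
    · have hw' : γ.1⁻¹ (γ.1 w) ∈ B := by rwa [h3]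
      rw [Set.indicator_of_mem hw, Set.indicator_of_mem hw', enorm_mul, mul_pow]
    · have hw' : γ.1⁻¹ (γ.1 w) ∉ B := by rwa [h3]
      rw [Set.indicator_of_notMem hw, Set.indicator_of_notMem hw', mul_zero]
  have h3 := ENNReal.toReal_mono (hIt γ) (h1.trans h2)
  rw [ENNReal.toReal_mul, ENNReal.toReal_pow, toReal_enorm] at h3
  rwa [le_div_iff₀ (ENNReal.toReal_pos hv0 hvt)]

/-- The Poincaré series converges locally uniformly. -/
theorem exists_summable_bound (hD : IsBoundedSymmetricDomain D) {Γ : Subgroup (D ≃ₜ D)}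
    (hΓ : IsCocompactSmooth Γ) (ρ : Γ →* Matrix.unitaryGroup (Fin m) ℂ) {k : ℕ} (hk : 2 ≤ k)
    (j : Fin m) (p z₀ : D) : ∃ r > 0, ∃ u : Γ → ℝ, Summable u ∧
      ∀ γ : Γ, ∀ z ∈ Metric.ball z₀ r, ‖poincareTerm Γ ρ k j p z γ‖ ≤ u γ := by
  have hO := hD.isOpen
  have hs := bergmanRoot_pos hO hD.isBounded
  obtain ⟨r₁, hr₁, u, hu, hle⟩ := exists_summable_bound_two hD hΓ p z₀
  obtain ⟨r₂, hr₂, hM⟩ := Metric.eventually_nhds_iff_ball.1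
    ((continuous_bergmanRoot hO).continuousAt.eventually_lt_const (lt_add_one (bergmanRoot D z₀)))
  -- Two of the `k` factors supply the summable bound, and the other `l` are bounded uniformly in
  -- `γ`.
  obtain ⟨l, rfl⟩ := Nat.exists_eq_add_of_le hk
  refine ⟨min r₁ r₂, lt_min hr₁ hr₂,
    fun γ => u γ * ((bergmanRoot D z₀ + 1) * bergmanRoot D p) ^ l, hu.mul_right _, fun γ z hz => ?_⟩
  have h1 := hle γ z (Metric.ball_subset_ball (min_le_left _ _) hz)
  have h2 := hM z (Metric.ball_subset_ball (min_le_right _ _) hz)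
  refine (norm_poincareTerm_le Γ ρ _ j p z γ).trans ?_
  rw [pow_add]
  have h3 := norm_jac_mul_bergmanKernel_le hO (hΓ.le_aut γ.2) z p
  have h4 : ‖jac γ.1 z * bergmanKernel D (γ.1 z) p‖ ≤
      (bergmanRoot D z₀ + 1) * bergmanRoot D p :=
    h3.trans (mul_le_mul_of_nonneg_right h2.le (hs p).le)
  exact mul_le_mul h1 (pow_le_pow_left₀ (norm_nonneg _) h4 l) (by positivity)
    ((by positivity : (0 : ℝ) ≤ _).trans h1)

theorem summable_norm_poincareTerm (hD : IsBoundedSymmetricDomain D) {Γ : Subgroup (D ≃ₜ D)}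
    (hΓ : IsCocompactSmooth Γ) (ρ : Γ →* Matrix.unitaryGroup (Fin m) ℂ) {k : ℕ} (hk : 2 ≤ k)
    (j : Fin m) (p z : D) : Summable fun γ : Γ => ‖poincareTerm Γ ρ k j p z γ‖ := by
  obtain ⟨r, hr, u, hu, h⟩ := exists_summable_bound hD hΓ ρ hk j p z
  exact hu.of_nonneg_of_le (fun _ => norm_nonneg _) fun γ => h γ z (Metric.mem_ball_self hr)

theorem summable_poincareTerm (hD : IsBoundedSymmetricDomain D) {Γ : Subgroup (D ≃ₜ D)}
    (hΓ : IsCocompactSmooth Γ) (ρ : Γ →* Matrix.unitaryGroup (Fin m) ℂ) {k : ℕ} (hk : 2 ≤ k)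
    (j : Fin m) (p z : D) : Summable fun γ : Γ => poincareTerm Γ ρ k j p z γ :=
  (summable_norm_poincareTerm hD hΓ ρ hk j p z).of_norm

theorem poincareSeries_mem (hD : IsBoundedSymmetricDomain D) {Γ : Subgroup (D ≃ₜ D)}
    (hΓ : IsCocompactSmooth Γ) (ρ : Γ →* Matrix.unitaryGroup (Fin m) ℂ) {k : ℕ} (hk : 2 ≤ k)
    (j : Fin m) (p : D) : poincareSeries Γ ρ k j p ∈ automorphicForms Γ ρ k := by
  have hO := hD.isOpen
  have hK := isReproducingKernel_bergmanKernel hO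
  refine Submodule.smul_mem _ (weightConst D k)
    (x := fun z => ∑' γ : Γ, poincareTerm Γ ρ k j p z γ) ⟨?_, fun σ z => ?_⟩
  · have hterm : ∀ γ : Γ, IsHolomorphic fun z => poincareTerm Γ ρ k j p z γ := by
      intro γ
      have hγ := hΓ.le_aut γ.2
      have h1 : IsHolomorphic fun z => (jac γ.1 z * bergmanKernel D (γ.1 z) p) ^ k •
          fun i => (ρ γ⁻¹ : Matrix (Fin m) (Fin m) ℂ) i j :=
        (((isHolomorphic_jac hO hγ).mul ((hK.holomorphic p).comp hγ.1)).pow k).smul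
          (isHolomorphic_const _)
      refine h1.congr fun z => ?_
      ext i
      rw [poincareTerm_apply]
      rfl
    refine isHolomorphic_of_tendstoUniformlyOn (l := atTop) hO
      (F := fun (s : Finset Γ) z => ∑ γ ∈ s, poincareTerm Γ ρ k j p z γ)
      (fun s => IsHolomorphic.sum s fun γ _ => hterm γ) fun z => ?_
    obtain ⟨r, hr, u, hu, h⟩ := exists_summable_bound hD hΓ ρ hk j p z
    exact ⟨r, hr, tendstoUniformlyOn_tsum hu h⟩
  · have hL : (ρ σ : Matrix (Fin m) (Fin m) ℂ).mulVec (∑' γ : Γ, poincareTerm Γ ρ k j p z γ) =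
        ∑' γ : Γ, (ρ σ : Matrix (Fin m) (Fin m) ℂ).mulVec (poincareTerm Γ ρ k j p z γ) :=
      ((ρ σ : Matrix (Fin m) (Fin m) ℂ).mulVecLin.toContinuousLinearMap).map_tsum
        (summable_poincareTerm hD hΓ ρ hk j p z)
    simp only
    -- Reindexing by `γ ↦ γ σ` matches the two series term by term, by the chain rule and `ρ(σ)
    -- ρ((γσ)⁻¹) = ρ(γ⁻¹)`.
    rw [hL, ← (summable_poincareTerm hD hΓ ρ hk j p (σ.1 z)).tsum_const_smul,
      ← (Equiv.mulRight σ).tsum_eq fun γ =>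
        (ρ σ : Matrix (Fin m) (Fin m) ℂ).mulVec (poincareTerm Γ ρ k j p z γ)]
    refine tsum_congr fun γ => ?_
    have h1 : (ρ σ : Matrix (Fin m) (Fin m) ℂ) * (ρ (γ * σ)⁻¹ : Matrix (Fin m) (Fin m) ℂ) =
        (ρ γ⁻¹ : Matrix (Fin m) (Fin m) ℂ) := by
      rw [mul_inv_rev, map_mul, map_inv, Submonoid.coe_mul, ← mul_assoc, ← Submonoid.coe_mul,
        mul_inv_cancel, Submonoid.coe_one, one_mul]
    have h2 : jac (γ * σ).1 z = jac γ.1 (σ.1 z) * jac σ.1 z :=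
      jac_mul hO (hΓ.le_aut γ.2) (hΓ.le_aut σ.2) z
    have h3 : (γ * σ).1 z = γ.1 (σ.1 z) := rfl
    rw [Equiv.coe_mulRight, poincareTerm, poincareTerm, Matrix.mulVec_smul, Matrix.mulVec_mulVec,
      h1, h2, h3, smul_smul, mul_pow, mul_comm]

/-- Values of an automorphic form at equivalent points. -/
theorem norm_apply_le_of_mem {Γ : Subgroup (D ≃ₜ D)} {ρ : Γ →* Matrix.unitaryGroup (Fin m) ℂ}
    {k : ℕ} {F : D → Fin m → ℂ} (hF : F ∈ automorphicForms Γ ρ k) (γ : Γ) (z : D) (i : Fin m) :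
    ‖F z i‖ ≤ ‖jac γ.1 z‖ ^ k * ∑ j, ‖F (γ.1 z) j‖ := by
  have h1 : F z = (ρ γ⁻¹ : Matrix (Fin m) (Fin m) ℂ).mulVec (jac γ.1 z ^ k • F (γ.1 z)) := by
    rw [hF.2 γ z, Matrix.mulVec_mulVec, map_inv, ← Submonoid.coe_mul, inv_mul_cancel,
      Submonoid.coe_one, Matrix.one_mulVec]
  rw [h1, Matrix.mulVec, dotProduct, Finset.mul_sum]
  refine (norm_sum_le _ _).trans (Finset.sum_le_sum fun j _ => ?_)
  rw [norm_mul, Pi.smul_apply, norm_smul, norm_pow]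
  exact mul_le_of_le_one_left (by positivity) (entry_norm_bound_of_unitary (ρ γ⁻¹).2 i j)

/-- Automorphic forms for cocompact groups grow at most like `K(z, z) ^ (k / 2)`. -/
theorem exists_growth (hD : IsBoundedSymmetricDomain D) {Γ : Subgroup (D ≃ₜ D)}
    (hΓ : IsCocompactSmooth Γ) {ρ : Γ →* Matrix.unitaryGroup (Fin m) ℂ} {k : ℕ}
    {F : D → Fin m → ℂ} (hF : F ∈ automorphicForms Γ ρ k) :
    ∃ C : ℝ, ∀ z i, ‖F z i‖ ≤ C * bergmanRoot D z ^ k := by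
  have hO := hD.isOpen
  have hs := bergmanRoot_pos hO hD.isBounded
  obtain ⟨Q, hQ, hQΓ⟩ := exists_isCompact_forall_exists_mem hO hΓ
  have hFc : Continuous F := IsHolomorphic.continuous hF.1
  -- A bound for this quotient on a compact set meeting every orbit transports to all of `D`: the
  -- Jacobian factors cancel, and the unitary matrix has entries of modulus at most `1`.
  have hc : Continuous fun z => (bergmanRoot D z ^ k)⁻¹ * ∑ j, ‖F z j‖ := by
    refine (((continuous_bergmanRoot hO).pow k).inv₀ fun z => (pow_pos (hs z) k).ne').mul ?_
    exact continuous_finsetSum _ fun j _ => ((continuous_apply j).comp hFc).norm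
  obtain ⟨C, hC⟩ := hQ.exists_bound_of_continuousOn hc.continuousOn
  refine ⟨C, fun z i => ?_⟩
  obtain ⟨γ, hγ⟩ := hQΓ z
  have h1 := norm_apply_le_of_mem hF γ z i
  have h2 := (le_abs_self _).trans (hC _ hγ)
  rw [inv_mul_le_iff₀ (pow_pos (hs _) k)] at h2
  refine h1.trans ?_
  rw [← bergmanRoot_aut hO (hΓ.le_aut γ.2) z, mul_pow]
  calc ‖jac γ.1 z‖ ^ k * ∑ j, ‖F (γ.1 z) j‖ ≤ ‖jac γ.1 z‖ ^ k * (bergmanRoot D (γ.1 z) ^ k * C) :=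
        mul_le_mul_of_nonneg_left h2 (by positivity)
    _ = _ := by ring

end Poincare

/-! ### Finite dimension of the space of automorphic forms. -/

section FiniteDimensional

/-- A space of square integrable vector-valued functions for a finite measure on which point
evaluations are uniformly bounded has finite dimension. -/
theorem finiteDimensional_of_eval_bound {X : Type*} [MeasurableSpace X] {μ : Measure X}
    [IsFiniteMeasure μ] {m : ℕ} (A : Submodule ℂ (X → Fin m → ℂ))
    (hinteg : ∀ F ∈ A, ∀ G ∈ A, Integrable (fun x => ∑ i, starRingEnd ℂ (F x i) * G x i) μ)
    {S : Set X} (hS : ∀ᵐ x ∂μ, x ∈ S) {B : ℝ} (hB0 : 0 ≤ B)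
    (hB : ∀ F ∈ A, ∀ x ∈ S, ∀ i, ‖F x i‖ ^ 2 ≤ B * ∫ y, ∑ j, ‖F y j‖ ^ 2 ∂μ)
    (hdef : ∀ F ∈ A, (∀ x ∈ S, F x = 0) → F = 0) : FiniteDimensional ℂ A := by
  have hself : ∀ F : X → Fin m → ℂ, (∫ x, ∑ i, starRingEnd ℂ (F x i) * F x i ∂μ) =
      ((∫ x, ∑ i, ‖F x i‖ ^ 2 ∂μ : ℝ) : ℂ) := by
    intro F
    rw [← integral_complex_ofReal]
    congr 1
    ext x
    push_cast
    refine Finset.sum_congr rfl fun i _ => ?_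
    rw [mul_comm, Complex.mul_conj, Complex.normSq_eq_norm_sq]
    push_cast
    rfl
  let core : InnerProductSpace.Core ℂ A :=
    { inner := fun F G => ∫ x, ∑ i, starRingEnd ℂ (F.1 x i) * G.1 x i ∂μ
      conj_inner_symm := fun F G => by
        rw [← integral_conj]
        congr 1
        ext x
        rw [map_sum]
        refine Finset.sum_congr rfl fun i _ => ?_
        rw [map_mul, Complex.conj_conj, mul_comm]
      re_inner_nonneg := fun F => by
        rw [hself]
        exact integral_nonneg fun x => Finset.sum_nonneg fun i _ => by positivity
      add_left := fun F G H => by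
        rw [← integral_add (hinteg F.1 F.2 H.1 H.2) (hinteg G.1 G.2 H.1 H.2)]
        congr 1
        ext x
        rw [← Finset.sum_add_distrib]
        refine Finset.sum_congr rfl fun i _ => ?_
        rw [← add_mul, ← map_add]
        rfl
      smul_left := fun F G r => by
        rw [← integral_const_mul]
        congr 1
        ext x
        rw [Finset.mul_sum]
        refine Finset.sum_congr rfl fun i _ => ?_
        rw [← mul_assoc, ← map_mul]
        rfl
      definite := fun F hF => by
        rw [hself] at hF
        have h0 : ∫ x, ∑ i, ‖F.1 x i‖ ^ 2 ∂μ = 0 := by exact_mod_cast hF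
        refine Subtype.ext (hdef F.1 F.2 fun x hx => funext fun i => ?_)
        have h1 := hB F.1 F.2 x hx i
        rw [h0, mul_zero] at h1
        exact norm_eq_zero.1 (pow_eq_zero_iff two_ne_zero |>.1 (le_antisymm h1 (by positivity))) }
  let : NormedAddCommGroup A := core.toNormedAddCommGroup
  let : InnerProductSpace ℂ A := InnerProductSpace.ofCore core.toCore
  have hnorm : ∀ F : A, ‖F‖ ^ 2 = ∫ x, ∑ i, ‖F.1 x i‖ ^ 2 ∂μ := by
    intro F
    have h1 : ((‖F‖ : ℝ) : ℂ) ^ 2 = inner ℂ F F := (inner_self_eq_norm_sq_to_K F).symm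
    have h2 : inner ℂ F F = ((∫ x, ∑ i, ‖F.1 x i‖ ^ 2 ∂μ : ℝ) : ℂ) := hself F.1
    rw [h2] at h1
    exact_mod_cast h1
  have hsq : ∀ F : A, Integrable (fun x => ∑ i, ‖F.1 x i‖ ^ 2) μ := by
    intro F
    refine (hinteg F.1 F.2 F.1 F.2).re.congr (Eventually.of_forall fun x => ?_)
    simp only [map_sum]
    refine Finset.sum_congr rfl fun i _ => ?_
    rw [mul_comm, Complex.mul_conj, Complex.normSq_eq_norm_sq]
    rfl
  have hbound : ∀ N : ℕ, ∀ b : Fin N → A, Orthonormal ℂ b →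
      (N : ℝ) ≤ ∫ _, (m : ℝ) * B ∂μ := by
    intro N b hb
    have hpt : ∀ x ∈ S, ∀ i, ∑ a, ‖(b a).1 x i‖ ^ 2 ≤ B := by
      intro x hx i
      set T := ∑ a, ‖(b a).1 x i‖ ^ 2 with hT
      have hT0 : 0 ≤ T := Finset.sum_nonneg fun a _ => by positivity
      -- The extremal function for evaluation at `x`: both its `i`-th coordinate at `x` and its
      -- squared norm equal `T`, so the evaluation bound reads `T² ≤ B T`.
      set G : A := ∑ a, starRingEnd ℂ ((b a).1 x i) • b a with hG
      have h1 : G.1 x i = (T : ℂ) := by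
        rw [hG, hT]
        simp only [AddSubmonoidClass.coe_finsetSum, Finset.sum_apply]
        push_cast
        refine Finset.sum_congr rfl fun a _ => ?_
        show starRingEnd ℂ ((b a).1 x i) * (b a).1 x i = _
        rw [mul_comm, Complex.mul_conj, Complex.normSq_eq_norm_sq]
        push_cast
        rfl
      have h2 : ‖G‖ ^ 2 = T := by
        have h3 : ((‖G‖ : ℝ) : ℂ) ^ 2 = inner ℂ G G := (inner_self_eq_norm_sq_to_K G).symm
        rw [hG, hb.inner_sum] at h3
        have h4 : ((‖G‖ ^ 2 : ℝ) : ℂ) = ((T : ℝ) : ℂ) := by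
          rw [hT]
          push_cast
          rw [h3]
          refine Finset.sum_congr rfl fun a _ => ?_
          rw [mul_comm, Complex.mul_conj, Complex.normSq_eq_norm_sq, Complex.norm_conj]
          push_cast
          rfl
        exact_mod_cast h4
      have h3 := hB G.1 G.2 x hx i
      rw [← hnorm, h2, h1, Complex.norm_real, Real.norm_of_nonneg hT0] at h3
      rcases hT0.eq_or_lt with h | h
      · exact h ▸ hB0
      · rw [pow_two] at h3
        exact le_of_mul_le_mul_right h3 h
    -- Integrating the pointwise bound over the finite measure bounds the size of any orthonormal
    -- family.
    calc (N : ℝ) = ∑ a, ‖b a‖ ^ 2 := by simp [hb.1]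
      _ = ∑ a, ∫ x, ∑ i, ‖(b a).1 x i‖ ^ 2 ∂μ := Finset.sum_congr rfl fun a _ => hnorm _
      _ = ∫ x, ∑ a, ∑ i, ‖(b a).1 x i‖ ^ 2 ∂μ :=
          (integral_finsetSum _ fun a _ => hsq (b a)).symm
      _ ≤ ∫ _, (m : ℝ) * B ∂μ := by
          refine integral_mono_ae (integrable_finsetSum _ fun a _ => hsq (b a))
            (integrable_const _) ?_
          filter_upwards [hS] with x hx
          rw [Finset.sum_comm]
          refine (Finset.sum_le_sum fun i _ => hpt x hx i).trans_eq ?_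
          simp
  -- The span of a finite independent set has an orthonormal basis of the same size, so that size is
  -- bounded.
  refine Module.rank_lt_aleph0_iff.1 (lt_of_le_of_lt
    (rank_le (n := ⌈∫ _, (m : ℝ) * B ∂μ⌉₊) fun s hs => ?_)
    Cardinal.natCast_lt_aleph0)
  set W := Submodule.span ℂ (s : Set A) with hW
  have hfr : Module.finrank ℂ W = s.card := by
    have := finrank_span_eq_card hs
    have hr : Set.range (fun i : s => (i : A)) = s := by ext; simp
    rw [hr, Fintype.card_coe] at this
    exact this
  have hON := (stdOrthonormalBasis ℂ W).orthonormal.comp_linearIsometry W.subtypeₗᵢ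
  have := hbound _ _ hON
  rw [hfr] at this
  exact_mod_cast this.trans (Nat.le_ceil _)

variable {n : ℕ} {D : Set (Fin n → ℂ)} {m : ℕ}

/-- A compact set `C` meets every orbit and `S` is a compact neighbourhood of it. The mean value
inequality bounds a form on `C` by its `L²` norm on `S`, and automorphy extends the bound from `C`
to `S`. -/
theorem finiteDimensional_automorphicForms (hD : IsBoundedSymmetricDomain D)
    {Γ : Subgroup (D ≃ₜ D)} (hΓ : IsCocompactSmooth Γ) (ρ : Γ →* Matrix.unitaryGroup (Fin m) ℂ)
    (k : ℕ) : FiniteDimensional ℂ (automorphicForms Γ ρ k) := by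
  have hO := hD.isOpen
  have hs := bergmanRoot_pos hO hD.isBounded
  have := isFiniteMeasure_euclideanVolume hO hD.isBounded
  obtain ⟨C, hC, hCΓ⟩ := exists_isCompact_forall_exists_mem hO hΓ
  obtain ⟨δ, hδ, hδD⟩ := (hC.image continuous_subtype_val).exists_cthickening_subset_open hO
    (by rintro _ ⟨w, -, rfl⟩; exact w.2)
  set S : Set D := Subtype.val ⁻¹' Metric.cthickening δ (Subtype.val '' C) with hSdef
  have hSc : IsCompact S := by
    rw [Subtype.isCompact_iff, hSdef, Set.image_preimage_eq_inter_range, Subtype.range_coe,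
      Set.inter_eq_left.2 hδD]
    exact (hC.image continuous_subtype_val).cthickening
  have hCS : C ⊆ S := fun w hw => Metric.self_subset_cthickening _ ⟨w, hw, rfl⟩
  have hball : ∀ c ∈ C, Metric.ball (c : Fin n → ℂ) δ ⊆
      Metric.cthickening δ (Subtype.val '' C) := fun c hc =>
    (Metric.ball_subset_thickening (Set.mem_image_of_mem _ hc) δ).trans
      (Metric.thickening_subset_cthickening _ _)
  have hcont : ∀ F ∈ automorphicForms Γ ρ k, ∀ i, Continuous fun z => F z i := fun F hF i =>
    (IsHolomorphic.apply hF.1 i).continuous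
  have hsq : ∀ F ∈ automorphicForms Γ ρ k, ∀ i, IntegrableOn (fun w => ‖F w i‖ ^ 2) S
      (euclideanVolume D) := fun F hF i =>
    ((hcont F hF i).norm.pow 2).continuousOn.integrableOn_compact hSc
  set v := (volume (Metric.ball (0 : Fin n → ℂ) δ)).toReal with hv
  have hv0 : 0 < v := ENNReal.toReal_pos (Metric.measure_ball_pos _ _ hδ).ne' measure_ball_lt_top.ne
  have hpt : ∀ F ∈ automorphicForms Γ ρ k, ∀ c ∈ C, ∀ j, ‖F c j‖ ^ 2 * v ≤
      ∫ w in S, ‖F w j‖ ^ 2 ∂(euclideanVolume D) := by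
    intro F hF c hc j
    have h1 := (IsHolomorphic.apply hF.1 j).sq_enorm_mul_le hO ((hball c hc).trans hδD)
    have h2 : ∫⁻ w in Metric.ball c δ, ‖F w j‖ₑ ^ 2 ∂(euclideanVolume D) ≤
        ∫⁻ w in S, ‖F w j‖ₑ ^ 2 ∂(euclideanVolume D) :=
      lintegral_mono_set fun w hw => hball c hc hw
    have h3 : ∫⁻ w in S, ‖F w j‖ₑ ^ 2 ∂(euclideanVolume D) =
        ENNReal.ofReal (∫ w in S, ‖F w j‖ ^ 2 ∂(euclideanVolume D)) := by
      rw [ofReal_integral_eq_lintegral_ofReal (hsq F hF j)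
        (Eventually.of_forall fun w => by positivity)]
      refine lintegral_congr fun w => ?_
      rw [ENNReal.ofReal_pow (norm_nonneg _), ofReal_norm]
    have h4 := ENNReal.toReal_mono (by rw [h3]; exact ENNReal.ofReal_ne_top) (h1.trans h2)
    rwa [ENNReal.toReal_mul, ENNReal.toReal_pow, toReal_enorm, h3,
      ENNReal.toReal_ofReal (integral_nonneg fun w => by positivity)] at h4
  obtain ⟨M, hM⟩ := hSc.exists_bound_of_continuousOn (continuous_bergmanRoot hO).continuousOn
  obtain ⟨M', hM'⟩ := hC.exists_bound_of_continuousOn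
    ((continuous_bergmanRoot hO).inv₀ fun z => (hs z).ne').continuousOn
  refine finiteDimensional_of_eval_bound (μ := (euclideanVolume D).restrict S) (S := S)
    (B := ((M * M') ^ k) ^ 2 * (m * v⁻¹)) _ (fun F hF G hG => ?_)
    (ae_restrict_mem hSc.measurableSet) (by positivity) (fun F hF z hz i => ?_) fun F hF h0 => ?_
  · refine Continuous.continuousOn ?_ |>.integrableOn_compact hSc
    exact continuous_finsetSum _ fun i _ =>
      (Complex.continuous_conj.comp (hcont F hF i)).mul (hcont G hG i)
  · obtain ⟨γ, hγ⟩ := hCΓ z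
    have h1 := norm_apply_le_of_mem hF γ z i
    -- The Jacobian is the quotient of `K^{1/2}` on the diagonal at `z ∈ S` and at `γ z ∈ C`.
    have h2 : ‖jac γ.1 z‖ ≤ M * M' := by
      have e1 := bergmanRoot_aut hO (hΓ.le_aut γ.2) z
      have e2 : ‖jac γ.1 z‖ = bergmanRoot D z * (bergmanRoot D (γ.1 z))⁻¹ := by
        rw [← e1]
        have := (hs (γ.1 z)).ne'
        field_simp
      rw [e2]
      have e3 := (le_abs_self _).trans (hM z hz)
      have e4 := (le_abs_self _).trans (hM' _ hγ)
      exact mul_le_mul e3 e4 (inv_nonneg.2 (hs _).le) ((hs z).le.trans e3)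
    have h3 : (∑ j, ‖F (γ.1 z) j‖) ^ 2 ≤ m * ∑ j, ‖F (γ.1 z) j‖ ^ 2 := by
      simpa using sq_sum_le_card_mul_sum_sq (s := Finset.univ) (f := fun j => ‖F (γ.1 z) j‖)
    have h4 : ∑ j, ‖F (γ.1 z) j‖ ^ 2 ≤
        v⁻¹ * ∫ w in S, ∑ j, ‖F w j‖ ^ 2 ∂(euclideanVolume D) := by
      rw [integral_finsetSum _ fun j _ => hsq F hF j, Finset.mul_sum]
      refine Finset.sum_le_sum fun j _ => ?_
      rw [le_inv_mul_iff₀ hv0, mul_comm]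
      exact hpt F hF _ hγ j
    calc ‖F z i‖ ^ 2 ≤ (‖jac γ.1 z‖ ^ k * ∑ j, ‖F (γ.1 z) j‖) ^ 2 :=
          pow_le_pow_left₀ (norm_nonneg _) h1 2
      _ = (‖jac γ.1 z‖ ^ k) ^ 2 * (∑ j, ‖F (γ.1 z) j‖) ^ 2 := mul_pow _ _ _
      _ ≤ ((M * M') ^ k) ^ 2 * (m * (v⁻¹ * ∫ w in S, ∑ j, ‖F w j‖ ^ 2 ∂(euclideanVolume D))) := by
          refine mul_le_mul ?_ (h3.trans (mul_le_mul_of_nonneg_left h4 (Nat.cast_nonneg _)))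
            (by positivity) (by positivity)
          exact pow_le_pow_left₀ (by positivity) (pow_le_pow_left₀ (norm_nonneg _) h2 k) 2
      _ = _ := by ring
  · ext z i
    obtain ⟨γ, hγ⟩ := hCΓ z
    have h1 := norm_apply_le_of_mem hF γ z i
    rw [h0 _ (hCS hγ)] at h1
    simpa using h1

end FiniteDimensional

/-! ### Unfolding of integrals over the group. -/

section Unfolding

variable {n : ℕ} {D : Set (Fin n → ℂ)}

/-- A compactly supported measurable weight whose translates under the group sum to one. -/
theorem exists_weight_tsum_eq_one (hD : IsBoundedSymmetricDomain D) {Γ : Subgroup (D ≃ₜ D)}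
    (hΓ : IsCocompactSmooth Γ) : ∃ Q : Set D, IsCompact Q ∧ ∃ e : D → ENNReal, Measurable e ∧
      (∀ w ∉ Q, e w = 0) ∧ ∀ u, ∑' γ : Γ, e (γ.1⁻¹ u) = 1 := by
  have := countable_of_isCocompactSmooth hD hΓ
  obtain ⟨Q, hQ, hQΓ⟩ := exists_isCompact_forall_exists_mem hD.isOpen hΓ
  set b : D → ENNReal := Q.indicator fun _ => 1 with hbdef
  have hbm : Measurable b := measurable_const.indicator hQ.measurableSet
  -- `N` counts the elements of the group that move `w` into `Q`. It is invariant, finite and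
  -- nonzero, so dividing the indicator of `Q` by it gives the weight.
  set N : D → ENNReal := fun w => ∑' γ : Γ, b (γ.1 w) with hN
  have hNm : Measurable N := by
    exact Measurable.tsum fun γ => hbm.comp γ.1.continuous.measurable
  have hN0 : ∀ w, N w ≠ 0 := by
    intro w h0
    obtain ⟨γ, hγ⟩ := hQΓ w
    have := ENNReal.tsum_eq_zero.1 h0 γ
    rw [hbdef, Set.indicator_of_mem hγ] at this
    exact one_ne_zero this
  have hNt : ∀ w, N w ≠ ⊤ := by
    intro w
    have hfin := finite_setOf_apply_mem hD hΓ w hQ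
    have : N w = ∑ γ ∈ hfin.toFinset, b (γ.1 w) := tsum_eq_sum fun γ hγ => by
      rw [Set.Finite.mem_toFinset] at hγ
      exact Set.indicator_of_notMem (s := Q) (a := γ.1 w) hγ fun _ => (1 : ENNReal)
    rw [this]
    refine ENNReal.sum_ne_top.2 fun γ hγ => ?_
    rw [Set.Finite.mem_toFinset] at hγ
    have h1 : γ.1 w ∈ Q := hγ
    rw [hbdef, Set.indicator_of_mem h1]
    exact ENNReal.one_ne_top
  have hinv : ∀ (γ : Γ) w, N (γ.1⁻¹ w) = N w := fun γ w =>
    (Equiv.mulRight γ⁻¹).tsum_eq fun σ : Γ => b (σ.1 w)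
  refine ⟨Q, hQ, fun w => b w / N w, hbm.div hNm, fun w hw => ?_, fun u => ?_⟩
  · simp only [hbdef, Set.indicator_of_notMem hw, ENNReal.zero_div]
  · simp only [hinv, div_eq_mul_inv]
    rw [ENNReal.tsum_mul_right]
    have : ∑' γ : Γ, b (γ.1⁻¹ u) = N u := (Equiv.inv Γ).tsum_eq fun γ : Γ => b (γ.1 u)
    rw [this]
    exact ENNReal.mul_inv_cancel (hN0 u) (hNt u)

/-- Unfolding of an integral over a fundamental weight. -/
theorem integral_unfold (hO : IsOpen D) {Γ : Subgroup (D ≃ₜ D)} [Countable Γ] (hΓ : Γ ≤ Aut D)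
    {e : D → ENNReal} (he : Measurable e) (hsum : ∀ u, ∑' γ : Γ, e (γ.1⁻¹ u) = 1) {h : D → ℂ}
    (hc : Continuous h) (hi : Integrable h (euclideanVolume D)) :
    ∫ w, ((e w).toReal : ℂ) * ∑' γ : Γ, ((‖jac γ.1 w‖ ^ 2 : ℝ) : ℂ) * h (γ.1 w)
      ∂(euclideanVolume D) = ∫ u, h u ∂(euclideanVolume D) := by
  have het : ∀ (γ : Γ) u, e (γ.1⁻¹ u) ≠ ⊤ := fun γ u =>
    ENNReal.ne_top_of_tsum_ne_top (hsum u ▸ ENNReal.one_ne_top) γ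
  have hjc : ∀ γ : Γ, Continuous (jac γ.1) := fun γ =>
    (isHolomorphic_jac hO (hΓ γ.2)).continuous
  have hγγ : ∀ (γ : Γ) w, γ.1⁻¹ (γ.1 w) = w := fun γ w => γ.1.symm_apply_apply w
  -- These pieces of `h` sum to `h`, also in absolute value. This justifies both exchanges of sum
  -- and integral, before and after the change of variables in each term.
  set t : Γ → D → ℂ := fun γ u => ((e (γ.1⁻¹ u)).toReal : ℂ) * h u with ht
  have htm : ∀ γ, AEStronglyMeasurable (t γ) (euclideanVolume D) := fun γ =>
    (Complex.measurable_ofReal.comp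
      (he.comp γ.1⁻¹.continuous.measurable).ennreal_toReal).aestronglyMeasurable.mul
      hc.aestronglyMeasurable
  have hte : ∀ γ u, ‖t γ u‖ₑ = e (γ.1⁻¹ u) * ‖h u‖ₑ := fun γ u => by
    rw [ht, enorm_mul, ← ofReal_norm, Complex.norm_real, Real.norm_of_nonneg ENNReal.toReal_nonneg,
      ENNReal.ofReal_toReal (het γ u)]
  have htfin : ∑' γ, ∫⁻ u, ‖t γ u‖ₑ ∂(euclideanVolume D) ≠ ⊤ := by
    rw [← lintegral_tsum fun γ => (htm γ).enorm]
    simp only [hte, ENNReal.tsum_mul_right, hsum, one_mul]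
    exact hi.2.ne
  set s : Γ → D → ℂ := fun γ w =>
    ((e w).toReal : ℂ) * (((‖jac γ.1 w‖ ^ 2 : ℝ) : ℂ) * h (γ.1 w)) with hs
  have hst : ∀ γ w, s γ w = (‖jac γ.1 w‖ ^ 2 : ℝ) • t γ (γ.1 w) := fun γ w => by
    simp only [hs, ht, hγγ, Complex.real_smul]
    ring
  have hsm : ∀ γ, AEStronglyMeasurable (s γ) (euclideanVolume D) := fun γ =>
    (Complex.measurable_ofReal.comp he.ennreal_toReal).aestronglyMeasurable.mul
      ((Complex.continuous_ofReal.comp ((hjc γ).norm.pow 2)).mul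
        (hc.comp γ.1.continuous)).aestronglyMeasurable
  have hsfin : ∑' γ, ∫⁻ w, ‖s γ w‖ₑ ∂(euclideanVolume D) ≠ ⊤ := by
    convert htfin using 3 with γ
    rw [← lintegral_comp_aut hO (hΓ γ.2) fun u => ‖t γ u‖ₑ]
    refine lintegral_congr fun w => ?_
    rw [hst, enorm_smul, enorm_pow, enorm_norm]
  calc ∫ w, ((e w).toReal : ℂ) * ∑' γ : Γ, ((‖jac γ.1 w‖ ^ 2 : ℝ) : ℂ) * h (γ.1 w)
        ∂(euclideanVolume D) = ∫ w, ∑' γ, s γ w ∂(euclideanVolume D) := by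
        refine integral_congr_ae (Eventually.of_forall fun w => ?_)
        simp only [hs, tsum_mul_left]
    _ = ∑' γ, ∫ w, s γ w ∂(euclideanVolume D) := integral_tsum hsm hsfin
    _ = ∑' γ, ∫ u, t γ u ∂(euclideanVolume D) := by
        refine tsum_congr fun γ => ?_
        simp only [hst]
        exact integral_comp_of_measurePreserving (hjc γ).measurable
          (measurePreserving_aut hO (hΓ γ.2)) (t γ)
    _ = ∫ u, ∑' γ, t γ u ∂(euclideanVolume D) := (integral_tsum htm htfin).symm
    _ = ∫ u, h u ∂(euclideanVolume D) := by
        refine integral_congr_ae (Eventually.of_forall fun u => ?_)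
        have h1 : ∑' γ : Γ, ((e (γ.1⁻¹ u)).toReal : ℂ) = 1 := by
          rw [← Complex.ofReal_tsum, ← ENNReal.tsum_toReal_eq fun γ => het γ u, hsum]
          simp
        simp only [ht, tsum_mul_right, h1, one_mul]

end Unfolding

/-! ### The Petersson pairing and the spanning theorem. -/

section Pairing

variable {n : ℕ} {D : Set (Fin n → ℂ)} {m : ℕ}

/-- The Petersson pairing of automorphic forms, as an integral over `D` against a weight `e` whose
translates under the group sum to one. -/
def petersson (e : D → ENNReal) (k : ℕ) (F G : D → Fin m → ℂ) : ℂ :=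
  ∫ w, ((e w).toReal : ℂ) * ((bergmanWeight D k w : ℂ) * ∑ i, F w i * starRingEnd ℂ (G w i))
    ∂(euclideanVolume D)

theorem integrable_petersson (hD : IsBoundedSymmetricDomain D) {Q : Set D} (hQ : IsCompact Q)
    {e : D → ENNReal} (he : Measurable e) (he1 : ∀ w, e w ≤ 1) (he0 : ∀ w ∉ Q, e w = 0) (k : ℕ)
    {F G : D → Fin m → ℂ} (hF : Continuous F) (hG : Continuous G) :
    Integrable (fun w => ((e w).toReal : ℂ) * ((bergmanWeight D k w : ℂ) *
      ∑ i, F w i * starRingEnd ℂ (G w i))) (euclideanVolume D) := by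
  have hO := hD.isOpen
  have := isFiniteMeasure_euclideanVolume hO hD.isBounded
  have hc : Continuous fun w => (bergmanWeight D k w : ℂ) *
      ∑ i, F w i * starRingEnd ℂ (G w i) := by
    refine (Complex.continuous_ofReal.comp (continuous_bergmanWeight hO hD.isBounded k)).mul ?_
    exact continuous_finsetSum _ fun i _ => ((continuous_apply i).comp hF).mul
      (Complex.continuous_conj.comp ((continuous_apply i).comp hG))
  have h1 := (hc.continuousOn (s := Q)).integrableOn_compact (μ := euclideanVolume D) hQ
  rw [← integrable_indicator_iff hQ.measurableSet] at h1
  have h2 := h1.bdd_mul (c := 1) (f := fun w => ((e w).toReal : ℂ))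
    (Complex.measurable_ofReal.comp he.ennreal_toReal).aestronglyMeasurable
    (Eventually.of_forall fun w => by
      rw [Complex.norm_real, Real.norm_of_nonneg ENNReal.toReal_nonneg]
      exact ENNReal.toReal_le_of_le_ofReal zero_le_one (by simpa using he1 w))
  refine h2.congr (Eventually.of_forall fun w => ?_)
  by_cases hw : w ∈ Q
  · simp only [Set.indicator_of_mem hw]
  · simp [he0 w hw]

/-- The Poincaré series represent the evaluation functionals. -/
theorem apply_eq_zero_of_petersson (hD : IsBoundedSymmetricDomain D) {Γ : Subgroup (D ≃ₜ D)}
    (hΓ : IsCocompactSmooth Γ) {ρ : Γ →* Matrix.unitaryGroup (Fin m) ℂ} {k : ℕ} (hk : 2 ≤ k)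
    {e : D → ENNReal} (he : Measurable e) (hsum : ∀ u, ∑' γ : Γ, e (γ.1⁻¹ u) = 1)
    {F : D → Fin m → ℂ} (hF : F ∈ automorphicForms Γ ρ k) (j : Fin m) (p : D)
    (h0 : petersson e k F (poincareSeries Γ ρ k j p) = 0) : F p j = 0 := by
  have hO := hD.isOpen
  have hb := hD.isBounded
  have := countable_of_isCocompactSmooth hD hΓ
  have hc0 := weightConst_ne_zero hD (one_le_two.trans hk)
  obtain ⟨C, hC⟩ := exists_growth hD hΓ hF
  have hFj : IsHolomorphic fun w => F w j := IsHolomorphic.apply hF.1 j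
  set h : D → ℂ := fun w => (bergmanWeight D k w : ℂ) * (F w j * bergmanKernel D p w ^ k) with hh
  have hhc : Continuous h :=
    (Complex.continuous_ofReal.comp (continuous_bergmanWeight hO hb k)).mul
      (hFj.continuous.mul ((continuous_bergmanKernel_right hO p).pow k))
  have hhi : Integrable h (euclideanVolume D) :=
    integrable_mul_bergmanKernel_pow hO hb hk hFj.continuous (fun w => hC w j) p
  -- Unfolding turns the sum over `γ` into the reproducing integral of `F_j` at `p`, up to the
  -- nonzero constant.
  have key : petersson e k F (poincareSeries Γ ρ k j p) =
      starRingEnd ℂ (weightConst D k) * ∫ u, h u ∂(euclideanVolume D) := by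
    rw [← integral_unfold hO hΓ.le_aut he hsum hhc hhi, ← integral_const_mul, petersson]
    refine integral_congr_ae (Eventually.of_forall fun w => ?_)
    -- Unitarity moves `ρ(γ⁻¹)` across the pairing as `ρ(γ)`, and automorphy turns `ρ(γ) F(w)` into
    -- `J^k F(γ w)`. The Jacobian powers then convert the weight at `w` into the weight at `γ w`.
    have hterm : ∀ γ : Γ, (bergmanWeight D k w : ℂ) *
        ∑ i, F w i * starRingEnd ℂ (poincareTerm Γ ρ k j p w γ i) =
          ((‖jac γ.1 w‖ ^ 2 : ℝ) : ℂ) * h (γ.1 w) := by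
      intro γ
      have h1 : ∀ i, starRingEnd ℂ ((ρ γ⁻¹ : Matrix (Fin m) (Fin m) ℂ) i j) =
          (ρ γ : Matrix (Fin m) (Fin m) ℂ) j i := by
        intro i
        rw [map_inv, Matrix.UnitaryGroup.inv_apply, Matrix.star_apply]
        exact Complex.conj_conj _
      have h2 : ∑ i, (ρ γ : Matrix (Fin m) (Fin m) ℂ) j i * F w i =
          jac γ.1 w ^ k * F (γ.1 w) j := (congrFun (hF.2 γ w) j).symm
      have h3 : ∑ i, F w i * starRingEnd ℂ (poincareTerm Γ ρ k j p w γ i) =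
          starRingEnd ℂ (jac γ.1 w) ^ k * bergmanKernel D p (γ.1 w) ^ k *
            (jac γ.1 w ^ k * F (γ.1 w) j) := by
        rw [← h2, Finset.mul_sum]
        refine Finset.sum_congr rfl fun i _ => ?_
        rw [poincareTerm_apply, map_mul, map_pow, map_mul, h1, ← bergmanKernel_symm hO, mul_pow]
        ring
      have h4 : ((‖jac γ.1 w‖ ^ (2 * k) * bergmanWeight D k w : ℝ) : ℂ) =
          ((‖jac γ.1 w‖ ^ 2 * bergmanWeight D k (γ.1 w) : ℝ) : ℂ) := by
        rw [bergmanWeight_aut hO hb k (hΓ.le_aut γ.2)]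
      have h5 : (jac γ.1 w * starRingEnd ℂ (jac γ.1 w)) ^ k =
          ((‖jac γ.1 w‖ ^ (2 * k) : ℝ) : ℂ) := by
        rw [Complex.mul_conj, Complex.normSq_eq_norm_sq, pow_mul]
        push_cast
        rfl
      rw [h3, hh]
      push_cast at h4 h5 ⊢
      rw [← mul_assoc (_ ^ 2) (bergmanWeight D k (γ.1 w) : ℂ), ← h4, ← h5, mul_pow]
      ring
    have hs := summable_poincareTerm hD hΓ ρ hk j p w
    have hsi : ∀ i, Summable fun γ : Γ =>
        F w i * starRingEnd ℂ (poincareTerm Γ ρ k j p w γ i) := fun i =>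
      ((Pi.summable.1 hs i).map (starRingEnd ℂ) Complex.continuous_conj).mul_left _
    have h6 : ∑ i, F w i * starRingEnd ℂ (poincareSeries Γ ρ k j p w i) =
        starRingEnd ℂ (weightConst D k) *
          ∑' γ : Γ, ∑ i, F w i * starRingEnd ℂ (poincareTerm Γ ρ k j p w γ i) := by
      rw [Summable.tsum_finsetSum fun i _ => hsi i, Finset.mul_sum]
      refine Finset.sum_congr rfl fun i _ => ?_
      rw [poincareSeries, Pi.smul_apply, tsum_apply hs, smul_eq_mul, map_mul, Complex.conj_tsum,
        tsum_mul_left]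
      ring
    simp only
    rw [h6, ← tsum_congr hterm, tsum_mul_left]
    ring
  rw [key, mul_eq_zero] at h0
  have h7 := h0.resolve_left ((map_ne_zero _).2 hc0)
  have h8 := reproducing_of_growth hD hk hFj (fun w => hC w j) p
  rw [h8]
  exact mul_eq_zero_of_right _ h7

/-- The Poincaré series at points in general position span the space of automorphic forms. -/
theorem span_poincareSeries (hD : IsBoundedSymmetricDomain D) {Γ : Subgroup (D ≃ₜ D)}
    (hΓ : IsCocompactSmooth Γ) (ρ : Γ →* Matrix.unitaryGroup (Fin m) ℂ) {k : ℕ} (hk : 2 ≤ k)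
    {d : ℕ} {p : Fin d → D} (hp : InGeneralPosition Γ ρ k p) :
    Submodule.span ℂ (Set.range fun q : Fin d × Fin m => poincareSeries Γ ρ k q.2 (p q.1)) =
      automorphicForms Γ ρ k := by
  have hfd := finiteDimensional_automorphicForms hD hΓ ρ k
  have hcd : Countable Γ := countable_of_isCocompactSmooth hD hΓ
  obtain ⟨Q, hQ, e, he, he0, hsum⟩ := exists_weight_tsum_eq_one hD hΓ
  have he1 : ∀ w, e w ≤ 1 := fun w => by
    simpa using (ENNReal.le_tsum (f := fun γ : Γ => e (γ.1⁻¹ w)) 1).trans_eq (hsum w)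
  set W := Submodule.span ℂ
    (Set.range fun q : Fin d × Fin m => poincareSeries Γ ρ k q.2 (p q.1)) with hW
  have hWA : W ≤ automorphicForms Γ ρ k := by
    rw [hW, Submodule.span_le]
    rintro _ ⟨q, rfl⟩
    exact poincareSeries_mem hD hΓ ρ hk q.2 (p q.1)
  by_contra hne
  have hfw : FiniteDimensional ℂ W := Submodule.finiteDimensional_of_le hWA
  have hlt := Submodule.finrank_lt_finrank_of_lt (lt_of_le_of_ne hWA hne)
  have hcont : ∀ F ∈ automorphicForms Γ ρ k, Continuous F := fun F hF =>
    IsHolomorphic.continuous hF.1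
  have hinteg : ∀ F ∈ automorphicForms Γ ρ k, ∀ G ∈ automorphicForms Γ ρ k, _ := fun F hF G hG =>
    integrable_petersson hD hQ he he1 he0 k (hcont F hF) (hcont G hG)
  set b := Module.finBasis ℂ W with hbdef
  -- If `W` is a proper subspace, there are fewer orthogonality conditions than dimensions, so the
  -- kernel of `T` contains a nonzero form. Nondegeneracy of the pairing is not needed.
  let T : automorphicForms Γ ρ k →ₗ[ℂ] (Fin (Module.finrank ℂ W) → ℂ) :=
    { toFun := fun F a => petersson e k F.1 (b a).1
      map_add' := fun F G => by
        ext a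
        simp only [petersson, Pi.add_apply]
        rw [← integral_add (hinteg _ F.2 _ (hWA (b a).2)) (hinteg _ G.2 _ (hWA (b a).2))]
        congr 1
        ext w
        rw [← mul_add, ← mul_add, ← Finset.sum_add_distrib]
        simp only [← add_mul]
        rfl
      map_smul' := fun c F => by
        ext a
        simp only [petersson, Pi.smul_apply, smul_eq_mul, RingHom.id_apply]
        rw [← integral_const_mul]
        congr 1
        ext w
        have h : ∀ i, (c • F).1 w i * starRingEnd ℂ ((b a).1 w i) =
            c * (F.1 w i * starRingEnd ℂ ((b a).1 w i)) := fun i => mul_assoc _ _ _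
        rw [Finset.sum_congr rfl fun i _ => h i, ← Finset.mul_sum]
        ring }
  obtain ⟨F, hFT, hF0⟩ := Submodule.exists_mem_ne_zero_of_ne_bot
    (LinearMap.ker_ne_bot_of_finrank_lt (f := T) (by simpa using hlt))
  have hFb : ∀ a, petersson e k F.1 (b a).1 = 0 := fun a => congrFun (LinearMap.mem_ker.1 hFT) a
  -- The pairing is conjugate-linear in its second argument, so orthogonality to a basis suffices.
  have hpW : ∀ G ∈ W, petersson e k F.1 G = 0 := by
    intro G hG
    have hr : G = ∑ a, b.repr ⟨G, hG⟩ a • (b a).1 := by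
      have := congrArg Subtype.val (b.sum_repr ⟨G, hG⟩)
      simp only [AddSubmonoidClass.coe_finsetSum, Submodule.coe_smul] at this
      exact this.symm
    calc petersson e k F.1 G = ∑ a, starRingEnd ℂ (b.repr ⟨G, hG⟩ a) *
          petersson e k F.1 (b a).1 := by
          simp only [petersson, ← integral_const_mul]
          rw [← integral_finsetSum _ fun a _ => (hinteg _ F.2 _ (hWA (b a).2)).const_mul _]
          congr 1
          ext w
          have hi : ∀ i, starRingEnd ℂ (G w i) =
              ∑ a, starRingEnd ℂ (b.repr ⟨G, hG⟩ a) * starRingEnd ℂ ((b a).1 w i) := by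
            intro i
            have := congrArg (starRingEnd ℂ) (congrFun (congrFun hr w) i)
            rw [this]
            simp only [Finset.sum_apply, Pi.smul_apply, map_sum, smul_eq_mul, map_mul]
          simp only [hi, Finset.mul_sum]
          rw [Finset.sum_comm]
          refine Finset.sum_congr rfl fun a _ => Finset.sum_congr rfl fun i _ => ?_
          ring
      _ = 0 := Finset.sum_eq_zero fun a _ => by rw [hFb, mul_zero]
  have hFp : ∀ l, F.1 (p l) = 0 := fun l => funext fun j =>
    apply_eq_zero_of_petersson hD hΓ hk he hsum F.2 j (p l)
      (hpW _ (Submodule.subset_span ⟨(l, j), rfl⟩))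
  obtain ⟨φ, -, hφ⟩ := hp
  -- The hyperplane consists of the functionals that kill `F`.
  refine hφ ⟨LinearMap.ker (Module.Dual.eval ℂ (automorphicForms Γ ρ k) F), ?_, fun l => ?_⟩
  · refine LinearMap.isCoatom_ker_of_surjective (LinearMap.surjective fun h => ?_)
    exact hF0 ((Module.eval_apply_eq_zero_iff ℂ F).1 h)
  · show φ l (F.1 (p l)) = 0
    rw [hFp, map_zero]

end Pairing

/-! ### Generic points are in general position. -/

section Generic

variable {n : ℕ} {D : Set (Fin n → ℂ)} {m : ℕ}

/-- Otherwise some nonzero element of the bidual kills all evaluations. By reflexivity it is a form,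
and that form vanishes at every point. -/
theorem span_evalFunctional_eq_top (Γ : Subgroup (D ≃ₜ D))
    (ρ : Γ →* Matrix.unitaryGroup (Fin m) ℂ) (k : ℕ)
    [FiniteDimensional ℂ (automorphicForms Γ ρ k)] :
    Submodule.span ℂ (Set.range fun q : D × Fin m =>
      evalFunctional Γ ρ k q.1 (LinearMap.proj q.2)) = ⊤ := by
  by_contra hne
  obtain ⟨f, hf0, hf⟩ := Submodule.exists_le_ker_of_lt_top _ (lt_top_iff_ne_top.2 hne)
  obtain ⟨F, rfl⟩ := (Module.evalEquiv ℂ (automorphicForms Γ ρ k)).surjective f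
  refine hf0 ((map_eq_zero_iff _ (LinearEquiv.injective _)).2 (Subtype.ext ?_))
  ext z i
  exact hf (Submodule.subset_span ⟨(z, i), rfl⟩)

theorem holdsGenerically_inGeneralPosition (hD : D.Nonempty) {Γ : Subgroup (D ≃ₜ D)}
    (ρ : Γ →* Matrix.unitaryGroup (Fin m) ℂ) (hm : 0 < m) (k : ℕ)
    [FiniteDimensional ℂ (automorphicForms Γ ρ k)] {d : ℕ}
    (hd : Module.finrank ℂ (automorphicForms Γ ρ k) ≤ d) :
    HoldsGenerically fun p : Fin d → D => InGeneralPosition Γ ρ k p := by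
  set A := automorphicForms Γ ρ k
  set N := Module.finrank ℂ A with hN
  set b := Module.finBasis ℂ A
  obtain ⟨q, hq⟩ : ∃ q : Fin N → D × Fin m,
      LinearIndependent ℂ fun l => evalFunctional Γ ρ k (q l).1 (LinearMap.proj (q l).2) := by
    obtain ⟨f, hf, -, hli⟩ := Submodule.exists_fun_fin_finrank_span_eq ℂ
      (Set.range fun q : D × Fin m => evalFunctional Γ ρ k q.1 (LinearMap.proj q.2))
    have hcard : N = Module.finrank ℂ (Submodule.span ℂ (Set.range fun q : D × Fin m =>
        evalFunctional Γ ρ k q.1 (LinearMap.proj q.2))) := by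
      rw [span_evalFunctional_eq_top, finrank_top, Subspace.dual_finrank_eq]
    choose q hq using hf
    refine ⟨fun l => q (Fin.cast hcard l), ?_⟩
    simp only [hq]
    exact hli.comp _ (Fin.cast_injective hcard)
  obtain ⟨z₀⟩ := hD.to_subtype
  -- Beyond the first `N` indices coordinate and point are arbitrary; coordinate `0` exists because
  -- `m` is positive.
  let ι : Fin d → Fin m := fun l => if h : (l : ℕ) < N then (q ⟨l, h⟩).2 else ⟨0, hm⟩
  let p₀ : Fin d → D := fun l => if h : (l : ℕ) < N then (q ⟨l, h⟩).1 else z₀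
  have hι : ∀ l : Fin N, ι (Fin.castLE hd l) = (q l).2 := fun l => by simp [ι]
  have hp₀ : ∀ l : Fin N, p₀ (Fin.castLE hd l) = (q l).1 := fun l => by simp [p₀]
  let ev : (Fin d → D) → Fin N → Module.Dual ℂ A := fun p l =>
    evalFunctional Γ ρ k (p (Fin.castLE hd l)) (LinearMap.proj (ι (Fin.castLE hd l)))
  let M : (Fin d → Fin n → ℂ) → Matrix (Fin N) (Fin N) ℂ := fun p i l =>
    Function.extend Subtype.val (b i).1 0 (p (Fin.castLE hd l)) (ι (Fin.castLE hd l))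
  -- The matrix holds the coordinates of the `N` evaluations in the dual basis. So its determinant
  -- is nonzero exactly when they form a basis of the dual space, in which case no hyperplane
  -- contains them.
  have hM : ∀ p : Fin d → D, (M fun l => p l).det = b.dualBasis.det (ev p) := by
    intro p
    rw [Module.Basis.det_apply]
    congr 1
    ext i l
    rw [Module.Basis.toMatrix_apply, Module.Basis.dualBasis_repr]
    simp only [M]
    rw [extend_val _ (p _).2]
    rfl
  refine ⟨fun p => (M p).det, differentiableOn_det fun i l => ?_, ⟨p₀, ?_⟩, fun p hp => ?_⟩
  · have h1 : IsHolomorphic (b i).1 := (b i).2.1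
    have h2 := DifferentiableOn.comp (t := D) (s := {p : Fin d → Fin n → ℂ | ∀ l, p l ∈ D}) h1
      (differentiable_apply (𝕜 := ℂ) (Fin.castLE hd l)).differentiableOn fun p hp => hp _
    exact differentiableOn_pi.1 h2 (ι (Fin.castLE hd l))
  · simp only [hM]
    have h1 : LinearIndependent ℂ (ev p₀) := by
      simpa only [ev, hι, hp₀] using hq
    have h2 := (Module.Basis.is_basis_iff_det b.dualBasis).1 ⟨h1,
      h1.span_eq_top_of_card_eq_finrank' (by
      rw [Fintype.card_fin, Subspace.dual_finrank_eq])⟩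
    exact h2.ne_zero
  · simp only [hM] at hp
    have h1 := ((Module.Basis.is_basis_iff_det b.dualBasis).2 (isUnit_iff_ne_zero.2 hp)).2
    refine ⟨fun l => LinearMap.proj (ι l), fun l h => ?_, ?_⟩
    · have := LinearMap.congr_fun h (Pi.single (ι l) 1)
      simp at this
    · rintro ⟨S, hS, hSp⟩
      refine hS.1 (top_le_iff.1 (h1 ▸ Submodule.span_le.2 ?_))
      rintro _ ⟨l, rfl⟩
      exact hSp _

end Generic

end BoundedSymmetric

end

open BoundedSymmetric in
theorem theorem3p3 {n : ℕ} (hn : 0 < n) {D : Set (Fin n → ℂ)} (hD : IsBoundedSymmetricDomain D)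
    (Γ : Subgroup (D ≃ₜ D)) (hΓ : IsCocompactSmooth Γ) {m : ℕ} (hm : 0 < m)
    (ρ : Γ →* Matrix.unitaryGroup (Fin m) ℂ) :
    ∃ k₀ : ℕ, ∀ k ≥ k₀,
      (∀ (j : Fin m) (p z : D), Summable fun γ : Γ => ‖poincareTerm Γ ρ k j p z γ‖) ∧
      FiniteDimensional ℂ (automorphicForms Γ ρ k) ∧
      (∀ d ≥ Module.finrank ℂ (automorphicForms Γ ρ k),
        HoldsGenerically fun p : Fin d → D => InGeneralPosition Γ ρ k p) ∧
      ∀ (d : ℕ) (p : Fin d → D), InGeneralPosition Γ ρ k p →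
        Submodule.span ℂ
            (Set.range fun q : Fin d × Fin m => poincareSeries Γ ρ k q.2 (p q.1)) =
          automorphicForms Γ ρ k := by
  -- Weight two is where square integrability of the Bergman kernel gives absolute convergence.
  refine ⟨2, fun k hk => ?_⟩
  have hfd := finiteDimensional_automorphicForms hD hΓ ρ k
  exact ⟨fun j p z => summable_norm_poincareTerm hD hΓ ρ hk j p z, hfd,
    fun d hd => holdsGenerically_inGeneralPosition hD.isConnected.nonempty ρ hm k hd,
    fun d p hp => span_poincareSeries hD hΓ ρ hk hp⟩
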